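/- Let $M$ be a von Neumann algebra with a faithful normal tracial state $\varphi$, and let $X=\{x_1,\dots,x_n\}\subset M$ be a finite tuple of selfadjoint elements which generates $M$, i.e. $X''=M$. Let $\mathcal R$ be the hyperfinite $\mathrm{II}_1$-factor, with its faithful normal tracial state $\tau$, let $\omega$ be a nonprincipal ultrafilter on $\mathbb N$, and let $\mathcal R^\omega$ be the ultrapower, i.e. the quotient of $\ell^\infty(\mathcal R)$ by the ideal of all sequences $(a_j)_j$ with $\lim_{j\to\omega}\tau(a_j^*a_j)=0$, with the trace $(a_j)_j\mapsto\lim_{j\to\omega}\tau(a_j)$. An *embedding* of $M$ into $\mathcal R^\omega$ is a normal, injective, unital $*$-homomorphism $M\to\mathcal R^\omega$ which carries the trace of $\mathcal R^\omega$ back to $\varphi$. Assume that $M$ embeds into $\mathcal R^\omega$. For $m\in\mathbb N$, $k\ge 1$ and $\gamma>0$ let $\Gamma(X;m,k,\gamma)$ be the set of all $n$-tuples $(a_1,\dots,a_n)$ of selfadjoint $k\times k$ complex matrices with $$|tr_k(a_{i_1}\cdots a_{i_p})-\varphi(x_{i_1}\cdots x_{i_p})|<\gamma\qquad\text{for all }1\le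 p\le m,\ 1\le i_1,\dots,i_p\le n,$$ where $tr_k$ is the normalized trace. For an $n$-tuple $\zeta$ of selfadjoint $d\times d$ matrices put $|\zeta|_2=\big(\sum_{i=1}^n tr_d(\zeta_i^2)\big)^{1/2}$. Say that $X$ is *quasitubular* if for every $\varepsilon>0$ there exist $m\in\mathbb N$ and $\gamma>0$ such that for every $k\ge 1$ and all $\xi,\eta\in\Gamma(X;m,k,\gamma)$ there exist $p\ge 1$ and a unitary $u\in M_k(\mathbb C)\otimes M_p(\mathbb C)$ with $|u(\xi\otimes I_p)u^*-\eta\otimes I_p|_2<\varepsilon$ (operations on tuples are entrywise). **Lemma.** If any two embeddings $\sigma,\pi$ of $M$ into $\mathcal R^\omega$ are conjugate by a unitary of $\mathcal R^\omega$ (there is a unitary $u\in\mathcal R^\omega$ with $\sigma(a)=u\,\pi(a)\,u^*$ for all $a\in M$), then $X$ is quasitubular. -/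

import Mathlib

open scoped Kronecker ComplexOrder

noncomputable section

namespace Microstates

section TracialAlgebras

variable {H : Type*} [NormedAddCommGroup H] [InnerProductSpace ℂ H] [CompleteSpace H]

/-- Ultraweak (= `σ`-weak) continuity of a linear functional on a von Neumann algebra `M` acting
on `H`: it has the form `a ↦ ∑ ⟨a ξᵢ, ηᵢ⟩` with `∑ ‖ξᵢ‖² < ∞` and `∑ ‖ηᵢ‖² < ∞`.
(Mathlib's inner product is linear in its second argument.) -/
def IsUltraweaklyContinuous (M : VonNeumannAlgebra H)
    (f : M.toStarSubalgebra →ₗ[ℂ] ℂ) : Prop :=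
  ∃ ξ η : ℕ → H, Summable (fun i => ‖ξ i‖ ^ 2) ∧ Summable (fun i => ‖η i‖ ^ 2) ∧
    ∀ a : M.toStarSubalgebra,
      HasSum (fun i => inner ℂ (η i) ((a : H →L[ℂ] H) (ξ i))) (f a)

/-- A faithful normal tracial state on a von Neumann algebra. -/
structure FaithfulNormalTrace (M : VonNeumannAlgebra H) where
  /-- the underlying linear functional -/
  toFun : M.toStarSubalgebra →ₗ[ℂ] ℂ
  map_one : toFun 1 = 1
  nonneg : ∀ a, 0 ≤ toFun (star a * a)
  faithful : ∀ a, toFun (star a * a) = 0 → a = 0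
  tracial : ∀ a b, toFun (a * b) = toFun (b * a)
  normal : IsUltraweaklyContinuous M toFun

/-- `R` is a hyperfinite `II₁`-factor: an infinite-dimensional factor which carries a faithful
normal tracial state and is generated by an increasing sequence of full matrix subalgebras
(with the same unit). -/
structure IsHyperfiniteII1Factor (R : VonNeumannAlgebra H) : Prop where
  factor : ∀ z ∈ R, (∀ a ∈ R, z * a = a * z) → ∃ c : ℂ, z = c • (1 : H →L[ℂ] H)
  finite : Nonempty (FaithfulNormalTrace R)
  infinite_dimensional : ¬ FiniteDimensional ℂ R.toStarSubalgebra
  hyperfinite : ∃ A : ℕ → StarSubalgebra ℂ (H →L[ℂ] H), Monotone A ∧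
    (∀ k, ∃ r : ℕ, Nonempty (A k ≃⋆ₐ[ℂ] Matrix (Fin r) (Fin r) ℂ)) ∧
    Set.centralizer (Set.centralizer (⋃ k, (A k : Set (H →L[ℂ] H)))) = (R : Set (H →L[ℂ] H))

namespace FaithfulNormalTrace

variable {R : VonNeumannAlgebra H} (τ : FaithfulNormalTrace R)

/-- The square `|a|₂² = τ(a* a)` of the 2-norm. -/
def normSq₂ (a : R.toStarSubalgebra) : ℝ := (τ.toFun (star a * a)).re

/-- The 2-norm `|a|₂ = τ(a* a)^{1/2}`. -/
def norm₂ (a : R.toStarSubalgebra) : ℝ := Real.sqrt (τ.normSq₂ a)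

theorem normSq₂_nonneg (a : R.toStarSubalgebra) : 0 ≤ τ.normSq₂ a :=
  (Complex.le_def.1 (τ.nonneg a)).1

theorem normSq₂_star (a : R.toStarSubalgebra) : τ.normSq₂ (star a) = τ.normSq₂ a := by
  simp only [normSq₂, star_star, τ.tracial a (star a)]

theorem normSq₂_add_le (a b : R.toStarSubalgebra) :
    τ.normSq₂ (a + b) ≤ 2 * τ.normSq₂ a + 2 * τ.normSq₂ b := by
  have h := τ.normSq₂_nonneg (a - b)
  have e : τ.normSq₂ (a + b) + τ.normSq₂ (a - b) = 2 * τ.normSq₂ a + 2 * τ.normSq₂ b := by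
    simp only [normSq₂, star_add, star_sub, add_mul, mul_add, sub_mul, mul_sub, map_add, map_sub,
      Complex.add_re, Complex.sub_re]
    ring
  linarith

theorem isClosed_coe (R : VonNeumannAlgebra H) :
    IsClosed (R.toStarSubalgebra : Set (H →L[ℂ] H)) := by
  have h := Set.isClosed_centralizer (Set.centralizer (R : Set (H →L[ℂ] H)))
  rwa [R.centralizer_centralizer] at h

theorem exists_star_mul_self {A : Type*} [CStarAlgebra A] (a b : A) :
    ∃ c : A, ‖star a * a‖ • (star b * b) - star b * (star a * a) * b = star c * c := by
  let _ := CStarAlgebra.spectralOrder A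
  have := CStarAlgebra.spectralOrderedRing A
  have h1 : star b * (star a * a) * b ≤ ‖star a * a‖ • (star b * b) :=
    CStarAlgebra.star_left_conjugate_le_norm_smul
  exact CStarAlgebra.nonneg_iff_eq_star_mul_self.1 (sub_nonneg.2 h1)

theorem normSq₂_mul_le (a b : R.toStarSubalgebra) :
    τ.normSq₂ (a * b) ≤ ‖(a : H →L[ℂ] H)‖ ^ 2 * τ.normSq₂ b := by
  have : IsClosed (R.toStarSubalgebra : Set (H →L[ℂ] H)) := isClosed_coe R
  let _ : CStarAlgebra R.toStarSubalgebra := StarSubalgebra.cstarAlgebra _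
  obtain ⟨c, hc⟩ := exists_star_mul_self a b
  have h2 : 0 ≤ (τ.toFun (‖star a * a‖ • (star b * b) - star b * (star a * a) * b)).re := by
    rw [hc]
    exact τ.normSq₂_nonneg c
  have h3 : ‖star a * a‖ = ‖(a : H →L[ℂ] H)‖ ^ 2 := by
    rw [CStarRing.norm_star_mul_self, sq]
    rfl
  have h4 : ‖star a * a‖ • (star b * b) = ((‖star a * a‖ : ℝ) : ℂ) • (star b * b) := rfl
  rw [map_sub, h4, map_smul, h3, Complex.sub_re, smul_eq_mul, Complex.re_ofReal_mul] at h2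
  have h5 : star (a * b) * (a * b) = star b * (star a * a) * b := by
    simp only [star_mul, mul_assoc]
  simp only [normSq₂, h5]
  linarith

theorem norm_apply_sq_le (a : R.toStarSubalgebra) : ‖τ.toFun a‖ ^ 2 ≤ τ.normSq₂ a := by
  -- positivity of `τ` at `a - τ(a) 1`
  have hp := τ.nonneg a
  set t := τ.toFun a with ht
  have hstar : τ.toFun (star a) = star t := by
    have h1 := (Complex.le_def.1 (τ.nonneg (a + 1))).2
    have h2 := (Complex.le_def.1 (τ.nonneg (a + Complex.I • 1))).2
    have h0 := (Complex.le_def.1 hp).2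
    simp only [star_add, star_one, star_smul, add_mul, mul_add, mul_one, one_mul, map_add,
      τ.map_one, map_smul, smul_mul_assoc, mul_smul_comm, smul_eq_mul, Complex.add_im,
      Complex.zero_im, Complex.one_im, RCLike.star_def, Complex.conj_I, smul_add,
      neg_smul, ← ht, neg_mul, map_neg, Complex.mul_im, Complex.neg_im, Complex.I_re,
      Complex.I_im] at h1 h2 h0
    rw [RCLike.star_def]
    apply Complex.ext
    · simp at h1 h2 h0 ⊢
      linarith
    · simp at h1 h2 h0 ⊢
      linarith
  have h := τ.normSq₂_nonneg (a - t • 1)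
  have e : τ.normSq₂ (a - t • 1) = τ.normSq₂ a - ‖t‖ ^ 2 := by
    simp only [normSq₂, star_sub, star_smul, star_one, sub_mul, mul_sub, map_sub, mul_one,
      one_mul, smul_mul_assoc, mul_smul_comm, map_smul, τ.map_one, smul_eq_mul, hstar, ← ht,
      Complex.sub_re, Complex.mul_re, RCLike.star_def, Complex.conj_re, Complex.conj_im]
    rw [← Complex.normSq_eq_norm_sq, Complex.normSq_apply]
    ring
  linarith

end FaithfulNormalTrace

end TracialAlgebras

section Ultrapower

variable {K : Type*} [NormedAddCommGroup K] [InnerProductSpace ℂ K] [CompleteSpace K]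

/-- The `*`-algebra `ℓ^∞(R)` of operator norm bounded sequences in `R`. -/
def boundedSeq (R : VonNeumannAlgebra K) : StarSubalgebra ℂ (ℕ → R.toStarSubalgebra) where
  carrier := {x | ∃ C : ℝ, ∀ n, ‖(x n : K →L[ℂ] K)‖ ≤ C}
  mul_mem' := by
    rintro x y ⟨C, hC⟩ ⟨D, hD⟩
    refine ⟨C * D, fun n => (norm_mul_le (x n : K →L[ℂ] K) (y n : K →L[ℂ] K)).trans ?_⟩
    exact mul_le_mul (hC n) (hD n) (norm_nonneg _) ((norm_nonneg _).trans (hC n))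
  add_mem' := by
    rintro x y ⟨C, hC⟩ ⟨D, hD⟩
    exact ⟨C + D, fun n => (norm_add_le (x n : K →L[ℂ] K) (y n : K →L[ℂ] K)).trans
      (add_le_add (hC n) (hD n))⟩
  algebraMap_mem' := fun c => ⟨‖algebraMap ℂ (K →L[ℂ] K) c‖, fun _ => le_rfl⟩
  star_mem' := by
    rintro x ⟨C, hC⟩
    exact ⟨C, fun n => (norm_star (x n : K →L[ℂ] K)).le.trans (hC n)⟩

variable {R : VonNeumannAlgebra K} (τ : FaithfulNormalTrace R) (ω : Ultrafilter ℕ)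

/-- `x` is null along `ω`: `lim_{n → ω} |xₙ|₂ = 0`. -/
def IsNull (x : boundedSeq R) : Prop :=
  Filter.Tendsto (fun n => τ.norm₂ (x.1 n)) ω (nhds 0)

theorem isNull_iff (x : boundedSeq R) :
    IsNull τ ω x ↔ Filter.Tendsto (fun n => τ.normSq₂ (x.1 n)) ω (nhds 0) := by
  constructor
  · intro h
    have h2 := h.pow 2
    simpa [FaithfulNormalTrace.norm₂, Real.sq_sqrt, τ.normSq₂_nonneg] using h2
  · intro h
    have h2 := (Real.continuous_sqrt.tendsto 0).comp h
    rw [Real.sqrt_zero] at h2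
    exact h2

theorem isNull_mul_left (x y : boundedSeq R) (hy : IsNull τ ω y) : IsNull τ ω (x * y) := by
  rw [isNull_iff] at hy ⊢
  obtain ⟨C, hC⟩ := x.2
  have h := hy.const_mul (C ^ 2)
  rw [mul_zero] at h
  refine squeeze_zero (fun n => τ.normSq₂_nonneg _) (fun n => ?_) h
  refine (τ.normSq₂_mul_le (x.1 n) (y.1 n)).trans ?_
  exact mul_le_mul_of_nonneg_right (pow_le_pow_left₀ (norm_nonneg _) (hC n) 2)
    (τ.normSq₂_nonneg _)

theorem isNull_star (x : boundedSeq R) (hx : IsNull τ ω x) : IsNull τ ω (star x) := by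
  rw [isNull_iff] at hx ⊢
  exact hx.congr fun n => (τ.normSq₂_star (x.1 n)).symm

/-- The ideal of those bounded sequences which are null along `ω`. -/
def nullIdeal : Ideal (boundedSeq R) where
  carrier := {x | IsNull τ ω x}
  zero_mem' := by
    change IsNull τ ω 0
    rw [isNull_iff]
    simp [FaithfulNormalTrace.normSq₂]
  add_mem' := by
    intro x y hx hy
    change IsNull τ ω _ at hx hy ⊢
    rw [isNull_iff] at hx hy ⊢
    have h := (hx.const_mul 2).add (hy.const_mul 2)
    simp only [mul_zero, add_zero] at h
    exact squeeze_zero (fun n => τ.normSq₂_nonneg _)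
      (fun n => τ.normSq₂_add_le (x.1 n) (y.1 n)) h
  smul_mem' := fun x y hy => isNull_mul_left τ ω x y hy

theorem mem_nullIdeal (x : boundedSeq R) : x ∈ nullIdeal τ ω ↔ IsNull τ ω x := Iff.rfl

theorem star_mem_nullIdeal {x : boundedSeq R} (hx : x ∈ nullIdeal τ ω) :
    star x ∈ nullIdeal τ ω := isNull_star τ ω x hx

instance nullIdeal_isTwoSided : (nullIdeal τ ω).IsTwoSided where
  mul_mem_of_left := by
    intro a b ha
    have h := star_mem_nullIdeal τ ω
      ((nullIdeal τ ω).mul_mem_left (star b) (star_mem_nullIdeal τ ω ha))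
    simpa using h

/-- The ultrapower `R^ω` of `(R, τ)`: bounded sequences modulo `lim_{n → ω} |xₙ|₂ = 0`. -/
def Ultrapower : Type _ := boundedSeq R ⧸ nullIdeal τ ω

instance : Ring (Ultrapower τ ω) :=
  inferInstanceAs (Ring (boundedSeq R ⧸ nullIdeal τ ω))

instance : Algebra ℂ (Ultrapower τ ω) :=
  inferInstanceAs (Algebra ℂ (boundedSeq R ⧸ nullIdeal τ ω))

namespace Ultrapower

/-- The quotient map `Q : ℓ^∞(R) → R^ω`. -/
def mk : boundedSeq R →ₐ[ℂ] Ultrapower τ ω := Ideal.Quotient.mkₐ ℂ (nullIdeal τ ω)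

theorem mk_surjective : Function.Surjective (mk τ ω) := Ideal.Quotient.mk_surjective

theorem mk_eq_mk_iff (x y : boundedSeq R) : mk τ ω x = mk τ ω y ↔ IsNull τ ω (x - y) :=
  Ideal.Quotient.eq

/-- The adjoint on `R^ω`, computed on representatives. -/
instance : Star (Ultrapower τ ω) where
  star := Quotient.lift (s := Submodule.quotientRel (nullIdeal τ ω))
    (fun x => mk τ ω (star x)) (by
      intro x y h
      have h1 : x - y ∈ nullIdeal τ ω := (Submodule.quotientRel_def _).1 h
      have h2 : star (x - y) ∈ nullIdeal τ ω := star_mem_nullIdeal τ ω h1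
      rw [star_sub x y] at h2
      exact (mk_eq_mk_iff τ ω _ _).2 h2)

theorem star_mk (x : boundedSeq R) : star (mk τ ω x) = mk τ ω (star x) := rfl

theorem star_mul_aux (z w : Ultrapower τ ω) : star (z * w) = star w * star z := by
  obtain ⟨x, rfl⟩ := mk_surjective τ ω z
  obtain ⟨y, rfl⟩ := mk_surjective τ ω w
  have h1 : mk τ ω x * mk τ ω y = mk τ ω (x * y) := (map_mul (mk τ ω) x y).symm
  have h2 : mk τ ω (star y * star x) = mk τ ω (star y) * mk τ ω (star x) :=
    map_mul (mk τ ω) (star y) (star x)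
  have h3 : star (x * y) = star y * star x := star_mul x y
  rw [h1, star_mk, h3, h2]
  rfl

theorem star_add_aux (z w : Ultrapower τ ω) : star (z + w) = star z + star w := by
  obtain ⟨x, rfl⟩ := mk_surjective τ ω z
  obtain ⟨y, rfl⟩ := mk_surjective τ ω w
  have h1 : mk τ ω x + mk τ ω y = mk τ ω (x + y) := (map_add (mk τ ω) x y).symm
  have h2 : mk τ ω (star x + star y) = mk τ ω (star x) + mk τ ω (star y) :=
    map_add (mk τ ω) (star x) (star y)
  have h3 : star (x + y) = star x + star y := star_add x y
  rw [h1, star_mk, h3, h2]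
  rfl

theorem star_star_aux (z : Ultrapower τ ω) : star (star z) = z := by
  obtain ⟨x, rfl⟩ := mk_surjective τ ω z
  rw [star_mk, star_mk, star_star x]

instance : StarRing (Ultrapower τ ω) where
  star_involutive := star_star_aux τ ω
  star_mul := star_mul_aux τ ω
  star_add := star_add_aux τ ω

theorem tendsto_trace_sub (x y : boundedSeq R) (h : IsNull τ ω (x - y)) :
    Filter.Tendsto (fun n => τ.toFun (x.1 n) - τ.toFun (y.1 n)) ω (nhds 0) := by
  refine squeeze_zero_norm (fun n => ?_) h
  rw [← map_sub]
  exact Real.le_sqrt_of_sq_le (τ.norm_apply_sq_le _)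

/-- The trace on `R^ω`: `Q(x) ↦ lim_{n → ω} τ(xₙ)`. -/
def trace : Ultrapower τ ω → ℂ :=
  Quotient.lift (s := Submodule.quotientRel (nullIdeal τ ω))
    (fun x => (ω : Filter ℕ).limUnder (fun n => τ.toFun (x.1 n))) (by
      intro x y h
      have h1 : IsNull τ ω (x - y) := (Submodule.quotientRel_def _).1 h
      have h2 := tendsto_trace_sub τ ω x y h1
      have key : ∀ c : ℂ, Filter.map (fun n => τ.toFun (x.1 n)) ω ≤ nhds c ↔
          Filter.map (fun n => τ.toFun (y.1 n)) ω ≤ nhds c := by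
        intro c
        constructor
        · intro hc
          have h3 := Filter.Tendsto.sub (show Filter.Tendsto _ _ _ from hc) h2
          simpa [Filter.Tendsto] using h3
        · intro hc
          have h3 := Filter.Tendsto.add (show Filter.Tendsto _ _ _ from hc) h2
          simpa [Filter.Tendsto] using h3
      simp only [Filter.limUnder, Filter.lim, key])

/-- The limit which defines the trace always exists. -/
theorem tendsto_trace (x : boundedSeq R) :
    Filter.Tendsto (fun n => τ.toFun (x.1 n)) ω (nhds (trace τ ω (mk τ ω x))) := by
  obtain ⟨C, hC⟩ := x.2
  have hC0 : 0 ≤ C := (norm_nonneg _).trans (hC 0)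
  have hb : ∀ n, τ.toFun (x.1 n) ∈ Metric.closedBall (0 : ℂ) C := by
    intro n
    rw [mem_closedBall_zero_iff]
    refine abs_le_of_sq_le_sq' ?_ hC0 |>.2
    refine (τ.norm_apply_sq_le _).trans ?_
    have h := τ.normSq₂_mul_le (x.1 n) 1
    have h1 : τ.normSq₂ 1 = 1 := by
      simp [FaithfulNormalTrace.normSq₂, τ.map_one]
    rw [mul_one, h1, mul_one] at h
    exact h.trans (pow_le_pow_left₀ (norm_nonneg _) (hC n) 2)
  obtain ⟨c, -, hc⟩ := (isCompact_closedBall (0 : ℂ) C).ultrafilter_le_nhds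
    (ω.map fun n => τ.toFun (x.1 n))
    (by
      rw [Filter.le_principal_iff]
      exact Filter.mem_map.2 (Filter.univ_mem' hb))
  exact tendsto_nhds_limUnder ⟨c, hc⟩

end Ultrapower

end Ultrapower

section Embeddings

/-- The order of a `*`-algebra: `a ≼ b` if `b - a` is positive, i.e. of the form `c* c`. -/
def StarLE {A : Type*} [Ring A] [StarRing A] (a b : A) : Prop := ∃ c : A, b - a = star c * c

/-- `s` is the least upper bound of `S` in the order `StarLE`. -/
def IsStarLUB {A : Type*} [Ring A] [StarRing A] (S : Set A) (s : A) : Prop :=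
  (∀ a ∈ S, StarLE a s) ∧ ∀ b, (∀ a ∈ S, StarLE a b) → StarLE s b

/-- Normality of a map between von Neumann algebras: it preserves the least upper bounds of upward
directed sets of selfadjoint elements. -/
def IsNormalMap {A B : Type*} [Ring A] [StarRing A] [Ring B] [StarRing B] (f : A → B) : Prop :=
  ∀ (S : Set A) (s : A), S.Nonempty → (∀ a ∈ S, IsSelfAdjoint a) →
    (∀ a ∈ S, ∀ b ∈ S, ∃ c ∈ S, StarLE a c ∧ StarLE b c) →
    IsStarLUB S s → IsStarLUB (f '' S) (f s)

variable {H : Type*} [NormedAddCommGroup H] [InnerProductSpace ℂ H] [CompleteSpace H]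
  {K : Type*} [NormedAddCommGroup K] [InnerProductSpace ℂ K] [CompleteSpace K]

/-- `π` is an embedding of `(M, φ)` into `R^ω`: a unital `*`-homomorphism (unitality is part of
`→⋆ₐ`) which is normal, injective and trace preserving. -/
structure IsEmbedding {M : VonNeumannAlgebra H} (φ : FaithfulNormalTrace M)
    {R : VonNeumannAlgebra K} (τ : FaithfulNormalTrace R) (ω : Ultrafilter ℕ)
    (π : M.toStarSubalgebra →⋆ₐ[ℂ] Ultrapower τ ω) : Prop where
  normal : IsNormalMap π
  injective : Function.Injective π
  trace_preserving : ∀ a, Ultrapower.trace τ ω (π a) = φ.toFun a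

/-- `σ` and `π` are conjugate by a unitary of `R^ω`. -/
def UnitarilyConjugate {M : VonNeumannAlgebra H}
    {R : VonNeumannAlgebra K} {τ : FaithfulNormalTrace R} {ω : Ultrafilter ℕ}
    (σ π : M.toStarSubalgebra →⋆ₐ[ℂ] Ultrapower τ ω) : Prop :=
  ∃ u ∈ unitary (Ultrapower τ ω), ∀ a, σ a = u * π a * star u

end Embeddings

section Microstates

/-- The normalized trace of a square matrix. -/
def normTrace {ι : Type*} [Fintype ι] (a : Matrix ι ι ℂ) : ℂ :=
  (Fintype.card ι : ℂ)⁻¹ * a.trace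

/-- `|ξ|₂ = (∑ᵢ tr(ξᵢ* ξᵢ))^{1/2}` for an `n`-tuple of matrices, `tr` the normalized trace. -/
def tupleNorm₂ {n : ℕ} {ι : Type*} [Fintype ι] (ξ : Fin n → Matrix ι ι ℂ) : ℝ :=
  Real.sqrt (∑ i, (normTrace (star (ξ i) * ξ i)).re)

variable {H : Type*} [NormedAddCommGroup H] [InnerProductSpace ℂ H] [CompleteSpace H]
  {M : VonNeumannAlgebra H}

/-- The microstate space `Γ(X; m, k, γ)`: the `n`-tuples of selfadjoint `k × k` matrices whose
moments of order at most `m` differ from those of `X` by less than `γ`. -/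
def microstateSpace (φ : FaithfulNormalTrace M) {n : ℕ} (X : Fin n → M.toStarSubalgebra)
    (m k : ℕ) (γ : ℝ) : Set (Fin n → Matrix (Fin k) (Fin k) ℂ) :=
  {a | (∀ i, (a i).IsHermitian) ∧ ∀ p : ℕ, 1 ≤ p → p ≤ m → ∀ i : Fin p → Fin n,
    ‖normTrace (List.ofFn fun j => a (i j)).prod -
      φ.toFun (List.ofFn fun j => X (i j)).prod‖ < γ}

/-- `X` is `N`-quasitubular. The algebra `M_k(ℂ) ⊗ M_p(ℂ)` is the algebra of matrices indexed by
`Fin k × Fin p`. -/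
def IsNQuasitubular (φ : FaithfulNormalTrace M) {n : ℕ} (X : Fin n → M.toStarSubalgebra)
    (N : ℕ) : Prop :=
  ∀ ε : ℝ, 0 < ε → ∃ m : ℕ, ∃ γ : ℝ, 0 < γ ∧ ∀ k : ℕ, 1 ≤ k →
    ∀ ξ : Fin (N + 1) → Fin n → Matrix (Fin k) (Fin k) ℂ,
      (∀ s, ξ s ∈ microstateSpace φ X m k γ) →
      ∃ p : ℕ, 1 ≤ p ∧ ∃ u ∈ Matrix.unitaryGroup (Fin k × Fin p) ℂ, ∃ i j : Fin (N + 1), i < j ∧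
        tupleNorm₂ (fun l => u * (ξ i l ⊗ₖ (1 : Matrix (Fin p) (Fin p) ℂ)) * star u -
          ξ j l ⊗ₖ (1 : Matrix (Fin p) (Fin p) ℂ)) < ε

/-- `X` is quasitubular if it is `1`-quasitubular. -/
def IsQuasitubular (φ : FaithfulNormalTrace M) {n : ℕ} (X : Fin n → M.toStarSubalgebra) : Prop :=
  IsNQuasitubular φ X 1

end Microstates

end Microstates

end

/-!
Suppose that `X` is not quasitubular. Then for some `ε` there are, for every `m`, two microstates
`ξ_m⁰, ξ_m¹` of size `k_m` and of precision `1 / (m + 1)` for which no amplifications are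
`ε`-conjugate. The hyperfinite factor `R` contains unital matrix algebras of unbounded size
(`MatrixExhaustion`), and `M_k(ℂ)` maps into a much larger `M_r(ℂ)` by a homomorphism `α` which is
unital up to a corner of small trace (`exists_padding`). Composing, one moves each sequence of
microstates into `R`, where its moments converge to those of `X`. There is no uniform bound on the
operator norms, but since the even moments grow like those of `X`, truncating the spectra at some
`C > ‖X i‖` is negligible in the 2-norm (`TracialState.exists_truncation`,
`TracialState.tendsto_truncation`). So one obtains tuples in `R^ω` with the moments of `X`.

Each of them is the image of `X` under an embedding of `M` (`exists_isEmbedding`). Indeed the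
correspondence between `X` and the tuple extends by 2-norm continuity to `M`: polynomials in `X`
are 2-norm dense in `M` (the double commutant theorem, applied to `ℓ² ⊗ H`), and Kaplansky's density
theorem is replaced by an argument with resolvents `(h + i)⁻¹`, which are contractions depending
continuously on `h` in the 2-norm; every selfadjoint contraction is twice the real part of such a
resolvent. A trace preserving homomorphism is automatically injective and normal, because suprema
of directed sets in `M` are 2-norm limits and the positive cone of `R^ω` is closed in the 2-norm.

By hypothesis a unitary of `R^ω` conjugates the two embeddings. At a suitable index `m` this gives
an almost unitary element of `R` which almost intertwines the two truncated microstates. It is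
approximated by an invertible matrix in one of the matrix algebras `M_r(ℂ) ⊆ R`, and then by the
unitary part `W` of that matrix (`MatrixExhaustion.exists_unitary`). Thus `W` almost conjugates
`α(ξ_m⁰)` to `α(ξ_m¹)` inside `M_r(ℂ)`, for an almost unital `α : M_k(ℂ) → M_r(ℂ)`. Finally, the
partial flip `∑ e_ij ⊗ α(e_ji)` conjugates `x ⊗ 1` to `1 ⊗ α(x)` in `M_k(ℂ) ⊗ M_r(ℂ)`, up to the
small corner, so that `W` yields a unitary of `M_k(ℂ) ⊗ M_r(ℂ)` which almost conjugates `ξ_m⁰ ⊗ 1`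
to `ξ_m¹ ⊗ 1` (`exists_unitary_kronecker`), a contradiction.
-/

open scoped Kronecker ComplexOrder

noncomputable section

set_option linter.unusedSectionVars false

namespace Microstates

/-! ### Tracial states and the 2-norm -/

/-- A tracial state on a unital `*`-algebra. Faithfulness and normality are not part of the
structure, so that ultrapowers, matrix algebras and von Neumann algebras are treated alike. -/
structure TracialState (A : Type*) [Ring A] [StarRing A] [Algebra ℂ A] where
  /-- the underlying linear functional -/
  toFun : A →ₗ[ℂ] ℂ
  map_one : toFun 1 = 1
  nonneg : ∀ a, 0 ≤ toFun (star a * a)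
  tracial : ∀ a b, toFun (a * b) = toFun (b * a)

namespace TracialState

section Basic

variable {A : Type*} [Ring A] [StarRing A] [Algebra ℂ A] [StarModule ℂ A] (T : TracialState A)

theorem map_star (a : A) : T.toFun (star a) = star (T.toFun a) := by
  have h1 := (Complex.le_def.1 (T.nonneg (a + 1))).2
  have h2 := (Complex.le_def.1 (T.nonneg (a + Complex.I • 1))).2
  have h0 := (Complex.le_def.1 (T.nonneg a)).2
  simp only [star_add, star_one, star_smul, add_mul, mul_add, mul_one, one_mul, map_add,
    T.map_one, map_smul, smul_mul_assoc, mul_smul_comm, smul_eq_mul, Complex.add_im,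
    Complex.zero_im, Complex.one_im, RCLike.star_def, Complex.conj_I, smul_add,
    neg_smul, neg_mul, map_neg, Complex.mul_im, Complex.neg_im, Complex.I_re,
    Complex.I_im] at h1 h2 h0
  rw [RCLike.star_def]
  apply Complex.ext
  · simp at h1 h2 h0 ⊢
    linarith
  · simp at h1 h2 h0 ⊢
    linarith

/-- The positive semidefinite sesquilinear form `⟨a, b⟩ = T(a* b)`. -/
abbrev core : PreInnerProductSpace.Core ℂ A where
  inner a b := T.toFun (star a * b)
  conj_inner_symm a b := by
    have h := T.map_star (star b * a)
    rw [star_mul, star_star] at h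
    rw [h]
    simp
  re_inner_nonneg a := (Complex.le_def.1 (T.nonneg a)).1
  add_left a b c := by simp [add_mul]
  smul_left a b c := by simp

/-- The 2-norm `|a|₂ = T(a* a)^{1/2}`. -/
def norm2 (a : A) : ℝ := Real.sqrt (T.toFun (star a * a)).re

theorem norm2_nonneg (a : A) : 0 ≤ T.norm2 a := Real.sqrt_nonneg _

theorem re_nonneg (a : A) : 0 ≤ (T.toFun (star a * a)).re := (Complex.le_def.1 (T.nonneg a)).1

theorem norm2_sq (a : A) : T.norm2 a ^ 2 = (T.toFun (star a * a)).re :=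
  Real.sq_sqrt (T.re_nonneg a)

theorem apply_star_mul_self (a : A) : T.toFun (star a * a) = ((T.norm2 a ^ 2 : ℝ) : ℂ) := by
  rw [norm2_sq]
  exact (Complex.eq_re_of_ofReal_le (r := 0) (by simpa using T.nonneg a))

theorem norm2_add_le (a b : A) : T.norm2 (a + b) ≤ T.norm2 a + T.norm2 b :=
  let _ := T.core
  @norm_add_le A (InnerProductSpace.Core.toSeminormedAddCommGroup (𝕜 := ℂ)).toSeminormedAddGroup a b

theorem norm2_neg (a : A) : T.norm2 (-a) = T.norm2 a := by simp [norm2]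

theorem norm2_sub_comm (a b : A) : T.norm2 (a - b) = T.norm2 (b - a) := by
  rw [← T.norm2_neg, neg_sub]

theorem norm2_zero : T.norm2 0 = 0 := by simp [norm2]

theorem norm2_one : T.norm2 1 = 1 := by simp [norm2, T.map_one]

theorem norm2_sub_le (a b : A) : T.norm2 (a - b) ≤ T.norm2 a + T.norm2 b := by
  rw [sub_eq_add_neg, ← T.norm2_neg b]
  exact T.norm2_add_le a _

theorem norm2_sub_le' (a b c : A) : T.norm2 (a - c) ≤ T.norm2 (a - b) + T.norm2 (b - c) := by
  rw [← sub_add_sub_cancel a b c]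
  exact T.norm2_add_le _ _

theorem norm2_smul (c : ℂ) (a : A) : T.norm2 (c • a) = ‖c‖ * T.norm2 a := by
  have h : star (c • a) * (c • a) = ((‖c‖ ^ 2 : ℝ) : ℂ) • (star a * a) := by
    rw [star_smul, smul_mul_smul_comm, RCLike.star_def, Complex.conj_mul']
    simp
  rw [norm2, h, map_smul, smul_eq_mul, Complex.re_ofReal_mul, Real.sqrt_mul (by positivity),
    Real.sqrt_sq (norm_nonneg c), norm2]

theorem norm2_star (a : A) : T.norm2 (star a) = T.norm2 a := by
  simp only [norm2, star_star, T.tracial a (star a)]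

theorem norm_apply_star_mul_le (a b : A) : ‖T.toFun (star a * b)‖ ≤ T.norm2 a * T.norm2 b :=
  let _ := T.core
  InnerProductSpace.Core.norm_inner_le_norm (𝕜 := ℂ) a b

theorem norm_apply_mul_le (a b : A) : ‖T.toFun (a * b)‖ ≤ T.norm2 a * T.norm2 b := by
  simpa [norm2_star] using T.norm_apply_star_mul_le (star a) b

theorem norm_apply_le (a : A) : ‖T.toFun a‖ ≤ T.norm2 a := by
  simpa [norm2_one] using T.norm_apply_mul_le 1 a

theorem norm2_unitary_mul {u : A} (hu : star u * u = 1) (a : A) : T.norm2 (u * a) = T.norm2 a := by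
  rw [norm2, norm2, star_mul, mul_assoc, ← mul_assoc (star u), hu, one_mul]

theorem norm2_mul_unitary {u : A} (hu : u * star u = 1) (a : A) : T.norm2 (a * u) = T.norm2 a := by
  rw [← norm2_star, star_mul, norm2_unitary_mul, norm2_star]
  simpa using hu

theorem norm2_eq_zero_iff (a : A) : T.norm2 a = 0 ↔ T.toFun (star a * a) = 0 := by
  rw [apply_star_mul_self]
  simp

end Basic

section CStar

variable {A : Type*} [CStarAlgebra A] (T : TracialState A)

theorem norm2_mul_le (a b : A) : T.norm2 (a * b) ≤ ‖a‖ * T.norm2 b := by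
  obtain ⟨c, hc⟩ := FaithfulNormalTrace.exists_star_mul_self a b
  have h2 := T.re_nonneg c
  have h4 : ‖star a * a‖ • (star b * b) = ((‖star a * a‖ : ℝ) : ℂ) • (star b * b) := by
    simp
  rw [← hc, map_sub, h4, map_smul, CStarRing.norm_star_mul_self, Complex.sub_re, smul_eq_mul,
    Complex.re_ofReal_mul] at h2
  have h5 : star (a * b) * (a * b) = star b * (star a * a) * b := by
    simp only [star_mul, mul_assoc]
  apply abs_le_of_sq_le_sq' _ (by have := T.norm2_nonneg b; positivity) |>.2
  rw [mul_pow, norm2_sq, norm2_sq, h5]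
  linarith

theorem norm2_mul_le' (a b : A) : T.norm2 (a * b) ≤ T.norm2 a * ‖b‖ := by
  rw [← norm2_star, star_mul, mul_comm, ← norm_star b, ← T.norm2_star a]
  exact T.norm2_mul_le _ _

theorem norm2_le_norm (a : A) : T.norm2 a ≤ ‖a‖ := by
  simpa [norm2_one] using T.norm2_mul_le a 1

end CStar

end TracialState

/-! ### Functional calculus and the 2-norm -/

section FunctionalCalculus

variable {A : Type*} [CStarAlgebra A]

/-- The resolvent of a selfadjoint element at `-i` is a contraction. -/
theorem exists_resolvent {h : A} (hh : IsSelfAdjoint h) :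
    ∃ r : A, ‖r‖ ≤ 1 ∧ r * (h + Complex.I • 1) = 1 ∧ (h + Complex.I • 1) * r = 1 := by
  have hne : ∀ z ∈ spectrum ℂ h, z + Complex.I ≠ 0 := by
    intro z hz h0
    have h1 := hh.im_eq_zero_of_mem_spectrum hz
    have h2 := congrArg Complex.im h0
    simp [h1] at h2
  have hc : ContinuousOn (fun z : ℂ => (z + Complex.I)⁻¹) (spectrum ℂ h) :=
    ContinuousOn.inv₀ (by fun_prop) hne
  have hn : IsStarNormal h := hh.isStarNormal
  have he : h + Complex.I • (1 : A) = cfc (fun z : ℂ => z + Complex.I) h := by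
    rw [cfc_add_const (R := ℂ) Complex.I (fun z => z) h, cfc_id' ℂ h,
      Algebra.algebraMap_eq_smul_one]
  refine ⟨cfc (fun z : ℂ => (z + Complex.I)⁻¹) h, ?_, ?_, ?_⟩
  · refine norm_cfc_le zero_le_one fun z hz => ?_
    have h1 := hh.im_eq_zero_of_mem_spectrum hz
    rw [norm_inv]
    apply inv_le_one_of_one_le₀
    have h2 := Complex.abs_im_le_norm (z + Complex.I)
    simpa [h1] using h2
  · rw [he, ← cfc_mul _ _ h hc (by fun_prop), ← cfc_one ℂ h]
    exact cfc_congr fun z hz => inv_mul_cancel₀ (hne z hz)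
  · rw [he, ← cfc_mul _ _ h (by fun_prop) hc, ← cfc_one ℂ h]
    exact cfc_congr fun z hz => mul_inv_cancel₀ (hne z hz)

/-- A selfadjoint contraction is twice the real part of a resolvent: `a = 2c / (1 + c²)` for
`c = a / (1 + √(1 - a²))`. -/
theorem exists_add_star_resolvent_eq {a : A} (ha : IsSelfAdjoint a) (h1 : ‖a‖ ≤ 1) :
    ∃ c : A, IsSelfAdjoint c ∧ ∀ r : A, r * (c + Complex.I • 1) = 1 →
      (c + Complex.I • 1) * r = 1 → r + star r = a := by
  set g : ℝ → ℝ := fun t => t / (1 + Real.sqrt (1 - t ^ 2)) with hg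
  have hpos : ∀ t : ℝ, 0 < 1 + Real.sqrt (1 - t ^ 2) := fun t => by positivity
  have hgc : Continuous g := by
    refine Continuous.div (by fun_prop) (by fun_prop) fun t => (hpos t).ne'
  set c : A := cfc g a with hc
  have hcs : IsSelfAdjoint c := cfc_predicate g a
  have hac : a * c = c * a := by
    have h := cfc_commute_cfc (fun t : ℝ => t) g a
    rwa [cfc_id' ℝ a] at h
  have key : c + c = a * (1 + c * c) := by
    nth_rewrite 1 [← cfc_id' ℝ a]
    rw [hc, ← cfc_one ℝ a, ← cfc_mul g g a, ← cfc_add a g g, ← cfc_add a 1 (fun t => g t * g t),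
      ← cfc_mul _ _ a]
    refine cfc_congr fun t ht => ?_
    have : Nontrivial A := by
      by_contra hA
      have := not_nontrivial_iff_subsingleton.1 hA
      simp [spectrum.of_subsingleton] at ht
    have h2 : ‖t‖ ≤ 1 := (spectrum.norm_le_norm_of_mem ht).trans h1
    have h3 : 0 ≤ 1 - t ^ 2 := by
      rw [Real.norm_eq_abs, ← sq_le_one_iff_abs_le_one] at h2
      linarith
    have h4 := Real.sq_sqrt h3
    have h5 := hpos t
    simp only [hg, Pi.one_apply]
    field_simp
    linear_combination (-t) * h4
  refine ⟨c, hcs, fun r hr1 hr2 => ?_⟩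
  have hr3 : star r * (c - Complex.I • 1) = 1 := by
    have h := congrArg star hr2
    simpa [hcs.star_eq, sub_eq_add_neg] using h
  calc r + star r = star r * (c - Complex.I • 1) * r + star r * ((c + Complex.I • 1) * r) := by
        rw [hr3, hr2, one_mul, mul_one]
    _ = star r * (c + c) * r := by noncomm_ring
    _ = star r * (c - Complex.I • 1) * a * ((c + Complex.I • 1) * r) := by
        rw [key]
        have e1 : (c - Complex.I • 1) * a = a * (c - Complex.I • (1 : A)) := by
          simp [sub_mul, mul_sub, hac]
        have e2 : (c - Complex.I • 1) * (c + Complex.I • (1 : A)) = 1 + c * c := by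
          have e3 : Complex.I • Complex.I • (1 : A) = -1 := by
            rw [smul_smul, Complex.I_mul_I, neg_one_smul]
          simp only [sub_mul, mul_add, smul_mul_assoc, mul_smul_comm, one_mul, mul_one,
            smul_sub, e3]
          abel
        rw [mul_assoc (star r) (c - _) a, e1, ← e2]
        noncomm_ring
    _ = a := by rw [hr3, hr2, one_mul, mul_one]

/-- The square roots `p`, `q` of the positive and the negative part of a selfadjoint element. -/
theorem exists_orthogonal_decomposition {a : A} (ha : IsSelfAdjoint a) :
    ∃ p q : A, star p = p ∧ star q = q ∧ ‖p‖ ≤ Real.sqrt ‖a‖ ∧ ‖q‖ ≤ Real.sqrt ‖a‖ ∧ q * p = 0 ∧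
      a = p * p - q * q := by
  set f : ℝ → ℝ := fun t => Real.sqrt t with hf
  set g : ℝ → ℝ := fun t => Real.sqrt (-t) with hg
  have hfc : Continuous f := by fun_prop
  have hgc : Continuous g := by fun_prop
  have hspec : ∀ t ∈ spectrum ℝ a, |t| ≤ ‖a‖ := by
    intro t ht
    have : Nontrivial A := by
      by_contra hA
      have := not_nontrivial_iff_subsingleton.1 hA
      simp [spectrum.of_subsingleton] at ht
    exact spectrum.norm_le_norm_of_mem ht
  refine ⟨cfc f a, cfc g a, (cfc_predicate f a : IsSelfAdjoint _),
    (cfc_predicate g a : IsSelfAdjoint _), ?_, ?_, ?_, ?_⟩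
  · refine norm_cfc_le (Real.sqrt_nonneg _) fun t ht => ?_
    rw [Real.norm_of_nonneg (Real.sqrt_nonneg _)]
    exact Real.sqrt_le_sqrt ((le_abs_self t).trans (hspec t ht))
  · refine norm_cfc_le (Real.sqrt_nonneg _) fun t ht => ?_
    rw [Real.norm_of_nonneg (Real.sqrt_nonneg _)]
    exact Real.sqrt_le_sqrt ((neg_le_abs t).trans (hspec t ht))
  · rw [← cfc_mul g f a, ← cfc_zero ℝ a]
    refine cfc_congr fun t _ => ?_
    rcases le_total 0 t with ht | ht
    · simp [f, g, Real.sqrt_eq_zero_of_nonpos (neg_nonpos.2 ht)]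
    · simp [f, g, Real.sqrt_eq_zero_of_nonpos ht]
  · rw [← cfc_mul f f a, ← cfc_mul g g a, ← cfc_sub ..]
    nth_rewrite 1 [← cfc_id' ℝ a]
    refine cfc_congr fun t _ => ?_
    rcases le_total 0 t with ht | ht
    · simp [f, g, Real.mul_self_sqrt ht, Real.sqrt_eq_zero_of_nonpos (neg_nonpos.2 ht)]
    · simp [f, g, Real.mul_self_sqrt (neg_nonneg.2 ht), Real.sqrt_eq_zero_of_nonpos ht]

variable (T : TracialState A)

theorem TracialState.re_apply_cfc_nonneg {a : A} {f : ℝ → ℝ} (hf : ContinuousOn f (spectrum ℝ a))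
    (h0 : ∀ t ∈ spectrum ℝ a, 0 ≤ f t) : 0 ≤ (T.toFun (cfc f a)).re := by
  have h : cfc f a =
      star (cfc (fun t => Real.sqrt (f t)) a) * cfc (fun t => Real.sqrt (f t)) a := by
    have hs : IsSelfAdjoint (cfc (fun t => Real.sqrt (f t)) a) := cfc_predicate _ a
    rw [hs.star_eq, ← cfc_mul _ _ a]
    exact cfc_congr fun t ht => (Real.mul_self_sqrt (h0 t ht)).symm
  rw [h]
  exact T.re_nonneg _

/-- Truncation of the spectrum to `[-C, C]`: the 2-norm error is controlled by every high moment,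
since `(t - f t)² ≤ t^(2L+2) / C^(2L)` for the truncation `f`. -/
theorem TracialState.exists_truncation {a : A} (ha : IsSelfAdjoint a) {C : ℝ} (hC : 0 < C) :
    ∃ b : A, IsSelfAdjoint b ∧ ‖b‖ ≤ C ∧
      ∀ L : ℕ, T.norm2 (b - a) ^ 2 ≤ (T.toFun (a ^ (2 * L + 2))).re / C ^ (2 * L) := by
  set f : ℝ → ℝ := fun t => max (-C) (min C t) with hf
  have hfc : Continuous f := by fun_prop
  refine ⟨cfc f a, cfc_predicate _ _, norm_cfc_le hC.le fun t _ => ?_, fun L => ?_⟩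
  · rw [Real.norm_eq_abs, abs_le]
    exact ⟨le_max_left _ _, max_le (by linarith) (min_le_left _ _)⟩
  have hs : IsSelfAdjoint (cfc f a - a) := (cfc_predicate f a : IsSelfAdjoint _).sub ha
  have h1 : star (cfc f a - a) * (cfc f a - a) = cfc (fun t => (f t - t) * (f t - t)) a := by
    rw [hs.star_eq]
    nth_rewrite 2 [← cfc_id' ℝ a]
    nth_rewrite 4 [← cfc_id' ℝ a]
    rw [← cfc_sub .., ← cfc_mul _ _ a]
  have h2 : a ^ (2 * L + 2) = cfc (fun t : ℝ => t ^ (2 * L + 2)) a := by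
    rw [cfc_pow_id (R := ℝ) a]
  have h3 := T.re_apply_cfc_nonneg (a := a)
    (f := fun t => (C ^ (2 * L))⁻¹ * t ^ (2 * L + 2) - (f t - t) * (f t - t)) (by fun_prop) (by
      intro t _
      rw [sub_nonneg, inv_mul_eq_div, le_div_iff₀ (by positivity)]
      rcases le_total |t| C with h | h
      · rw [abs_le] at h
        have : f t = t := by simp [hf, h.1, h.2]
        rw [this]
        have : 0 ≤ t ^ (2 * L + 2) := by
          rw [show 2 * L + 2 = 2 * (L + 1) by ring, pow_mul]
          positivity
        simpa
      · have e1 : (f t - t) * (f t - t) ≤ t ^ 2 := by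
          simp only [hf]
          rcases le_total t 0 with ht | ht
          · rw [abs_of_nonpos ht] at h
            rw [min_eq_right (by linarith), max_eq_left (by linarith)]
            nlinarith
          · rw [abs_of_nonneg ht] at h
            rw [min_eq_left (by linarith), max_eq_right (by linarith)]
            nlinarith
        have e2 : C ^ (2 * L) ≤ t ^ (2 * L) := by
          rw [← Even.pow_abs (even_two_mul L) t]
          exact pow_le_pow_left₀ hC.le h _
        calc (f t - t) * (f t - t) * C ^ (2 * L) ≤ t ^ 2 * t ^ (2 * L) := by gcongr
          _ = t ^ (2 * L + 2) := by ring)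
  rw [cfc_sub .., cfc_const_mul .., ← h2, ← h1, map_sub] at h3
  have h4 : ((C ^ (2 * L))⁻¹ : ℝ) • a ^ (2 * L + 2) =
    (((C ^ (2 * L))⁻¹ : ℝ) : ℂ) • a ^ (2 * L + 2) := (Complex.coe_smul _ _).symm
  rw [h4, map_smul, Complex.sub_re, smul_eq_mul, Complex.re_ofReal_mul, ← T.norm2_sq,
    inv_mul_eq_div] at h3
  linarith

/-- An invertible element `b` with `b* b` close to `1` is close in 2-norm to the unitary `w` of its
polar decomposition `b = w h`: one has `|b - w|₂² = T((h - 1)²) = T(s (b* b - 1))` with the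
contraction `s = (h - 1) / (h + 1)`. -/
theorem TracialState.exists_unitary_norm2_sub_le {b : A} (hb : IsUnit b) {D : ℝ}
    (hD : ∀ s : A, ‖s‖ ≤ 1 → ‖T.toFun (s * (star b * b - 1))‖ ≤ D) :
    ∃ w ∈ unitary A, T.norm2 (b - w) ^ 2 ≤ D := by
  set p := star b * b with hp
  have hps : IsSelfAdjoint p := .star_mul_self b
  have hsp : ∀ t ∈ spectrum ℝ p, 0 ≤ t := by
    let _ := CStarAlgebra.spectralOrder A
    have := CStarAlgebra.spectralOrderedRing A
    exact fun t ht => spectrum_nonneg_of_nonneg (star_mul_self_nonneg b) ht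
  set h := cfc Real.sqrt p with hh
  set s := cfc (fun t => (Real.sqrt t - 1) / (Real.sqrt t + 1)) p with hs
  have hpos : ∀ t : ℝ, 0 < Real.sqrt t + 1 := fun t => by positivity
  have hcs : Continuous fun t : ℝ => (Real.sqrt t - 1) / (Real.sqrt t + 1) :=
    Continuous.div (by fun_prop) (by fun_prop) fun t => (hpos t).ne'
  have hhs : IsSelfAdjoint h := cfc_predicate _ _
  have hhh : h * h = p := by
    rw [hh, ← cfc_mul _ _ p]
    nth_rewrite 2 [← cfc_id' ℝ p]
    exact cfc_congr fun t ht => Real.mul_self_sqrt (hsp t ht)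
  have hsn : ‖s‖ ≤ 1 := by
    refine norm_cfc_le zero_le_one fun t _ => ?_
    rw [Real.norm_eq_abs, abs_div, abs_of_pos (hpos t), div_le_one (hpos t), abs_le]
    have := Real.sqrt_nonneg t
    constructor <;> linarith
  have hse : s * (p - 1) = (h - 1) * (h - 1) := by
    nth_rewrite 1 [← cfc_id' ℝ p]
    rw [hs, hh, ← cfc_one ℝ p, ← cfc_sub .., ← cfc_sub ..,
      ← cfc_mul _ _ p hcs.continuousOn (by fun_prop), ← cfc_mul _ _ p]
    refine cfc_congr fun t ht => ?_
    have h1 := Real.sq_sqrt (hsp t ht)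
    have h2 := hpos t
    simp only [Pi.one_apply]
    field_simp
    linear_combination (1 - Real.sqrt t) * h1
  have hhu : IsUnit h := by
    have : IsUnit (h * h) := by
      rw [hhh]
      exact hb.star.mul hb
    exact ((Commute.refl h).isUnit_mul_iff.1 this).1
  obtain ⟨v, hv⟩ := hhu
  have hv1 : h * (↑v⁻¹ : A) = 1 := by rw [← hv]; simp
  have hv2 : (↑v⁻¹ : A) * h = 1 := by rw [← hv]; simp
  have hvs : star (↑v⁻¹ : A) * h = 1 := by
    have := congrArg star hv1
    simpa [hhs.star_eq] using this
  set w := b * (↑v⁻¹ : A) with hw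
  have hww : star w * w = 1 := by
    calc star w * w = star (↑v⁻¹ : A) * (star b * b) * ↑v⁻¹ := by
          simp only [hw, star_mul, mul_assoc]
      _ = star (↑v⁻¹ : A) * h * (h * ↑v⁻¹) := by rw [← hp, ← hhh]; simp only [mul_assoc]
      _ = 1 := by rw [hv1, hvs, one_mul]
  have hwu : IsUnit w := hb.mul (Units.isUnit _)
  have hww' : w * star w = 1 := by
    obtain ⟨x, hx⟩ := hwu
    have : star w = (↑x⁻¹ : A) := by
      rw [← hx] at hww ⊢
      rw [← mul_one (star (x : A)), ← Units.mul_inv x, ← mul_assoc, hww, one_mul]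
    rw [this, ← hx]
    simp
  refine ⟨w, Unitary.mem_iff.2 ⟨hww, hww'⟩, ?_⟩
  have hbw : b - w = w * (h - 1) := by
    rw [mul_sub, mul_one, hw, mul_assoc, hv2, mul_one]
  rw [hbw, T.norm2_unitary_mul hww, T.norm2_sq, (hhs.sub (.one A)).star_eq, ← hse]
  exact (Complex.re_le_norm _).trans (hD s hsn)

end FunctionalCalculus

/-! ### Density in the 2-norm -/

section Density

variable {H : Type*} [NormedAddCommGroup H] [InnerProductSpace ℂ H] [CompleteSpace H]

/-- The amplification `T ⊗ 1` of an operator to `ℓ²(ι, H)`. -/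
def ampliation (ι : Type*) (T : H →L[ℂ] H) :
    lp (fun _ : ι => H) 2 →L[ℂ] lp (fun _ : ι => H) 2 :=
  lp.mapCLM 2 (fun _ => T) (norm_nonneg T) (fun _ => le_rfl)

variable {ι : Type*}

@[simp]
theorem ampliation_apply (T : H →L[ℂ] H) (ζ : lp (fun _ : ι => H) 2) (i : ι) :
    ampliation ι T ζ i = T (ζ i) := rfl

theorem inner_ampliation_left (T : H →L[ℂ] H) (ζ ζ' : lp (fun _ : ι => H) 2) :
    inner ℂ (ampliation ι T ζ) ζ' = inner ℂ ζ (ampliation ι (star T) ζ') := by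
  rw [lp.inner_eq_tsum, lp.inner_eq_tsum]
  congr 1
  ext i
  simp [ContinuousLinearMap.star_eq_adjoint, ContinuousLinearMap.adjoint_inner_right]

/-- The double commutant theorem in the ultrastrong topology, for the value at one vector of
`ℓ²(ι, H)`: the projection onto the closure of `(A ⊗ 1)ζ` commutes with `A ⊗ 1`, so its matrix
entries lie in the commutant of `A` and it commutes with `a ⊗ 1`. -/
theorem exists_norm_ampliation_sub_lt (A : StarSubalgebra ℂ (H →L[ℂ] H)) {a : H →L[ℂ] H}
    (ha : a ∈ Set.centralizer (Set.centralizer (A : Set (H →L[ℂ] H))))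
    (ζ : lp (fun _ : ι => H) 2) {ε : ℝ} (hε : 0 < ε) :
    ∃ b ∈ A, ‖ampliation ι (a - b) ζ‖ < ε := by
  classical
  let W : Submodule ℂ (lp (fun _ : ι => H) 2) :=
    { carrier := {v | ∃ b ∈ A, ampliation ι b ζ = v}
      add_mem' := by
        rintro _ _ ⟨b, hb, rfl⟩ ⟨c, hc, rfl⟩
        exact ⟨b + c, add_mem hb hc, by ext i; simp⟩
      zero_mem' := ⟨0, zero_mem A, by ext i; simp⟩
      smul_mem' := by
        rintro c _ ⟨b, hb, rfl⟩
        exact ⟨c • b, A.smul_mem hb c, by ext i; simp⟩ }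
  set V := W.topologicalClosure with hV
  have hcl : IsClosed (V : Set (lp (fun _ : ι => H) 2)) := W.isClosed_topologicalClosure
  have : CompleteSpace V := hcl.completeSpace_coe
  have hζ : ζ ∈ V := W.le_topologicalClosure ⟨1, one_mem A, by ext i; simp⟩
  have hinv : ∀ b ∈ A, ∀ v ∈ V, ampliation ι b v ∈ V := by
    intro b hb v hv
    refine map_mem_closure (ampliation ι b).continuous hv ?_
    rintro _ ⟨c, hc, rfl⟩
    exact ⟨b * c, mul_mem hb hc, by ext i; simp⟩
  have hcomm : ∀ b ∈ A, ∀ x, V.starProjection (ampliation ι b x) =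
      ampliation ι b (V.starProjection x) := by
    intro b hb x
    refine Submodule.eq_starProjection_of_mem_of_inner_eq_zero
      (hinv b hb _ (Submodule.starProjection_apply_mem V x)) ?_
    intro w hw
    rw [← map_sub, inner_ampliation_left]
    exact Submodule.starProjection_inner_eq_zero x _ (hinv _ (star_mem hb) w hw)
  let P : ι → ι → (H →L[ℂ] H) := fun i j =>
    (lp.evalCLM ℂ (fun _ : ι => H) 2 i).comp
      (V.starProjection.comp (lp.singleContinuousLinearMap ℂ (fun _ : ι => H) 2 j))
  have hP : ∀ i j x, P i j x = V.starProjection (lp.single 2 j x) i := fun i j x => rfl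
  have hPc : ∀ i j, P i j ∈ Set.centralizer (A : Set (H →L[ℂ] H)) := by
    intro i j b hb
    ext x
    have h1 : ampliation ι b (lp.single 2 j x) = lp.single 2 j (b x) := by
      ext l
      rcases eq_or_ne l j with rfl | hl
      · simp
      · simp [hl]
    change b (V.starProjection (lp.single 2 j x) i) = V.starProjection (lp.single 2 j (b x)) i
    rw [← h1, hcomm b hb, ampliation_apply]
  have haP : ∀ i j x, a (P i j x) = P i j (a x) := by
    intro i j x
    have h := ha _ (hPc i j)
    exact (congrArg (fun T : H →L[ℂ] H => T x) h).symm
  have hmem : ampliation ι a ζ ∈ V := by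
    rw [← Submodule.starProjection_eq_self_iff]
    have h1 : ∀ x : lp (fun _ : ι => H) 2, ∀ i,
        HasSum (fun j => P i j (x j)) (V.starProjection x i) := fun x i =>
      (lp.hasSum_single (by simp) x).mapL
        ((lp.evalCLM ℂ (fun _ : ι => H) 2 i).comp V.starProjection)
    ext i
    refine (h1 (ampliation ι a ζ) i).unique ?_
    have h2 := (h1 ζ i).mapL a
    rw [Submodule.starProjection_eq_self_iff.2 hζ] at h2
    simp only [haP] at h2
    exact h2
  obtain ⟨_, ⟨b, hb, rfl⟩, h⟩ := Metric.mem_closure_iff.1 hmem ε hε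
  refine ⟨b, hb, ?_⟩
  rw [dist_eq_norm] at h
  have e : ampliation ι (a - b) ζ = ampliation ι a ζ - ampliation ι b ζ := by
    ext i
    simp
  rwa [e]

/-- A vector functional with data `ξ`, `η` at `T* T` is controlled by `T ⊗ 1` at the single vector
`ξ ⊕ η`. -/
theorem norm_le_norm_ampliation_sq (T : H →L[ℂ] H) (ξ η : ℕ → H)
    (h : Memℓp (Sum.elim ξ η : ℕ ⊕ ℕ → H) 2) {z : ℂ}
    (hz : HasSum (fun i => inner ℂ (T (η i)) (T (ξ i))) z) :
    ‖z‖ ≤ ‖ampliation (ℕ ⊕ ℕ) T ⟨Sum.elim ξ η, h⟩‖ ^ 2 := by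
  have h1 : HasSum (fun i : ℕ ⊕ ℕ => ‖T ((Sum.elim ξ η : ℕ ⊕ ℕ → H) i)‖ ^ 2)
      (‖ampliation (ℕ ⊕ ℕ) T ⟨Sum.elim ξ η, h⟩‖ ^ 2) := by
    have h0 := lp.hasSum_norm (p := 2) (by simp) (ampliation (ℕ ⊕ ℕ) T ⟨Sum.elim ξ η, h⟩)
    simp only [ENNReal.toReal_ofNat, Real.rpow_ofNat] at h0
    exact h0
  generalize ‖ampliation (ℕ ⊕ ℕ) T ⟨Sum.elim ξ η, h⟩‖ ^ 2 = N at h1 ⊢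
  have h2 : Summable fun i => ‖T (ξ i)‖ ^ 2 := by
    simpa only [Function.comp_def, Sum.elim_inl] using h1.summable.comp_injective Sum.inl_injective
  have h3 : Summable fun i => ‖T (η i)‖ ^ 2 := by
    simpa only [Function.comp_def, Sum.elim_inr] using h1.summable.comp_injective Sum.inr_injective
  have h4 : ∑' i, ‖T (ξ i)‖ ^ 2 + ∑' i, ‖T (η i)‖ ^ 2 = N := by
    rw [← h1.tsum_eq, Summable.tsum_sum]
    · simp only [Sum.elim_inl, Sum.elim_inr]
    · simpa only [Function.comp_def, Sum.elim_inl] using h2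
    · simpa only [Function.comp_def, Sum.elim_inr] using h3
  rw [← h4, ← h2.tsum_add h3, ← hz.tsum_eq]
  refine tsum_of_norm_bounded (h2.add h3).hasSum fun i => ?_
  refine (norm_inner_le_norm _ _).trans ?_
  have e := two_mul_le_add_sq ‖T (η i)‖ ‖T (ξ i)‖
  have e1 : 0 ≤ ‖T (η i)‖ * ‖T (ξ i)‖ := by positivity
  linarith

/-- A faithful normal trace as a tracial state. -/
def FaithfulNormalTrace.toTracialState {M : VonNeumannAlgebra H} (φ : FaithfulNormalTrace M) :
    TracialState M.toStarSubalgebra where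
  toFun := φ.toFun
  map_one := φ.map_one
  nonneg := φ.nonneg
  tracial := φ.tracial

/-- A `*`-algebra of operators which generates the von Neumann algebra `M` is dense in `M` for the
2-norm of a normal trace. -/
theorem FaithfulNormalTrace.exists_norm2_sub_lt {M : VonNeumannAlgebra H}
    (φ : FaithfulNormalTrace M) (A : StarSubalgebra ℂ (H →L[ℂ] H))
    (hA : (M : Set (H →L[ℂ] H)) ⊆ Set.centralizer (Set.centralizer (A : Set (H →L[ℂ] H))))
    (hAM : A ≤ M.toStarSubalgebra) (a : M.toStarSubalgebra) {ε : ℝ} (hε : 0 < ε) :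
    ∃ b : M.toStarSubalgebra, (b : H →L[ℂ] H) ∈ A ∧ φ.toTracialState.norm2 (a - b) < ε := by
  obtain ⟨ξ, η, hξ, hη, hφ⟩ := φ.normal
  have hsum : Summable fun i : ℕ ⊕ ℕ => ‖Sum.elim ξ η i‖ ^ 2 :=
    Summable.sum _ hξ hη
  have hmem : Memℓp (Sum.elim ξ η : ℕ ⊕ ℕ → H) 2 := memℓp_gen (by simpa using hsum)
  obtain ⟨b, hb, hlt⟩ := exists_norm_ampliation_sub_lt A (hA a.2) ⟨_, hmem⟩ hε
  refine ⟨⟨b, hAM hb⟩, hb, ?_⟩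
  set c : M.toStarSubalgebra := a - ⟨b, hAM hb⟩ with hc
  have hcc : (a : H →L[ℂ] H) - b = (c : H →L[ℂ] H) := rfl
  rw [hcc] at hlt
  have h5 := hφ (star c * c)
  have h6 : ∀ i, inner ℂ (η i) (((star c * c : M.toStarSubalgebra) : H →L[ℂ] H) (ξ i)) =
      inner ℂ ((c : H →L[ℂ] H) (η i)) ((c : H →L[ℂ] H) (ξ i)) := fun i =>
    ContinuousLinearMap.adjoint_inner_right (c : H →L[ℂ] H) (η i) ((c : H →L[ℂ] H) (ξ i))
  simp only [h6] at h5
  have h7 := norm_le_norm_ampliation_sq _ _ _ hmem h5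
  refine lt_of_le_of_lt (Real.sqrt_le_iff.2 ⟨norm_nonneg _, ?_⟩) hlt
  exact (Complex.re_le_norm _).trans h7

end Density

/-! ### The ultrapower as a tracial algebra -/

section UltrapowerTrace

open Filter Topology

variable {K : Type*} [NormedAddCommGroup K] [InnerProductSpace ℂ K] [CompleteSpace K]

/-- A von Neumann algebra as a `C*`-algebra. -/
instance vonNeumannCStarAlgebra (R : VonNeumannAlgebra K) : CStarAlgebra R.toStarSubalgebra :=
  StarSubalgebra.cstarAlgebra _ (h_closed := FaithfulNormalTrace.isClosed_coe R)

variable {R : VonNeumannAlgebra K} (τ : FaithfulNormalTrace R) (ω : Ultrafilter ℕ)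

theorem FaithfulNormalTrace.eq_zero_of_norm2_eq_zero {a : R.toStarSubalgebra}
    (h : τ.toTracialState.norm2 a = 0) : a = 0 :=
  τ.faithful a ((TracialState.norm2_eq_zero_iff _ a).1 h)

namespace Ultrapower

instance : StarModule ℂ (Ultrapower τ ω) where
  star_smul c z := by
    obtain ⟨x, rfl⟩ := mk_surjective τ ω z
    rw [← map_smul, star_mk, star_mk, star_smul, map_smul]

theorem trace_eq_of_tendsto {x : boundedSeq R} {c : ℂ}
    (h : Tendsto (fun n => τ.toFun (x.1 n)) ω (𝓝 c)) : trace τ ω (mk τ ω x) = c :=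
  tendsto_nhds_unique (tendsto_trace τ ω x) h

theorem trace_one : trace τ ω 1 = 1 := by
  have h : mk τ ω 1 = 1 := map_one (mk τ ω)
  rw [← h]
  apply trace_eq_of_tendsto
  have e : ∀ n, τ.toFun ((1 : boundedSeq R).1 n) = 1 := fun n => τ.map_one
  simp only [e]
  exact tendsto_const_nhds

theorem trace_star_mul_self_nonneg (z : Ultrapower τ ω) : 0 ≤ trace τ ω (star z * z) := by
  obtain ⟨x, rfl⟩ := mk_surjective τ ω z
  have e : star (mk τ ω x) * mk τ ω x = mk τ ω (star x * x) := (map_mul (mk τ ω) (star x) x).symm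
  have h0 : ∀ n, 0 ≤ τ.toFun ((star x * x).1 n) := fun n => τ.nonneg (x.1 n)
  rw [e]
  exact ge_of_tendsto' (tendsto_trace τ ω (star x * x)) h0

theorem trace_mul_comm (z w : Ultrapower τ ω) : trace τ ω (z * w) = trace τ ω (w * z) := by
  obtain ⟨x, rfl⟩ := mk_surjective τ ω z
  obtain ⟨y, rfl⟩ := mk_surjective τ ω w
  rw [← map_mul, ← map_mul]
  apply trace_eq_of_tendsto
  exact (tendsto_trace τ ω (y * x)).congr fun n => τ.tracial (y.1 n) (x.1 n)

/-- The trace of the ultrapower as a tracial state. -/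
def tracialState : TracialState (Ultrapower τ ω) where
  toFun :=
    { toFun := trace τ ω
      map_add' := by
        intro z w
        obtain ⟨x, rfl⟩ := mk_surjective τ ω z
        obtain ⟨y, rfl⟩ := mk_surjective τ ω w
        rw [← map_add]
        apply trace_eq_of_tendsto
        refine ((tendsto_trace τ ω x).add (tendsto_trace τ ω y)).congr fun n => ?_
        exact (map_add τ.toFun (x.1 n) (y.1 n)).symm
      map_smul' := by
        intro c z
        obtain ⟨x, rfl⟩ := mk_surjective τ ω z
        rw [← map_smul]
        apply trace_eq_of_tendsto
        refine ((tendsto_trace τ ω x).const_mul c).congr fun n => ?_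
        exact (map_smul τ.toFun c (x.1 n)).symm }
  map_one := trace_one τ ω
  nonneg := trace_star_mul_self_nonneg τ ω
  tracial := trace_mul_comm τ ω

theorem tendsto_norm2 (x : boundedSeq R) :
    Tendsto (fun n => τ.toTracialState.norm2 (x.1 n)) ω
      (𝓝 ((tracialState τ ω).norm2 (mk τ ω x))) := by
  have h := tendsto_trace τ ω (star x * x)
  have h2 := (Real.continuous_sqrt.tendsto _).comp ((Complex.continuous_re.tendsto _).comp h)
  exact h2

theorem eq_zero_of_norm2_eq_zero {z : Ultrapower τ ω} (h : (tracialState τ ω).norm2 z = 0) :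
    z = 0 := by
  obtain ⟨x, rfl⟩ := mk_surjective τ ω z
  have h1 := tendsto_norm2 τ ω x
  rw [h] at h1
  rw [← map_zero (mk τ ω), mk_eq_mk_iff, sub_zero]
  exact h1

theorem norm2_mul_le_of_norm_le {x y : boundedSeq R} {C : ℝ}
    (hx : ∀ n, ‖(x.1 n : K →L[ℂ] K)‖ ≤ C) :
    (tracialState τ ω).norm2 (mk τ ω x * mk τ ω y) ≤ C * (tracialState τ ω).norm2 (mk τ ω y) := by
  rw [← map_mul]
  refine le_of_tendsto_of_tendsto' (tendsto_norm2 τ ω (x * y))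
    ((tendsto_norm2 τ ω y).const_mul C) fun n => ?_
  exact (τ.toTracialState.norm2_mul_le (x.1 n) (y.1 n)).trans
    (mul_le_mul_of_nonneg_right (hx n) (TracialState.norm2_nonneg _ _))

theorem exists_norm2_mul_le (z : Ultrapower τ ω) : ∃ C : ℝ, 0 ≤ C ∧ ∀ w,
    (tracialState τ ω).norm2 (z * w) ≤ C * (tracialState τ ω).norm2 w ∧
    (tracialState τ ω).norm2 (w * z) ≤ C * (tracialState τ ω).norm2 w := by
  obtain ⟨x, rfl⟩ := mk_surjective τ ω z
  obtain ⟨C, hC⟩ := x.2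
  refine ⟨C, (norm_nonneg _).trans (hC 0), fun w => ⟨?_, ?_⟩⟩
  · obtain ⟨y, rfl⟩ := mk_surjective τ ω w
    exact norm2_mul_le_of_norm_le τ ω hC
  · rw [← TracialState.norm2_star, star_mul, ← TracialState.norm2_star _ w, star_mk]
    obtain ⟨y, hy⟩ := mk_surjective τ ω (star w)
    rw [← hy]
    exact norm2_mul_le_of_norm_le τ ω fun n => (norm_star (x.1 n : K →L[ℂ] K)).le.trans (hC n)

/-- Elements of `R^ω` which lift to a sequence of contractions. -/
def IsContraction (z : Ultrapower τ ω) : Prop :=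
  ∃ x : boundedSeq R, (∀ n, ‖x.1 n‖ ≤ 1) ∧ mk τ ω x = z

variable {τ ω}

theorem IsContraction.star {z : Ultrapower τ ω} (hz : IsContraction τ ω z) :
    IsContraction τ ω (star z) := by
  obtain ⟨x, hx, rfl⟩ := hz
  exact ⟨Star.star x, fun n => (norm_star (x.1 n)).le.trans (hx n), rfl⟩

theorem IsContraction.norm2_mul_le {z : Ultrapower τ ω} (hz : IsContraction τ ω z)
    (w : Ultrapower τ ω) :
    (tracialState τ ω).norm2 (z * w) ≤ (tracialState τ ω).norm2 w := by
  obtain ⟨x, hx, rfl⟩ := hz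
  obtain ⟨y, rfl⟩ := mk_surjective τ ω w
  simpa using norm2_mul_le_of_norm_le τ ω (C := 1) (y := y) hx

theorem IsContraction.norm2_mul_le' {z : Ultrapower τ ω} (hz : IsContraction τ ω z)
    (w : Ultrapower τ ω) :
    (tracialState τ ω).norm2 (w * z) ≤ (tracialState τ ω).norm2 w := by
  rw [← TracialState.norm2_star, star_mul, ← TracialState.norm2_star _ w]
  exact hz.star.norm2_mul_le _

theorem exists_isSelfAdjoint_rep {h : Ultrapower τ ω} (hh : IsSelfAdjoint h) :
    ∃ x : boundedSeq R, (∀ n, IsSelfAdjoint (x.1 n)) ∧ mk τ ω x = h := by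
  obtain ⟨x, rfl⟩ := mk_surjective τ ω h
  refine ⟨(2⁻¹ : ℂ) • (x + Star.star x), fun n => ?_, ?_⟩
  · change Star.star ((2⁻¹ : ℂ) • (x.1 n + Star.star (x.1 n))) =
      (2⁻¹ : ℂ) • (x.1 n + Star.star (x.1 n))
    simp [add_comm]
  · rw [map_smul, map_add, ← star_mk, hh.star_eq, ← two_smul ℂ, smul_smul]
    simp

/-- Resolvents exist in `R^ω`, computed on a selfadjoint lift. -/
theorem exists_resolvent {h : Ultrapower τ ω} (hh : IsSelfAdjoint h) :
    ∃ r, IsContraction τ ω r ∧ r * (h + Complex.I • 1) = 1 ∧ (h + Complex.I • 1) * r = 1 := by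
  obtain ⟨x, hx, rfl⟩ := exists_isSelfAdjoint_rep hh
  choose r h1 h2 h3 using fun n => Microstates.exists_resolvent (hx n)
  let y : boundedSeq R := ⟨r, 1, h1⟩
  have e : mk τ ω x + Complex.I • 1 = mk τ ω (x + Complex.I • 1) := by
    rw [map_add, map_smul, map_one]
  refine ⟨mk τ ω y, ⟨y, h1, rfl⟩, ?_, ?_⟩
  · rw [e, ← map_mul, ← map_one (mk τ ω)]
    exact congrArg _ (Subtype.ext (funext h2))
  · rw [e, ← map_mul, ← map_one (mk τ ω)]
    exact congrArg _ (Subtype.ext (funext h3))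

/-- Completeness of the contractions of `R^ω` in the 2-norm, by a diagonal sequence: at `m` one
takes the `N`-th lift for the largest `N ≤ m` up to which all the successive distances are small
at `m`. -/
theorem exists_limit_of_contractions (hω : (ω : Filter ℕ) ≤ cofinite) (z : ℕ → Ultrapower τ ω)
    (hz : ∀ N, IsContraction τ ω (z N))
    (hc : ∀ N, (tracialState τ ω).norm2 (z N - z (N + 1)) < (1 / 2) ^ N) :
    ∃ w, ∀ N, (tracialState τ ω).norm2 (z N - w) ≤ 2 * (1 / 2) ^ N := by
  classical
  choose x hx hxz using hz
  let S := τ.toTracialState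
  let P : ℕ → ℕ → Prop := fun m N => ∀ j < N, S.norm2 ((x j).1 m - (x (j + 1)).1 m) < (1 / 2) ^ j
  have hP0 : ∀ m, P m 0 := fun m j hj => absurd hj (Nat.not_lt_zero _)
  let g : ℕ → ℕ := fun m => Nat.findGreatest (P m) m
  have hg : ∀ m, P m (g m) := fun m => Nat.findGreatest_spec (Nat.zero_le m) (hP0 m)
  let y : boundedSeq R := ⟨fun m => (x (g m)).1 m, 1, fun m => hx (g m) m⟩
  refine ⟨mk τ ω y, fun N => ?_⟩
  have hev : ∀ᶠ m in (ω : Filter ℕ), P m N ∧ N ≤ m := by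
    refine Eventually.and ?_ ?_
    · have : ∀ᶠ m in (ω : Filter ℕ), ∀ j ∈ Finset.range N,
          S.norm2 ((x j).1 m - (x (j + 1)).1 m) < (1 / 2) ^ j := by
        rw [Filter.eventually_all_finset]
        intro j _
        have h := tendsto_norm2 τ ω (x j - x (j + 1))
        rw [map_sub, hxz, hxz] at h
        exact h.eventually_lt_const (hc j)
      filter_upwards [this] with m hm j hj using hm j (Finset.mem_range.2 hj)
    · rw [Nat.cofinite_eq_atTop] at hω
      exact hω (eventually_ge_atTop N)
  have hlim := tendsto_norm2 τ ω (x N - y)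
  rw [map_sub, hxz] at hlim
  refine le_of_tendsto hlim ?_
  filter_upwards [hev] with m hm
  have hN : N ≤ g m := Nat.le_findGreatest hm.2 hm.1
  have key : ∀ d, N + d ≤ g m →
      S.norm2 ((x N).1 m - (x (N + d)).1 m) ≤ 2 * (1 / 2) ^ N - 2 * (1 / 2) ^ (N + d) := by
    intro d
    induction d with
    | zero =>
      intro _
      simp [S.norm2_zero]
    | succ d ih =>
      intro hd
      have h1 := ih (by omega)
      have h2 := hg m (N + d) (by omega)
      have h3 := S.norm2_sub_le' ((x N).1 m) ((x (N + d)).1 m) ((x (N + (d + 1))).1 m)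
      rw [show N + (d + 1) = N + d + 1 by ring] at h3 ⊢
      rw [pow_succ (1 / 2 : ℝ) (N + d)]
      linarith
  obtain ⟨d, hd⟩ := Nat.exists_eq_add_of_le hN
  have h1 := key d hd.ge
  rw [← hd] at h1
  have h2 : (0 : ℝ) ≤ (1 / 2) ^ g m := by positivity
  exact h1.trans (by linarith)

/-- The decomposition of a selfadjoint element of `R^ω` into positive and negative part. -/
theorem exists_orthogonal_decomposition {h : Ultrapower τ ω} (hh : IsSelfAdjoint h) :
    ∃ p q : Ultrapower τ ω, star p = p ∧ star q = q ∧ q * p = 0 ∧ h = p * p - q * q := by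
  obtain ⟨x, hx, rfl⟩ := exists_isSelfAdjoint_rep hh
  obtain ⟨C, hC⟩ := x.2
  choose p q hp hq hpn hqn hqp hxpq using fun n =>
    Microstates.exists_orthogonal_decomposition (hx n)
  let p' : boundedSeq R := ⟨p, Real.sqrt C, fun n => (hpn n).trans (Real.sqrt_le_sqrt (hC n))⟩
  let q' : boundedSeq R := ⟨q, Real.sqrt C, fun n => (hqn n).trans (Real.sqrt_le_sqrt (hC n))⟩
  have e1 : star p' = p' := Subtype.ext (funext hp)
  have e2 : star q' = q' := Subtype.ext (funext hq)
  have e3 : q' * p' = 0 := Subtype.ext (funext hqp)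
  have e4 : x = p' * p' - q' * q' := Subtype.ext (funext hxpq)
  refine ⟨mk τ ω p', mk τ ω q', ?_, ?_, ?_, ?_⟩
  · rw [star_mk, e1]
  · rw [star_mk, e2]
  · rw [← map_mul, e3, map_zero]
  · have e5 : mk τ ω (p' * p') = mk τ ω p' * mk τ ω p' := map_mul (mk τ ω) p' p'
    have e6 : mk τ ω (q' * q') = mk τ ω q' * mk τ ω q' := map_mul (mk τ ω) q' q'
    rw [e4, ← e5, ← e6]
    exact map_sub (mk τ ω) _ _

/-- The positive cone of `R^ω` is closed in the 2-norm: the negative part `h⁻` of a limit `h` of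
positive elements satisfies `0 ≤ T(h⁻ h) = -|h⁻|₂²`. -/
theorem exists_eq_star_mul_self {h : Ultrapower τ ω} (hh : IsSelfAdjoint h)
    (hlim : ∀ ε > 0, ∃ d : Ultrapower τ ω, (tracialState τ ω).norm2 (h - star d * d) < ε) :
    ∃ d, h = star d * d := by
  obtain ⟨P, Q, hPs, hQs, hQP, hX⟩ := exists_orthogonal_decomposition hh
  set T := tracialState τ ω
  -- `Q * Q` is the negative part of `h`
  have h1 : Q * Q * h = -(star (Q * Q) * (Q * Q)) := by
    rw [hX, star_mul, hQs, mul_sub, ← mul_assoc, mul_assoc Q Q P, hQP]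
    simp
  have h2 : ∀ d : Ultrapower τ ω, 0 ≤ (T.toFun (Q * Q * (star d * d))).re := by
    intro d
    have e : T.toFun (Q * Q * (star d * d)) = T.toFun (star (d * Q) * (d * Q)) := by
      rw [mul_assoc, T.tracial, star_mul, hQs]
      simp only [mul_assoc]
    rw [e]
    exact T.re_nonneg _
  have h3 : ∀ ε > 0, T.norm2 (Q * Q) ^ 2 ≤ T.norm2 (Q * Q) * ε := by
    intro ε hε
    obtain ⟨d, hd⟩ := hlim ε hε
    have e1 := T.norm_apply_mul_le (Q * Q) (h - star d * d)
    have e2 := (Complex.abs_re_le_norm _).trans e1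
    rw [mul_sub, map_sub, h1, map_neg, Complex.sub_re, Complex.neg_re, ← T.norm2_sq] at e2
    have e3 := h2 d
    have e4 := (abs_le.1 e2).1
    have e5 := mul_le_mul_of_nonneg_left hd.le (T.norm2_nonneg (Q * Q))
    linarith
  have h4 : T.norm2 (Q * Q) = 0 := by
    by_contra hne
    have hpos : 0 < T.norm2 (Q * Q) := lt_of_le_of_ne (T.norm2_nonneg _) (Ne.symm hne)
    have := h3 (T.norm2 (Q * Q) / 2) (by positivity)
    nlinarith
  refine ⟨P, ?_⟩
  rw [hX, eq_zero_of_norm2_eq_zero τ ω h4, sub_zero, hPs]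

end Ultrapower

end UltrapowerTrace

/-! ### Trace preserving homomorphisms are normal -/

section Normality

open Filter Topology

variable {H : Type*} [NormedAddCommGroup H] [InnerProductSpace ℂ H] [CompleteSpace H]

/-- An eventually bounded family of operators has a weak operator limit along an ultrafilter. -/
theorem exists_weak_limit {ι : Type*} (U : Ultrafilter ι) (a : ι → H →L[ℂ] H) {C : ℝ}
    (hC : ∀ᶠ i in (U : Filter ι), ‖a i‖ ≤ C) :
    ∃ s : H →L[ℂ] H, ∀ v w, Tendsto (fun i => inner ℂ (a i v) w) U (𝓝 (inner ℂ (s v) w)) := by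
  have hb : ∀ v w, ∀ᶠ i in (U : Filter ι), ‖inner ℂ (a i v) w‖ ≤ C * ‖v‖ * ‖w‖ := by
    intro v w
    filter_upwards [hC] with i hi
    refine (norm_inner_le_norm _ _).trans ?_
    gcongr
    exact (a i).le_of_opNorm_le hi v
  have hex : ∀ v w, ∃ c, Tendsto (fun i => inner ℂ (a i v) w) U (𝓝 c) := by
    intro v w
    obtain ⟨c, -, hc⟩ := (isCompact_closedBall (0 : ℂ) (C * ‖v‖ * ‖w‖)).ultrafilter_le_nhds
      (U.map fun i => inner ℂ (a i v) w) (by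
        rw [Filter.le_principal_iff]
        refine Filter.mem_map.2 (mem_of_superset (hb v w) fun i hi => ?_)
        simpa using hi)
    exact ⟨c, hc⟩
  choose B hB using hex
  let B₁ : H →ₗ⋆[ℂ] H →ₗ[ℂ] ℂ := LinearMap.mk₂'ₛₗ (starRingEnd ℂ) (RingHom.id ℂ) B
    (fun v v' w => tendsto_nhds_unique (hB (v + v') w)
      (by simpa [inner_add_left] using (hB v w).add (hB v' w)))
    (fun c v w => tendsto_nhds_unique (hB (c • v) w)
      (by simpa [inner_smul_left, mul_comm] using (hB v w).const_mul (starRingEnd ℂ c)))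
    (fun v w w' => tendsto_nhds_unique (hB v (w + w'))
      (by simpa [inner_add_right] using (hB v w).add (hB v w')))
    (fun c v w => tendsto_nhds_unique (hB v (c • w))
      (by simpa [inner_smul_right] using (hB v w).const_mul c))
  have hB₁ : ∀ v w, ‖B₁ v w‖ ≤ C * ‖v‖ * ‖w‖ := fun v w =>
    le_of_tendsto (hB v w).norm (hb v w)
  refine ⟨InnerProductSpace.continuousLinearMapOfBilin (B₁.mkContinuous₂ C hB₁), fun v w => ?_⟩
  rw [InnerProductSpace.continuousLinearMapOfBilin_apply]
  exact hB v w

/-- A selfadjoint element of `M` with nonnegative quadratic form is of the form `c* c` in `M`. -/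
theorem exists_eq_star_mul_self_of_re_inner_nonneg {M : VonNeumannAlgebra H}
    {h : M.toStarSubalgebra} (hh : IsSelfAdjoint h)
    (hpos : ∀ v, 0 ≤ (inner ℂ ((h : H →L[ℂ] H) v) v).re) :
    ∃ c, h = star c * c := by
  obtain ⟨p, q, hp, hq, -, -, hqp, hpq⟩ := exists_orthogonal_decomposition hh
  have hq2 : q * q = 0 := by
    apply Subtype.ext
    apply ContinuousLinearMap.ext
    intro v
    have h1 := hpos ((q : H →L[ℂ] H) v)
    have h2 : q * h * q = -(star (q * q) * (q * q)) := by
      rw [hpq, star_mul, hq, mul_sub, ← mul_assoc, hqp]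
      simp [mul_assoc]
    have hq' : ContinuousLinearMap.adjoint (q : H →L[ℂ] H) = q := congrArg Subtype.val hq
    have h3 : inner ℂ ((h : H →L[ℂ] H) ((q : H →L[ℂ] H) v)) ((q : H →L[ℂ] H) v) =
        inner ℂ (((q * h * q : M.toStarSubalgebra) : H →L[ℂ] H) v) v := by
      rw [← ContinuousLinearMap.adjoint_inner_left, hq']
      rfl
    have h4 : inner ℂ (((-(star (q * q) * (q * q)) : M.toStarSubalgebra) : H →L[ℂ] H) v) v =
        -inner ℂ (((q * q : M.toStarSubalgebra) : H →L[ℂ] H) v)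
          (((q * q : M.toStarSubalgebra) : H →L[ℂ] H) v) := by
      rw [← ContinuousLinearMap.adjoint_inner_left, ← inner_neg_left]
      rfl
    rw [h3, h2, h4, Complex.neg_re] at h1
    have h5 := inner_self_nonneg (𝕜 := ℂ) (x := ((q * q : M.toStarSubalgebra) : H →L[ℂ] H) v)
    have h6 : RCLike.re (inner ℂ (((q * q : M.toStarSubalgebra) : H →L[ℂ] H) v)
          (((q * q : M.toStarSubalgebra) : H →L[ℂ] H) v)) = 0 := by
      apply le_antisymm _ h5
      change Complex.re _ ≤ 0
      linarith
    rw [inner_self_eq_norm_sq] at h6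
    simpa using h6
  exact ⟨p, by rw [hpq, hq2, sub_zero, hp]⟩

theorem norm_le_of_starLE {A : Type*} [CStarAlgebra A] {a b s : A} (hab : StarLE a b)
    (hbs : StarLE b s) : ‖s - b‖ ≤ ‖s - a‖ := by
  let _ := CStarAlgebra.spectralOrder A
  have := CStarAlgebra.spectralOrderedRing A
  obtain ⟨c, hc⟩ := hab
  obtain ⟨d, hd⟩ := hbs
  refine CStarAlgebra.norm_le_norm_of_nonneg_of_le (hd ▸ star_mul_self_nonneg d) ?_
  have h := star_mul_self_nonneg c
  rw [← hc] at h
  exact sub_le_sub_left (sub_nonneg.1 h) s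

theorem StarLE.antisymm {A : Type*} [CStarAlgebra A] {a b : A} (hab : StarLE a b)
    (hba : StarLE b a) : a = b := by
  let _ := CStarAlgebra.spectralOrder A
  have := CStarAlgebra.spectralOrderedRing A
  obtain ⟨c, hc⟩ := hab
  obtain ⟨d, hd⟩ := hba
  exact le_antisymm (sub_nonneg.1 (hc ▸ star_mul_self_nonneg c))
    (sub_nonneg.1 (hd ▸ star_mul_self_nonneg d))

theorem StarLE.trans {A : Type*} [CStarAlgebra A] {a b c : A} (hab : StarLE a b)
    (hbc : StarLE b c) : StarLE a c := by
  let _ := CStarAlgebra.spectralOrder A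
  have := CStarAlgebra.spectralOrderedRing A
  obtain ⟨d, hd⟩ := hab
  obtain ⟨e, he⟩ := hbc
  have h := add_nonneg (star_mul_self_nonneg d) (star_mul_self_nonneg e)
  obtain ⟨f, hf⟩ := CStarAlgebra.nonneg_iff_eq_star_mul_self.1 h
  exact ⟨f, by rw [← hf, ← hd, ← he]; abel⟩

theorem StarLE.refl {A : Type*} [Ring A] [StarRing A] (a : A) : StarLE a a := ⟨0, by simp⟩

variable {M : VonNeumannAlgebra H} (φ : FaithfulNormalTrace M)

theorem StarLE.re_inner_nonneg {a b : M.toStarSubalgebra} (hab : StarLE a b) (v : H) :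
    (inner ℂ ((a : H →L[ℂ] H) v) v).re ≤ (inner ℂ ((b : H →L[ℂ] H) v) v).re := by
  obtain ⟨c, hc⟩ := hab
  have h1 : (b : H →L[ℂ] H) - a = ContinuousLinearMap.adjoint (c : H →L[ℂ] H) * c :=
    congrArg Subtype.val hc
  have h2 : inner ℂ (((b : H →L[ℂ] H) - a) v) v =
      inner ℂ ((c : H →L[ℂ] H) v) ((c : H →L[ℂ] H) v) := by
    rw [h1, ← ContinuousLinearMap.adjoint_inner_left]
    rfl
  have h3 : 0 ≤ (inner ℂ (((b : H →L[ℂ] H) - a) v) v).re := by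
    rw [h2]
    exact inner_self_nonneg (𝕜 := ℂ)
  rw [sub_apply, inner_sub_left, Complex.sub_re] at h3
  linarith

/-- The supremum of a directed set is a weak operator limit of the set along an ultrafilter. -/
theorem exists_ultrafilter_tendsto_of_isStarLUB {S : Set M.toStarSubalgebra}
    {s : M.toStarSubalgebra} (hne : S.Nonempty) (hsa : ∀ a ∈ S, IsSelfAdjoint a)
    (hdir : ∀ a ∈ S, ∀ b ∈ S, ∃ c ∈ S, StarLE a c ∧ StarLE b c) (hs : IsStarLUB S s) :
    ∃ (U : Ultrafilter S) (C : ℝ),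
      (∀ᶠ a : S in (U : Filter S), ‖s - (a : M.toStarSubalgebra)‖ ≤ C) ∧
      ∀ v w, Tendsto (fun a : S => inner ℂ (((a : M.toStarSubalgebra) : H →L[ℂ] H) v) w) U
        (𝓝 (inner ℂ ((s : H →L[ℂ] H) v) w)) := by
  have : Nonempty S := hne.to_subtype
  let F : Filter S := ⨅ a : S, 𝓟 {b : S | StarLE (a : M.toStarSubalgebra) b}
  have hF : F.NeBot := by
    refine iInf_neBot_of_directed' (fun a b => ?_) fun a =>
      principal_neBot_iff.2 ⟨a, StarLE.refl _⟩
    obtain ⟨c, hc, h1, h2⟩ := hdir a a.2 b b.2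
    exact ⟨⟨c, hc⟩, principal_mono.2 fun d hd => h1.trans hd,
      principal_mono.2 fun d hd => h2.trans hd⟩
  let U : Ultrafilter S := Ultrafilter.of F
  have hU : ∀ a : S, ∀ᶠ b : S in (U : Filter S), StarLE (a : M.toStarSubalgebra) b := fun a =>
    Ultrafilter.of_le F (mem_iInf_of_mem a (mem_principal_self _))
  obtain ⟨a₀⟩ := ‹Nonempty S›
  have hC : ∀ᶠ a : S in (U : Filter S), ‖s - (a : M.toStarSubalgebra)‖ ≤ ‖s - a₀‖ := by
    filter_upwards [hU a₀] with b hb using norm_le_of_starLE hb (hs.1 b b.2)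
  refine ⟨U, ‖s - a₀‖, hC, ?_⟩
  have hC' : ∀ᶠ a : S in (U : Filter S),
      ‖((a : M.toStarSubalgebra) : H →L[ℂ] H)‖ ≤ ‖s‖ + ‖s - a₀‖ := by
    filter_upwards [hC] with a ha
    have h := norm_sub_le s (s - (a : M.toStarSubalgebra))
    rw [sub_sub_cancel] at h
    have h' : ‖((a : M.toStarSubalgebra) : H →L[ℂ] H)‖ ≤ ‖s‖ + ‖s - (a : M.toStarSubalgebra)‖ := h
    linarith
  obtain ⟨t, ht⟩ := exists_weak_limit U
    (fun a : S => ((a : M.toStarSubalgebra) : H →L[ℂ] H)) hC'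
  have htM : t ∈ (M : Set (H →L[ℂ] H)) := by
    rw [← M.centralizer_centralizer]
    intro g hg
    apply ContinuousLinearMap.ext
    intro v
    refine ext_inner_right ℂ fun w => ?_
    have h1 := ht v (ContinuousLinearMap.adjoint g w)
    rw [ContinuousLinearMap.adjoint_inner_right] at h1
    refine tendsto_nhds_unique h1 ((ht (g v) w).congr fun a => ?_)
    have h2 := hg _ (show ((a : M.toStarSubalgebra) : H →L[ℂ] H) ∈ (M : Set (H →L[ℂ] H)) from
      (a : M.toStarSubalgebra).2)
    rw [ContinuousLinearMap.adjoint_inner_right]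
    exact congrArg (fun T : H →L[ℂ] H => inner ℂ (T v) w) h2
  have hadj : ∀ a : M.toStarSubalgebra, IsSelfAdjoint a →
      ContinuousLinearMap.adjoint (a : H →L[ℂ] H) = a := fun a ha => congrArg Subtype.val ha
  have htsa : ContinuousLinearMap.adjoint t = t := by
    apply ContinuousLinearMap.ext
    intro v
    refine ext_inner_right ℂ fun w => ?_
    have h1 := (ht w v).star
    rw [ContinuousLinearMap.adjoint_inner_left]
    simp only [RCLike.star_def, inner_conj_symm] at h1
    refine tendsto_nhds_unique h1 ((ht v w).congr fun a => ?_)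
    rw [← ContinuousLinearMap.adjoint_inner_left, hadj _ (hsa a a.2)]
  let t' : M.toStarSubalgebra := ⟨t, htM⟩
  have htsa' : IsSelfAdjoint t' := Subtype.ext htsa
  have hssa : IsSelfAdjoint s := by
    obtain ⟨c, hc⟩ := hs.1 a₀ a₀.2
    rw [sub_eq_iff_eq_add] at hc
    rw [hc]
    exact (IsSelfAdjoint.star_mul_self c).add (hsa a₀ a₀.2)
  have htre : ∀ v, Tendsto (fun a : S => (inner ℂ (((a : M.toStarSubalgebra) : H →L[ℂ] H) v) v).re)
      U (𝓝 (inner ℂ (t v) v).re) := fun v => (Complex.continuous_re.tendsto _).comp (ht v v)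
  have hle : ∀ a ∈ S, StarLE a t' := by
    intro a ha
    refine exists_eq_star_mul_self_of_re_inner_nonneg (htsa'.sub (hsa a ha)) fun v => ?_
    have h1 : (inner ℂ ((a : H →L[ℂ] H) v) v).re ≤ (inner ℂ (t v) v).re := by
      refine ge_of_tendsto (htre v) ?_
      filter_upwards [hU ⟨a, ha⟩] with b hb using hb.re_inner_nonneg v
    have h2 : ((t' - a : M.toStarSubalgebra) : H →L[ℂ] H) v = t v - (a : H →L[ℂ] H) v := rfl
    rw [h2, inner_sub_left, Complex.sub_re]
    linarith
  have hge : StarLE t' s := by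
    refine exists_eq_star_mul_self_of_re_inner_nonneg (hssa.sub htsa') fun v => ?_
    have h1 : (inner ℂ (t v) v).re ≤ (inner ℂ ((s : H →L[ℂ] H) v) v).re :=
      le_of_tendsto' (htre v) fun a => (hs.1 a a.2).re_inner_nonneg v
    have h2 : ((s - t' : M.toStarSubalgebra) : H →L[ℂ] H) v = (s : H →L[ℂ] H) v - t v := rfl
    rw [h2, inner_sub_left, Complex.sub_re]
    linarith
  have hst : s = t' := (hs.2 t' hle).antisymm hge
  rw [hst]
  exact ht

/-- The supremum `s` of a directed set is in the 2-norm closure of the set: normality gives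
`φ(s - a) → 0`, and `|s - a|₂² ≤ ‖s - a‖ φ(s - a)` as `s - a ≥ 0`. -/
theorem FaithfulNormalTrace.exists_mem_norm2_sub_lt {S : Set M.toStarSubalgebra}
    {s : M.toStarSubalgebra} (hne : S.Nonempty) (hsa : ∀ a ∈ S, IsSelfAdjoint a)
    (hdir : ∀ a ∈ S, ∀ b ∈ S, ∃ c ∈ S, StarLE a c ∧ StarLE b c) (hs : IsStarLUB S s)
    {ε : ℝ} (hε : 0 < ε) : ∃ a ∈ S, φ.toTracialState.norm2 (s - a) < ε := by
  obtain ⟨U, C, hC, hU⟩ := exists_ultrafilter_tendsto_of_isStarLUB hne hsa hdir hs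
  obtain ⟨ξ, η, hξ, hη, hφ⟩ := φ.normal
  have hC0 : 0 ≤ C := by
    obtain ⟨a, ha⟩ := hC.exists
    exact (norm_nonneg _).trans ha
  have hlim : Tendsto (fun a : S => φ.toFun (s - a)) U (𝓝 0) := by
    have h1 : ∀ a : S, φ.toFun (s - a) = ∑' i, inner ℂ (η i)
        (((s - a : M.toStarSubalgebra) : H →L[ℂ] H) (ξ i)) := fun a => (hφ (s - a)).tsum_eq.symm
    simp only [h1]
    rw [← tsum_zero (α := ℂ) (β := ℕ)]
    refine tendsto_tsum_of_dominated_convergence (bound := fun i => C * (‖ξ i‖ ^ 2 + ‖η i‖ ^ 2))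
      ((hξ.add hη).mul_left C) (fun i => ?_) ?_
    · have h2 : Tendsto (fun a : S => inner ℂ ((s : H →L[ℂ] H) (ξ i)) (η i) -
          inner ℂ (((a : M.toStarSubalgebra) : H →L[ℂ] H) (ξ i)) (η i)) U (𝓝 0) := by
        simpa using (hU (ξ i) (η i)).const_sub (inner ℂ ((s : H →L[ℂ] H) (ξ i)) (η i))
      have h3 := h2.star
      rw [star_zero] at h3
      refine h3.congr fun a => ?_
      rw [← inner_sub_left, RCLike.star_def, inner_conj_symm]
      rfl
    · filter_upwards [hC] with a ha i
      have h4 : ‖((s - a : M.toStarSubalgebra) : H →L[ℂ] H) (ξ i)‖ ≤ C * ‖ξ i‖ :=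
        ContinuousLinearMap.le_of_opNorm_le _ ha _
      refine (norm_inner_le_norm _ _).trans ?_
      have h5 := mul_le_mul_of_nonneg_left h4 (norm_nonneg (η i))
      have h6 := two_mul_le_add_sq ‖ξ i‖ ‖η i‖
      have h7 : 0 ≤ ‖ξ i‖ * ‖η i‖ := by positivity
      have h8 : ‖ξ i‖ * ‖η i‖ ≤ ‖ξ i‖ ^ 2 + ‖η i‖ ^ 2 := by linarith
      calc _ ≤ ‖η i‖ * (C * ‖ξ i‖) := h5
        _ = C * (‖ξ i‖ * ‖η i‖) := by ring
        _ ≤ _ := mul_le_mul_of_nonneg_left h8 hC0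
  have hlim2 := (hlim.norm).const_mul C
  rw [norm_zero, mul_zero] at hlim2
  obtain ⟨a, ha1, ha2⟩ := ((hlim2.eventually_lt_const (show 0 < ε ^ 2 by positivity)).and hC).exists
  refine ⟨a, a.2, lt_of_pow_lt_pow_left₀ 2 hε.le (lt_of_le_of_lt ?_ ha1)⟩
  obtain ⟨c, hc⟩ := hs.1 a a.2
  have h1 := φ.toTracialState.norm2_mul_le (star c) c
  have h2 : ‖star c‖ ^ 2 = ‖s - (a : M.toStarSubalgebra)‖ := by
    rw [hc, CStarRing.norm_star_mul_self, norm_star, sq]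
  have h3 : φ.toTracialState.norm2 c ^ 2 ≤ ‖φ.toFun (s - a)‖ := by
    rw [TracialState.norm2_sq, hc]
    exact Complex.re_le_norm _
  calc φ.toTracialState.norm2 (s - a) ^ 2 ≤ (‖star c‖ * φ.toTracialState.norm2 c) ^ 2 := by
        rw [hc]
        exact pow_le_pow_left₀ (TracialState.norm2_nonneg _ _) h1 2
    _ = ‖s - (a : M.toStarSubalgebra)‖ * φ.toTracialState.norm2 c ^ 2 := by rw [mul_pow, h2]
    _ ≤ C * ‖φ.toFun (s - a)‖ := by gcongr

variable {K : Type*} [NormedAddCommGroup K] [InnerProductSpace ℂ K] [CompleteSpace K]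
  {R : VonNeumannAlgebra K} {τ : FaithfulNormalTrace R} {ω : Ultrafilter ℕ}

/-- A trace preserving unital `*`-homomorphism is automatically normal and injective. -/
theorem isEmbedding_of_trace_preserving (σ : M.toStarSubalgebra →⋆ₐ[ℂ] Ultrapower τ ω)
    (hσ : ∀ a, Ultrapower.trace τ ω (σ a) = φ.toFun a) : IsEmbedding φ τ ω σ := by
  have hn : ∀ a, (Ultrapower.tracialState τ ω).norm2 (σ a) = φ.toTracialState.norm2 a := by
    intro a
    have : (Ultrapower.tracialState τ ω).toFun (star (σ a) * σ a) = φ.toFun (star a * a) := by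
      rw [← map_star, ← map_mul]
      exact hσ _
    rw [TracialState.norm2, TracialState.norm2, this]
    rfl
  refine ⟨?_, ?_, hσ⟩
  · intro S s hne hsa hdir hs
    refine ⟨?_, ?_⟩
    · rintro _ ⟨a, ha, rfl⟩
      obtain ⟨c, hc⟩ := hs.1 a ha
      exact ⟨σ c, by rw [← map_sub, hc, map_mul, map_star]⟩
    · intro b hb
      obtain ⟨a₀, ha₀⟩ := hne
      have hbsa : IsSelfAdjoint b := by
        obtain ⟨c, hc⟩ := hb _ ⟨a₀, ha₀, rfl⟩
        rw [sub_eq_iff_eq_add] at hc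
        rw [hc]
        exact (IsSelfAdjoint.star_mul_self c).add ((hsa a₀ ha₀).map σ)
      have hssa : IsSelfAdjoint s := by
        obtain ⟨c, hc⟩ := hs.1 a₀ ha₀
        rw [sub_eq_iff_eq_add] at hc
        rw [hc]
        exact (IsSelfAdjoint.star_mul_self c).add (hsa a₀ ha₀)
      refine Ultrapower.exists_eq_star_mul_self (hbsa.sub (hssa.map σ)) fun ε hε => ?_
      obtain ⟨a, ha, hlt⟩ := φ.exists_mem_norm2_sub_lt ⟨a₀, ha₀⟩ hsa hdir hs hε
      obtain ⟨d, hd⟩ := hb _ ⟨a, ha, rfl⟩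
      refine ⟨d, ?_⟩
      rw [← hd, sub_sub_sub_cancel_left, ← map_sub, hn, TracialState.norm2_sub_comm]
      exact hlt
  · intro a b hab
    have h : (Ultrapower.tracialState τ ω).norm2 (σ (a - b)) = 0 := by
      rw [map_sub, hab, sub_self, TracialState.norm2_zero]
    rw [hn] at h
    exact sub_eq_zero.1 (φ.eq_zero_of_norm2_eq_zero h)

end Normality

/-! ### Extension of trace preserving maps from generators -/

section Extension

section Relation

variable {A B : Type*} [Ring A] [StarRing A] [Algebra ℂ A] [StarModule ℂ A]
  [Ring B] [StarRing B] [Algebra ℂ B] [StarModule ℂ B]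
  (S : TracialState A) (T : TracialState B) (D : StarSubalgebra ℂ (A × B))

/-- Multiplication by each element, from either side, is bounded for the 2-norm. -/
def TracialState.BoundedMul (S : TracialState A) : Prop :=
  ∀ a, ∃ C : ℝ, 0 ≤ C ∧ ∀ w, S.norm2 (a * w) ≤ C * S.norm2 w ∧ S.norm2 (w * a) ≤ C * S.norm2 w

/-- The closure of `D ⊆ A × B` for the 2-norms of both factors, as a relation. -/
def ClosureRel (a : A) (b : B) : Prop :=
  ∀ ε > 0, ∃ p ∈ D, S.norm2 (p.1 - a) < ε ∧ T.norm2 (p.2 - b) < ε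

variable {S T D}

theorem ClosureRel.of_mem {p : A × B} (hp : p ∈ D) : ClosureRel S T D p.1 p.2 := fun ε hε =>
  ⟨p, hp, by simpa [S.norm2_zero], by simpa [T.norm2_zero]⟩

theorem ClosureRel.of_limit {a : A} {b : B}
    (h : ∀ ε > 0, ∃ a' b', ClosureRel S T D a' b' ∧ S.norm2 (a' - a) < ε ∧ T.norm2 (b' - b) < ε) :
    ClosureRel S T D a b := by
  intro ε hε
  obtain ⟨a', b', hr, h1, h2⟩ := h (ε / 2) (by positivity)
  obtain ⟨p, hp, h3, h4⟩ := hr (ε / 2) (by positivity)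
  exact ⟨p, hp, by linarith [S.norm2_sub_le' p.1 a' a], by linarith [T.norm2_sub_le' p.2 b' b]⟩

theorem ClosureRel.add {a a' : A} {b b' : B} (h : ClosureRel S T D a b)
    (h' : ClosureRel S T D a' b') : ClosureRel S T D (a + a') (b + b') := by
  intro ε hε
  obtain ⟨p, hp, h1, h2⟩ := h (ε / 2) (by positivity)
  obtain ⟨q, hq, h3, h4⟩ := h' (ε / 2) (by positivity)
  refine ⟨p + q, add_mem hp hq, ?_, ?_⟩
  · rw [Prod.fst_add, add_sub_add_comm]
    linarith [S.norm2_add_le (p.1 - a) (q.1 - a')]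
  · rw [Prod.snd_add, add_sub_add_comm]
    linarith [T.norm2_add_le (p.2 - b) (q.2 - b')]

theorem ClosureRel.adjoint {a : A} {b : B} (h : ClosureRel S T D a b) :
    ClosureRel S T D (star a) (star b) := by
  intro ε hε
  obtain ⟨p, hp, h1, h2⟩ := h ε hε
  refine ⟨star p, star_mem hp, ?_, ?_⟩
  · rwa [Prod.fst_star, ← star_sub, S.norm2_star]
  · rwa [Prod.snd_star, ← star_sub, T.norm2_star]

theorem ClosureRel.smul {a : A} {b : B} (c : ℂ) (h : ClosureRel S T D a b) :
    ClosureRel S T D (c • a) (c • b) := by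
  intro ε hε
  obtain ⟨p, hp, h1, h2⟩ := h (ε / (‖c‖ + 1)) (by positivity)
  rw [lt_div_iff₀ (by positivity)] at h1 h2
  have e1 := S.norm2_nonneg (p.1 - a)
  have e2 := T.norm2_nonneg (p.2 - b)
  refine ⟨c • p, D.smul_mem hp c, ?_, ?_⟩
  · rw [Prod.smul_fst, ← smul_sub, S.norm2_smul]
    linarith
  · rw [Prod.smul_snd, ← smul_sub, T.norm2_smul]
    linarith

theorem TracialState.norm2_mul_sub_mul_lt (S : TracialState A) {C C' δ ε : ℝ} {a a' p q : A}
    (h1 : S.norm2 (p * (q - a')) ≤ C * S.norm2 (q - a'))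
    (h2 : S.norm2 ((p - a) * a') ≤ C' * S.norm2 (p - a)) (hC : 0 ≤ C) (hC' : 0 ≤ C')
    (hp : S.norm2 (p - a) < ε / (2 * (C' + 1))) (hq : S.norm2 (q - a') < δ)
    (hδ : δ ≤ ε / (2 * (C + 1))) :
    S.norm2 (p * q - a * a') < ε := by
  have e : p * q - a * a' = p * (q - a') + (p - a) * a' := by noncomm_ring
  have hq' := hq.trans_le hδ
  rw [lt_div_iff₀ (by positivity)] at hp hq'
  have e1 := S.norm2_nonneg (q - a')
  have e2 := S.norm2_nonneg (p - a)
  rw [e]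
  linarith [S.norm2_add_le (p * (q - a')) ((p - a) * a')]

theorem ClosureRel.mul (hS : S.BoundedMul) (hT : T.BoundedMul) {a a' : A} {b b' : B}
    (h : ClosureRel S T D a b) (h' : ClosureRel S T D a' b') :
    ClosureRel S T D (a * a') (b * b') := by
  intro ε hε
  obtain ⟨C₁, hC₁, hC₁'⟩ := hS a'
  obtain ⟨C₂, hC₂, hC₂'⟩ := hT b'
  obtain ⟨p, hp, h1, h2⟩ := h (min (ε / (2 * (C₁ + 1))) (ε / (2 * (C₂ + 1)))) (by positivity)
  obtain ⟨C₃, hC₃, hC₃'⟩ := hS p.1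
  obtain ⟨C₄, hC₄, hC₄'⟩ := hT p.2
  obtain ⟨q, hq, h3, h4⟩ := h' (min (ε / (2 * (C₃ + 1))) (ε / (2 * (C₄ + 1)))) (by positivity)
  exact ⟨p * q, mul_mem hp hq,
    S.norm2_mul_sub_mul_lt (hC₃' _).1 (hC₁' _).2 hC₃ hC₁ (h1.trans_le (min_le_left _ _)) h3
      (min_le_left _ _),
    T.norm2_mul_sub_mul_lt (hC₄' _).1 (hC₂' _).2 hC₄ hC₂ (h2.trans_le (min_le_right _ _)) h4
      (min_le_right _ _)⟩

theorem norm2_snd_eq (hlaw : ∀ p ∈ D, S.toFun p.1 = T.toFun p.2) {p : A × B} (hp : p ∈ D) :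
    T.norm2 p.2 = S.norm2 p.1 := by
  have h := hlaw _ (mul_mem (star_mem hp) hp)
  rw [TracialState.norm2, TracialState.norm2, ← Prod.fst_star, ← Prod.fst_mul, h]
  rfl

theorem ClosureRel.apply_eq (hlaw : ∀ p ∈ D, S.toFun p.1 = T.toFun p.2) {a : A} {b : B}
    (h : ClosureRel S T D a b) : T.toFun b = S.toFun a := by
  rw [← sub_eq_zero, ← norm_le_zero_iff]
  refine le_of_forall_pos_le_add fun ε hε => ?_
  obtain ⟨p, hp, h1, h2⟩ := h (ε / 2) (by positivity)
  have e1 := S.norm_apply_le (p.1 - a)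
  have e2 := T.norm_apply_le (p.2 - b)
  have e3 : T.toFun b - S.toFun a = S.toFun (p.1 - a) - T.toFun (p.2 - b) := by
    rw [map_sub, map_sub, hlaw p hp]
    ring
  rw [e3]
  linarith [norm_sub_le (S.toFun (p.1 - a)) (T.toFun (p.2 - b))]

theorem ClosureRel.eq_of_eq (hlaw : ∀ p ∈ D, S.toFun p.1 = T.toFun p.2)
    (hfaith : ∀ b, T.norm2 b = 0 → b = 0) {a : A} {b b' : B} (h : ClosureRel S T D a b)
    (h' : ClosureRel S T D a b') : b = b' := by
  rw [← sub_eq_zero]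
  apply hfaith
  refine le_antisymm (le_of_forall_pos_le_add fun ε hε => ?_) (T.norm2_nonneg _)
  obtain ⟨p, hp, h1, h2⟩ := h (ε / 4) (by positivity)
  obtain ⟨q, hq, h3, h4⟩ := h' (ε / 4) (by positivity)
  have e1 := norm2_snd_eq hlaw (sub_mem hp hq)
  rw [Prod.snd_sub, Prod.fst_sub] at e1
  have e2 := S.norm2_sub_le' p.1 a q.1
  have e3 := T.norm2_sub_le' b p.2 b'
  have e4 := T.norm2_sub_le' p.2 q.2 b'
  rw [S.norm2_sub_comm a] at e2
  rw [T.norm2_sub_comm b p.2] at e3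
  linarith

/-- If the 2-norm closure of a trace preserving correspondence `D` is everywhere defined, it is the
graph of a trace preserving `*`-homomorphism. -/
theorem exists_starAlgHom_closureRel (hS : S.BoundedMul) (hT : T.BoundedMul)
    (hlaw : ∀ p ∈ D, S.toFun p.1 = T.toFun p.2) (hfaith : ∀ b, T.norm2 b = 0 → b = 0)
    (htot : ∀ a, ∃ b, ClosureRel S T D a b) :
    ∃ σ : A →⋆ₐ[ℂ] B, ∀ a, ClosureRel S T D a (σ a) := by
  choose f hf using htot
  have huniq : ∀ {a b}, ClosureRel S T D a b → f a = b := fun h => (hf _).eq_of_eq hlaw hfaith h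
  refine ⟨{ toFun := f
            map_one' := huniq (ClosureRel.of_mem (one_mem D))
            map_mul' := fun a a' => huniq ((hf a).mul hS hT (hf a'))
            map_zero' := huniq (ClosureRel.of_mem (zero_mem D))
            map_add' := fun a a' => huniq ((hf a).add (hf a'))
            commutes' := fun c => huniq (ClosureRel.of_mem (D.algebraMap_mem c))
            map_star' := fun a => huniq (hf a).adjoint }, hf⟩

theorem sub_eq_of_resolvent {r r' h h' i : A} (h1 : r * (h + i) = 1) (h2 : (h' + i) * r' = 1) :
    r - r' = r * (h' - h) * r' := by
  have e : h' - h = (h' + i) - (h + i) := by abel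
  rw [e, mul_sub, sub_mul, h1, one_mul, mul_assoc, h2, mul_one]

theorem exists_isSelfAdjoint_mem {c : A} (hc : IsSelfAdjoint c)
    (hdense : ∀ ε > 0, ∃ p ∈ D, S.norm2 (p.1 - c) < ε) {ε : ℝ} (hε : 0 < ε) :
    ∃ p ∈ D, IsSelfAdjoint p ∧ S.norm2 (p.1 - c) < ε := by
  obtain ⟨q, hq, hlt⟩ := hdense ε hε
  refine ⟨(2⁻¹ : ℂ) • (q + star q), D.smul_mem (add_mem hq (star_mem hq)) _, ?_, ?_⟩
  · simp [IsSelfAdjoint, add_comm]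
  · have e1 : c = (2⁻¹ : ℂ) • (c + c) := by rw [← two_smul ℂ, smul_smul]; simp
    have e : ((2⁻¹ : ℂ) • (q + star q)).1 - c = (2⁻¹ : ℂ) • ((q.1 - c) + star (q.1 - c)) := by
      rw [star_sub, hc.star_eq]
      nth_rewrite 1 [e1]
      simp only [Prod.smul_fst, Prod.fst_add, Prod.fst_star, ← smul_sub]
      congr 1
      abel
    rw [e, S.norm2_smul]
    have h1 := S.norm2_add_le (q.1 - c) (star (q.1 - c))
    rw [S.norm2_star] at h1
    rw [show ‖(2⁻¹ : ℂ)‖ = 2⁻¹ by simp]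
    linarith

/-- Two selfadjoint tuples with the same moments generate a trace preserving correspondence. -/
theorem apply_fst_eq_apply_snd_of_mem_adjoin {ι : Type*} {X : ι → A} {Y : ι → B}
    (hX : ∀ i, IsSelfAdjoint (X i)) (hY : ∀ i, IsSelfAdjoint (Y i))
    (hXY : ∀ l : List ι, T.toFun (l.map Y).prod = S.toFun (l.map X).prod) {p : A × B}
    (hp : p ∈ StarAlgebra.adjoin ℂ (Set.range fun i => (X i, Y i))) :
    S.toFun p.1 = T.toFun p.2 := by
  set Z : ι → A × B := fun i => (X i, Y i) with hZ
  have hstar : Set.range Z ∪ star (Set.range Z) = Set.range Z := by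
    rw [Set.union_eq_left]
    rintro q ⟨i, hi⟩
    refine ⟨i, ?_⟩
    rw [← star_star q, ← hi]
    exact Prod.ext (hX i).symm (hY i).symm
  have hp' : p ∈ Subalgebra.toSubmodule (Algebra.adjoin ℂ (Set.range Z)) := by
    have : p ∈ (StarAlgebra.adjoin ℂ (Set.range Z)).toSubalgebra := hp
    rwa [StarAlgebra.adjoin_toSubalgebra, hstar] at this
  rw [Algebra.adjoin_eq_span] at hp'
  clear hp
  induction hp' using Submodule.span_induction with
  | mem q hq =>
    obtain ⟨l, hl, rfl⟩ := Submonoid.exists_list_of_mem_closure hq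
    obtain ⟨l', rfl⟩ : l ∈ Set.range (List.map Z) := by
      rw [Set.range_list_map]
      exact hl
    have e1 : (l'.map Z).prod.1 = (l'.map X).prod := by
      have h := map_list_prod (RingHom.fst A B) (l'.map Z)
      rw [List.map_map] at h
      exact h
    have e2 : (l'.map Z).prod.2 = (l'.map Y).prod := by
      have h := map_list_prod (RingHom.snd A B) (l'.map Z)
      rw [List.map_map] at h
      exact h
    rw [e1, e2]
    exact (hXY l').symm
  | zero => simp
  | add q q' hq hq' h h' =>
    rw [Prod.fst_add, Prod.snd_add, map_add, map_add, h, h']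
  | smul c q _ h => rw [Prod.smul_fst, Prod.smul_snd, map_smul, map_smul, h]

end Relation

variable {H : Type*} [NormedAddCommGroup H] [InnerProductSpace ℂ H] [CompleteSpace H]
  {M : VonNeumannAlgebra H} {φ : FaithfulNormalTrace M}
  {K : Type*} [NormedAddCommGroup K] [InnerProductSpace ℂ K] [CompleteSpace K]
  {R : VonNeumannAlgebra K} {τ : FaithfulNormalTrace R} {ω : Ultrafilter ℕ}
  {D : StarSubalgebra ℂ (M.toStarSubalgebra × Ultrapower τ ω)}

theorem TracialState.boundedMul {A : Type*} [CStarAlgebra A] (S : TracialState A) :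
    S.BoundedMul := fun a => ⟨‖a‖, norm_nonneg _, fun w =>
  ⟨S.norm2_mul_le a w, (S.norm2_mul_le' w a).trans_eq (mul_comm _ _)⟩⟩

/-- The closure relation is compatible with resolvents of selfadjoint elements of `D`: if `q` is
close to the resolvent in the first component, then `q (p + i) - 1` is small there, hence small in
the second component. -/
theorem ClosureRel.resolvent
    (hlaw : ∀ p ∈ D, φ.toTracialState.toFun p.1 = (Ultrapower.tracialState τ ω).toFun p.2)
    (hdense : ∀ a, ∀ ε > 0, ∃ p ∈ D, φ.toTracialState.norm2 (p.1 - a) < ε)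
    {p : M.toStarSubalgebra × Ultrapower τ ω} (hp : p ∈ D) {r₁ : M.toStarSubalgebra}
    {r₂ : Ultrapower τ ω} (h₁ : r₁ * (p.1 + Complex.I • 1) = 1)
    (h₂ : (p.2 + Complex.I • 1) * r₂ = 1) (hr₂ : Ultrapower.IsContraction τ ω r₂) :
    ClosureRel φ.toTracialState (Ultrapower.tracialState τ ω) D r₁ r₂ := by
  intro ε hε
  set S := φ.toTracialState
  set T := Ultrapower.tracialState τ ω
  obtain ⟨C, hC0, hC⟩ := S.boundedMul (p.1 + Complex.I • 1)
  obtain ⟨q, hq, hlt⟩ := hdense r₁ (ε / (C + 1)) (by positivity)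
  have hpos := S.norm2_nonneg (q.1 - r₁)
  have hle : ε / (C + 1) ≤ ε := div_le_self hε.le (by linarith)
  refine ⟨q, hq, hlt.trans_le hle, ?_⟩
  rw [lt_div_iff₀ (by positivity)] at hlt
  have e1 : q.2 - r₂ = (q.2 * (p.2 + Complex.I • 1) - 1) * r₂ := by
    rw [sub_mul, mul_assoc, h₂, mul_one, one_mul]
  have hD : q * (p + Complex.I • 1) - 1 ∈ D :=
    sub_mem (mul_mem hq (add_mem hp (D.smul_mem (one_mem D) _))) (one_mem D)
  have e2 : T.norm2 (q.2 * (p.2 + Complex.I • 1) - 1) = S.norm2 (q.1 * (p.1 + Complex.I • 1) - 1) :=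
    norm2_snd_eq hlaw hD
  have e3 : q.1 * (p.1 + Complex.I • 1) - 1 = (q.1 - r₁) * (p.1 + Complex.I • 1) := by
    rw [sub_mul, h₁]
  rw [e1]
  refine (hr₂.norm2_mul_le' _).trans_lt ?_
  rw [e2, e3]
  linarith [(hC (q.1 - r₁)).2]

/-- The closure relation is defined at the resolvent of every selfadjoint element. -/
theorem ClosureRel.exists_of_resolvent (hω : (ω : Filter ℕ) ≤ Filter.cofinite)
    (hlaw : ∀ p ∈ D, φ.toTracialState.toFun p.1 = (Ultrapower.tracialState τ ω).toFun p.2)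
    (hdense : ∀ a, ∀ ε > 0, ∃ p ∈ D, φ.toTracialState.norm2 (p.1 - a) < ε)
    {c : M.toStarSubalgebra} (hc : IsSelfAdjoint c) {r : M.toStarSubalgebra} (hrn : ‖r‖ ≤ 1)
    (hr : (c + Complex.I • 1) * r = 1) :
    ∃ z, ClosureRel φ.toTracialState (Ultrapower.tracialState τ ω) D r z := by
  set S := φ.toTracialState
  set T := Ultrapower.tracialState τ ω
  have hsa : ∀ N : ℕ, ∃ p ∈ D, IsSelfAdjoint p ∧ S.norm2 (p.1 - c) < (1 / 2) ^ N / 4 :=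
    fun N => exists_isSelfAdjoint_mem hc (hdense c) (by positivity)
  choose p hpD hpsa hplt using hsa
  choose r₁ hr₁n hr₁ hr₁' using fun N => exists_resolvent (congrArg Prod.fst (hpsa N) :
    IsSelfAdjoint (p N).1)
  choose r₂ hr₂n hr₂ hr₂' using fun N => Ultrapower.exists_resolvent (congrArg Prod.snd (hpsa N) :
    IsSelfAdjoint (p N).2)
  obtain ⟨w, hw⟩ := Ultrapower.exists_limit_of_contractions hω r₂ hr₂n (fun N => by
    rw [sub_eq_of_resolvent (hr₂ N) (hr₂' (N + 1))]
    refine ((hr₂n (N + 1)).norm2_mul_le' _).trans_lt (((hr₂n N).norm2_mul_le _).trans_lt ?_)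
    rw [← Prod.snd_sub, norm2_snd_eq hlaw (sub_mem (hpD _) (hpD _)), Prod.fst_sub]
    have h1 := S.norm2_sub_le' (p (N + 1)).1 c (p N).1
    rw [S.norm2_sub_comm c] at h1
    have h2 := hplt N
    have h3 := hplt (N + 1)
    rw [pow_succ] at h3
    have h4 : (0 : ℝ) < (1 / 2) ^ N := by positivity
    change S.norm2 _ < _
    linarith)
  refine ⟨w, ClosureRel.of_limit fun ε hε => ?_⟩
  obtain ⟨N, hN⟩ := exists_pow_lt_of_lt_one (show 0 < ε / 2 by positivity)
    (show (1 / 2 : ℝ) < 1 by norm_num)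
  refine ⟨r₁ N, r₂ N, ClosureRel.resolvent hlaw hdense (hpD N) (hr₁ N) (hr₂' N) (hr₂n N), ?_, ?_⟩
  · rw [sub_eq_of_resolvent (hr₁ N) hr]
    have h1 := S.norm2_mul_le' (r₁ N * (c - (p N).1)) r
    have h2 := S.norm2_mul_le (r₁ N) (c - (p N).1)
    have h3 := hplt N
    rw [S.norm2_sub_comm] at h3
    have h4 : S.norm2 (r₁ N * (c - (p N).1)) * ‖r‖ ≤ S.norm2 (r₁ N * (c - (p N).1)) :=
      mul_le_of_le_one_right (S.norm2_nonneg _) hrn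
    have h5 : ‖r₁ N‖ * S.norm2 (c - (p N).1) ≤ S.norm2 (c - (p N).1) :=
      mul_le_of_le_one_left (S.norm2_nonneg _) (hr₁n N)
    linarith
  · have := hw N
    linarith

/-- The closure relation is everywhere defined, since selfadjoint contractions are twice the real
parts of resolvents. -/
theorem ClosureRel.exists_right (hω : (ω : Filter ℕ) ≤ Filter.cofinite)
    (hlaw : ∀ p ∈ D, φ.toTracialState.toFun p.1 = (Ultrapower.tracialState τ ω).toFun p.2)
    (hdense : ∀ a, ∀ ε > 0, ∃ p ∈ D, φ.toTracialState.norm2 (p.1 - a) < ε)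
    (a : M.toStarSubalgebra) :
    ∃ z, ClosureRel φ.toTracialState (Ultrapower.tracialState τ ω) D a z := by
  have h1 : ∀ a : M.toStarSubalgebra, IsSelfAdjoint a → ‖a‖ ≤ 1 →
      ∃ z, ClosureRel φ.toTracialState (Ultrapower.tracialState τ ω) D a z := by
    intro a ha hn
    obtain ⟨c, hc, hcr⟩ := exists_add_star_resolvent_eq ha hn
    obtain ⟨r, hrn, hr, hr'⟩ := exists_resolvent hc
    obtain ⟨z, hz⟩ := ClosureRel.exists_of_resolvent hω hlaw hdense hc hrn hr'
    rw [← hcr r hr hr']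
    exact ⟨_, hz.add hz.adjoint⟩
  have h2 : ∀ a : M.toStarSubalgebra, IsSelfAdjoint a →
      ∃ z, ClosureRel φ.toTracialState (Ultrapower.tracialState τ ω) D a z := by
    intro a ha
    have hpos : 0 < ‖a‖ + 1 := by positivity
    obtain ⟨z, hz⟩ := h1 ((((‖a‖ + 1)⁻¹ : ℝ) : ℂ) • a)
      (by rw [IsSelfAdjoint, star_smul, ha.star_eq]; simp) (by
        rw [norm_smul, Complex.norm_real, norm_inv, Real.norm_of_nonneg hpos.le,
          inv_mul_le_iff₀ hpos]
        linarith)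
    have h := hz.smul ((‖a‖ + 1 : ℝ) : ℂ)
    rw [smul_smul, ← Complex.ofReal_mul, mul_inv_cancel₀ hpos.ne', Complex.ofReal_one,
      one_smul] at h
    exact ⟨_, h⟩
  obtain ⟨z, hz⟩ := h2 (realPart a : M.toStarSubalgebra) (realPart a).2
  obtain ⟨w, hw⟩ := h2 (imaginaryPart a : M.toStarSubalgebra) (imaginaryPart a).2
  rw [← realPart_add_I_smul_imaginaryPart a]
  exact ⟨_, hz.add (hw.smul Complex.I)⟩

theorem exists_mem_norm2_fst_sub_lt {B : Type*} [Ring B] [StarRing B] [Algebra ℂ B] [StarModule ℂ B]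
    {n : ℕ} {X : Fin n → M.toStarSubalgebra}
    (hgen : Set.centralizer (Set.centralizer (Set.range fun i => (X i : H →L[ℂ] H))) =
      (M : Set (H →L[ℂ] H)))
    {D : StarSubalgebra ℂ (M.toStarSubalgebra × B)} (hD : ∀ i, ∃ p ∈ D, p.1 = X i)
    (a : M.toStarSubalgebra) {ε : ℝ} (hε : 0 < ε) :
    ∃ p ∈ D, φ.toTracialState.norm2 (p.1 - a) < ε := by
  let f : M.toStarSubalgebra × B →⋆ₐ[ℂ] H →L[ℂ] H :=
    M.toStarSubalgebra.subtype.comp (StarAlgHom.fst ℂ M.toStarSubalgebra B)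
  have hXA : Set.range (fun i => (X i : H →L[ℂ] H)) ⊆ (D.map f : StarSubalgebra ℂ (H →L[ℂ] H)) := by
    rintro _ ⟨i, rfl⟩
    obtain ⟨p, hp, hpi⟩ := hD i
    exact ⟨p, hp, congrArg Subtype.val hpi⟩
  have hAM : D.map f ≤ M.toStarSubalgebra := by
    rintro _ ⟨p, -, rfl⟩
    exact p.1.2
  obtain ⟨b, hb, hlt⟩ := φ.exists_norm2_sub_lt (D.map f)
    (hgen ▸ Set.centralizer_subset (Set.centralizer_subset hXA)) hAM a hε
  obtain ⟨p, hp, hpb⟩ := StarSubalgebra.mem_map.1 hb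
  refine ⟨p, hp, ?_⟩
  have e : p.1 = b := Subtype.ext hpb
  rwa [e, TracialState.norm2_sub_comm]

/-- A tuple in `R^ω` with the same moments as a generating tuple `X` of `M` is the image of `X`
under an embedding of `M`. -/
theorem exists_isEmbedding (hω : (ω : Filter ℕ) ≤ Filter.cofinite) {n : ℕ}
    {X : Fin n → M.toStarSubalgebra} (hX : ∀ i, IsSelfAdjoint (X i))
    (hgen : Set.centralizer (Set.centralizer (Set.range fun i => (X i : H →L[ℂ] H))) =
      (M : Set (H →L[ℂ] H)))
    {Y : Fin n → Ultrapower τ ω} (hY : ∀ i, IsSelfAdjoint (Y i))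
    (hXY : ∀ l : List (Fin n), Ultrapower.trace τ ω (l.map Y).prod = φ.toFun (l.map X).prod) :
    ∃ σ : M.toStarSubalgebra →⋆ₐ[ℂ] Ultrapower τ ω, IsEmbedding φ τ ω σ ∧ ∀ i, σ (X i) = Y i := by
  set S := φ.toTracialState with hS
  set T := Ultrapower.tracialState τ ω with hT
  have hSb : S.BoundedMul := S.boundedMul
  have hTb : T.BoundedMul := Ultrapower.exists_norm2_mul_le τ ω
  have hTf : ∀ b, T.norm2 b = 0 → b = 0 := fun b => Ultrapower.eq_zero_of_norm2_eq_zero τ ω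
  have hXY' : ∀ l : List (Fin n), T.toFun (l.map Y).prod = S.toFun (l.map X).prod := hXY
  obtain ⟨D, hZD, hlaw⟩ : ∃ D : StarSubalgebra ℂ (M.toStarSubalgebra × Ultrapower τ ω),
      (∀ i, (X i, Y i) ∈ D) ∧ ∀ p ∈ D, S.toFun p.1 = T.toFun p.2 :=
    ⟨StarAlgebra.adjoin ℂ (Set.range fun i => (X i, Y i)),
      fun i => StarAlgebra.subset_adjoin ℂ _ ⟨i, rfl⟩,
      fun p hp => apply_fst_eq_apply_snd_of_mem_adjoin hX hY hXY' hp⟩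
  have hdense : ∀ a, ∀ ε > 0, ∃ p ∈ D, S.norm2 (p.1 - a) < ε := fun a ε hε =>
    exists_mem_norm2_fst_sub_lt hgen (fun i => ⟨_, hZD i, rfl⟩) a hε
  have htot := ClosureRel.exists_right hω hlaw hdense
  obtain ⟨σ, hσ⟩ := exists_starAlgHom_closureRel hSb hTb hlaw hTf htot
  have hσtr : ∀ a, T.toFun (σ a) = S.toFun a := fun a => (hσ a).apply_eq hlaw
  refine ⟨σ, isEmbedding_of_trace_preserving φ σ hσtr, fun i => ?_⟩
  have hrel : ClosureRel S T D (X i) (Y i) := ClosureRel.of_mem (p := (X i, Y i)) (hZD i)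
  exact (hσ (X i)).eq_of_eq hlaw hTf hrel

end Extension

/-! ### Matrix algebras -/

section Matrices

variable {ι κ : Type*} [Fintype ι] [DecidableEq ι] [Fintype κ] [DecidableEq κ]

theorem normTrace_star_mul_self_nonneg (a : Matrix ι ι ℂ) : 0 ≤ normTrace (star a * a) := by
  have h : 0 ≤ (star a * a).trace := by
    simp only [Matrix.trace, Matrix.diag, Matrix.mul_apply, Matrix.star_apply]
    exact Finset.sum_nonneg fun i _ => Finset.sum_nonneg fun j _ => star_mul_self_nonneg _
  exact mul_nonneg (by rw [← Complex.ofReal_natCast, ← Complex.ofReal_inv]; positivity) h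

variable (ι) in
/-- The normalized trace as a tracial state. -/
def matrixState [Nonempty ι] : TracialState (Matrix ι ι ℂ) where
  toFun := (Fintype.card ι : ℂ)⁻¹ • Matrix.traceLinearMap ι ℂ ℂ
  map_one := by simp
  nonneg := normTrace_star_mul_self_nonneg
  tracial a b := by simp [Matrix.trace_mul_comm a b]

theorem matrixState_apply [Nonempty ι] (a : Matrix ι ι ℂ) :
    (matrixState ι).toFun a = normTrace a := rfl

/-- The normalized trace is the only tracial functional, up to a factor. -/
theorem eq_mul_normTrace [Nonempty ι] (f : Matrix ι ι ℂ →ₗ[ℂ] ℂ)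
    (hf : ∀ a b, f (a * b) = f (b * a)) (x : Matrix ι ι ℂ) : f x = f 1 * normTrace x := by
  obtain ⟨o⟩ := ‹Nonempty ι›
  have h1 : ∀ i j, f (Matrix.single i j 1) = if i = j then f (Matrix.single o o 1) else 0 := by
    intro i j
    have e1 : Matrix.single i j (1 : ℂ) = Matrix.single i o 1 * Matrix.single o j 1 := by simp
    rw [e1, hf]
    split_ifs with h
    · subst h
      simp
    · rw [Matrix.single_mul_single_of_ne _ _ _ _ (Ne.symm h), map_zero]
  generalize f (Matrix.single o o 1) = c at h1
  have h2 : ∀ y : Matrix ι ι ℂ, f y = y.trace * c := by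
    intro y
    conv_lhs => rw [Matrix.matrix_eq_sum_single y]
    have e : ∀ i j, Matrix.single i j (y i j) = y i j • Matrix.single i j (1 : ℂ) :=
      fun i j => by rw [Matrix.smul_single, smul_eq_mul, mul_one]
    simp only [map_sum, e, map_smul, h1, smul_eq_mul, mul_ite, mul_zero, Finset.sum_ite_eq,
      Finset.mem_univ, if_true]
    rw [Matrix.trace, Finset.sum_mul]
    rfl
  rw [h2 x, h2 1, normTrace, Matrix.trace_one]
  have : (Fintype.card ι : ℂ) ≠ 0 := by
    have : Nonempty ι := ⟨o⟩
    exact_mod_cast Fintype.card_ne_zero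
  field_simp

theorem norm2_kronecker [Nonempty ι] [Nonempty κ] (a : Matrix ι ι ℂ) (b : Matrix κ κ ℂ) :
    (matrixState (ι × κ)).norm2 (a ⊗ₖ b) = (matrixState ι).norm2 a * (matrixState κ).norm2 b := by
  have e : (matrixState (ι × κ)).toFun (star (a ⊗ₖ b) * (a ⊗ₖ b)) =
      (matrixState ι).toFun (star a * a) * (matrixState κ).toFun (star b * b) := by
    simp only [matrixState_apply, normTrace, Matrix.star_eq_conjTranspose,
      Matrix.conjTranspose_kronecker, ← Matrix.mul_kronecker_mul, Matrix.trace_kronecker,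
      Fintype.card_prod, Nat.cast_mul, mul_inv]
    ring
  rw [TracialState.apply_star_mul_self, TracialState.apply_star_mul_self,
    TracialState.apply_star_mul_self, ← Complex.ofReal_mul, Complex.ofReal_inj, ← mul_pow] at e
  exact (pow_left_inj₀ (TracialState.norm2_nonneg _ _) (mul_nonneg (TracialState.norm2_nonneg _ _)
    (TracialState.norm2_nonneg _ _)) two_ne_zero).1 e

section Flip

variable (α : Matrix ι ι ℂ →⋆ₙₐ[ℂ] Matrix κ κ ℂ)

/-- The partial flip `∑ e_ij ⊗ α(e_ji)` between `M_ι` and its image under `α`. -/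
def partialFlip : Matrix (ι × κ) (ι × κ) ℂ :=
  Matrix.of fun p q => α (Matrix.single q.1 p.1 1) p.2 q.2

theorem star_partialFlip : star (partialFlip α) = partialFlip α := by
  ext ⟨i, a⟩ ⟨j, b⟩
  have h : star (α (Matrix.single i j 1)) = α (Matrix.single j i 1) := by
    rw [← map_star, Matrix.star_eq_conjTranspose, Matrix.conjTranspose_single, star_one]
  simpa [partialFlip, Matrix.star_apply] using congrFun (congrFun h a) b

theorem partialFlip_mul_self : partialFlip α * partialFlip α = 1 ⊗ₖ α 1 := by
  ext ⟨i, a⟩ ⟨j, b⟩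
  have h : ∑ l, α (Matrix.single l i 1) * α (Matrix.single j l 1) =
      (1 : Matrix ι ι ℂ) i j • α 1 := by
    simp only [← map_mul, ← map_sum, ← map_smul]
    congr 1
    ext l m
    rcases eq_or_ne i j with rfl | hij
    · rcases eq_or_ne l m with rfl | hlm
      · simp [Matrix.sum_apply, Matrix.single_apply]
      · have h0 : ∀ x, ¬(x = l ∧ x = m) := fun x hx => hlm (hx.1.symm.trans hx.2)
        simp [Matrix.sum_apply, hlm, h0]
    · simp [Matrix.single_mul_single_of_ne _ _ _ _ hij, hij]
  have h' := congrFun (congrFun h a) b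
  rw [Matrix.sum_apply] at h'
  simp only [Matrix.mul_apply, Matrix.smul_apply, smul_eq_mul] at h'
  rw [Matrix.mul_apply, Fintype.sum_prod_type, Matrix.kronecker_apply, ← h']
  rfl

theorem partialFlip_mul_one_kronecker (y : Matrix κ κ ℂ)
    (hy : ∀ x, α x * y = 0) : partialFlip α * (1 ⊗ₖ y) = 0 := by
  ext ⟨i, a⟩ ⟨j, b⟩
  have h := congrFun (congrFun (hy (Matrix.single j i 1)) a) b
  rw [Matrix.mul_apply] at h
  rw [Matrix.mul_apply, Fintype.sum_prod_type, Finset.sum_eq_single j]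
  · simpa [partialFlip] using h
  · intro l _ hl
    simp [hl]
  · simp

theorem partialFlip_mul_kronecker_one (x : Matrix ι ι ℂ) :
    partialFlip α * (x ⊗ₖ 1) = (1 ⊗ₖ α x) * partialFlip α := by
  ext ⟨i, a⟩ ⟨j, b⟩
  have h : ∑ l, x l j • α (Matrix.single l i 1) = α x * α (Matrix.single j i 1) := by
    simp only [← map_mul, ← map_sum, ← map_smul]
    congr 1
    ext l m
    rcases eq_or_ne i m with rfl | him
    · simp [Matrix.sum_apply, Matrix.single_apply, Matrix.mul_apply]
    · simp [Matrix.sum_apply, Matrix.mul_apply, him]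
  have h' := congrFun (congrFun h a) b
  rw [Matrix.sum_apply, Matrix.mul_apply] at h'
  simp only [Matrix.smul_apply, smul_eq_mul] at h'
  rw [Matrix.mul_apply, Matrix.mul_apply, Fintype.sum_prod_type, Fintype.sum_prod_type,
    Finset.sum_eq_single (a := i) (f := fun l => ∑ c, (1 ⊗ₖ α x) (i, a) (l, c) * _)]
  · simp only [Matrix.kronecker_apply, Matrix.one_apply_eq, one_mul]
    rw [← show _ = ∑ c, α x a c * partialFlip α (i, c) (j, b) from h']
    refine Finset.sum_congr rfl fun l _ => ?_
    rw [Finset.sum_eq_single b]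
    · simp [partialFlip, mul_comm]
    · intro c _ hc
      simp [Matrix.one_apply_ne hc]
    · simp
  · intro l _ hl
    simp [Matrix.one_apply_ne hl.symm]
  · simp

/-- The unitary flip `∑ e_ij ⊗ α(e_ji) + 1 ⊗ (1 - α(1))`. -/
def unitaryFlip : Matrix (ι × κ) (ι × κ) ℂ := partialFlip α + 1 ⊗ₖ (1 - α 1)

theorem map_mul_one_sub (x : Matrix ι ι ℂ) : α x * (1 - α 1) = 0 := by
  rw [mul_sub, mul_one, ← map_mul, mul_one, sub_self]

theorem one_sub_mul_map (x : Matrix ι ι ℂ) : (1 - α 1) * α x = 0 := by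
  rw [sub_mul, one_mul, ← map_mul, one_mul, sub_self]

theorem star_one_sub : star (1 - α 1) = 1 - α 1 := by
  rw [star_sub, star_one, ← map_star, star_one]

theorem star_unitaryFlip : star (unitaryFlip α) = unitaryFlip α := by
  rw [unitaryFlip, star_add, star_partialFlip, Matrix.star_eq_conjTranspose (1 ⊗ₖ _),
    Matrix.conjTranspose_kronecker, Matrix.conjTranspose_one, ← Matrix.star_eq_conjTranspose,
    star_one_sub]

theorem partialFlip_mul_one_kronecker_one_sub :
    partialFlip α * (1 ⊗ₖ (1 - α 1)) = 0 :=
  partialFlip_mul_one_kronecker α _ (map_mul_one_sub α)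

theorem kronecker_one_sub_mul_partialFlip (x : Matrix ι ι ℂ) :
    (x ⊗ₖ (1 - α 1)) * partialFlip α = 0 := by
  have h := congrArg star (partialFlip_mul_one_kronecker_one_sub α)
  rw [star_mul, star_partialFlip, star_zero, Matrix.star_eq_conjTranspose (1 ⊗ₖ _),
    Matrix.conjTranspose_kronecker, Matrix.conjTranspose_one, ← Matrix.star_eq_conjTranspose,
    star_one_sub] at h
  have e : x ⊗ₖ (1 - α 1) = (x ⊗ₖ 1) * (1 ⊗ₖ (1 - α 1)) := by
    rw [← Matrix.mul_kronecker_mul, mul_one, one_mul]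
  rw [e, mul_assoc, h, mul_zero]

theorem one_sub_mul_one_sub : (1 - α 1) * (1 - α 1) = 1 - α 1 := by
  rw [mul_sub, mul_one, one_sub_mul_map, sub_zero]

theorem unitaryFlip_mul_self : unitaryFlip α * unitaryFlip α = 1 := by
  rw [unitaryFlip, add_mul, mul_add, mul_add, partialFlip_mul_self,
    partialFlip_mul_one_kronecker_one_sub, kronecker_one_sub_mul_partialFlip,
    ← Matrix.mul_kronecker_mul, one_sub_mul_one_sub, mul_one, add_zero, zero_add,
    ← Matrix.kronecker_add, add_sub_cancel, Matrix.one_kronecker_one]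

theorem unitaryFlip_mul_kronecker_one (x : Matrix ι ι ℂ) :
    unitaryFlip α * (x ⊗ₖ 1) = (1 ⊗ₖ α x + x ⊗ₖ (1 - α 1)) * unitaryFlip α := by
  rw [unitaryFlip, add_mul, add_mul, mul_add, mul_add, kronecker_one_sub_mul_partialFlip,
    partialFlip_mul_kronecker_one, ← Matrix.mul_kronecker_mul, ← Matrix.mul_kronecker_mul,
    ← Matrix.mul_kronecker_mul, map_mul_one_sub, one_sub_mul_one_sub, Matrix.kronecker_zero]
  simp

/-- A unitary `W` which approximately conjugates `α(η)` to `α(ξ)` yields a unitary of `M_ι ⊗ M_κ`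
which approximately conjugates `η ⊗ 1` to `ξ ⊗ 1`: conjugation by the flip turns `x ⊗ 1` into
`1 ⊗ α(x) + x ⊗ (1 - α(1))`. -/
theorem exists_unitary_kronecker [Nonempty ι] [Nonempty κ] {W : Matrix κ κ ℂ}
    (hW : W ∈ Matrix.unitaryGroup κ ℂ) :
    ∃ U ∈ Matrix.unitaryGroup (ι × κ) ℂ, ∀ ξ η : Matrix ι ι ℂ,
      (matrixState (ι × κ)).norm2 (U * (η ⊗ₖ 1) * star U - ξ ⊗ₖ 1) ≤
        (matrixState κ).norm2 (W * α η * star W - α ξ) +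
          ((matrixState ι).norm2 η + (matrixState ι).norm2 ξ) *
            (matrixState κ).norm2 (1 - α 1) := by
  have hW1 : star W * W = 1 := (Unitary.mem_iff.1 hW).1
  have hW2 : W * star W = 1 := (Unitary.mem_iff.1 hW).2
  set F := unitaryFlip α
  have hF := unitaryFlip_mul_self α
  have hFs := star_unitaryFlip α
  set V : Matrix (ι × κ) (ι × κ) ℂ := 1 ⊗ₖ W with hV
  have hVs : star V = 1 ⊗ₖ star W := by
    rw [hV, Matrix.star_eq_conjTranspose, Matrix.conjTranspose_kronecker, Matrix.conjTranspose_one]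
    rfl
  have hV1 : star V * V = 1 := by
    rw [hVs, hV, ← Matrix.mul_kronecker_mul, hW1, mul_one, Matrix.one_kronecker_one]
  have hV2 : V * star V = 1 := by
    rw [hVs, hV, ← Matrix.mul_kronecker_mul, hW2, mul_one, Matrix.one_kronecker_one]
  have hG : ∀ x : Matrix ι ι ℂ, x ⊗ₖ (1 : Matrix κ κ ℂ) =
      F * (1 ⊗ₖ α x + x ⊗ₖ (1 - α 1)) * F := fun x => by
    rw [mul_assoc, ← unitaryFlip_mul_kronecker_one, ← mul_assoc, hF, one_mul]
  have hUs : star (F * V * F) = F * star V * F := by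
    rw [star_mul, star_mul, hFs, mul_assoc]
  refine ⟨F * V * F, Unitary.mem_iff.2 ⟨?_, ?_⟩, fun ξ η => ?_⟩
  · calc star (F * V * F) * (F * V * F) = F * star V * (F * F) * V * F := by
          rw [hUs]; simp only [mul_assoc]
      _ = F * (star V * V) * F := by rw [hF]; simp only [mul_assoc, one_mul]
      _ = 1 := by rw [hV1, mul_one, hF]
  · calc (F * V * F) * star (F * V * F) = F * V * (F * F) * star V * F := by
          rw [hUs]; simp only [mul_assoc]
      _ = F * (V * star V) * F := by rw [hF]; simp only [mul_assoc, one_mul]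
      _ = 1 := by rw [hV2, mul_one, hF]
  have e : (F * V * F) * (η ⊗ₖ 1) * star (F * V * F) - ξ ⊗ₖ 1 =
      F * (V * (1 ⊗ₖ α η + η ⊗ₖ (1 - α 1)) * star V - (1 ⊗ₖ α ξ + ξ ⊗ₖ (1 - α 1))) * F := by
    rw [hUs, hG η, hG ξ, mul_sub, sub_mul]
    congr 1
    calc _ = F * V * (F * F) * (1 ⊗ₖ α η + η ⊗ₖ (1 - α 1)) * (F * F) * star V * F := by
          simp only [mul_assoc]
      _ = _ := by rw [hF]; simp only [mul_assoc, mul_one]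
  have e2 : V * (1 ⊗ₖ α η + η ⊗ₖ (1 - α 1)) * star V - (1 ⊗ₖ α ξ + ξ ⊗ₖ (1 - α 1)) =
      1 ⊗ₖ (W * α η * star W - α ξ) + (V * (η ⊗ₖ (1 - α 1)) * star V - ξ ⊗ₖ (1 - α 1)) := by
    have e3 : V * (1 ⊗ₖ α η) * star V = 1 ⊗ₖ (W * α η * star W) := by
      rw [hVs, hV, ← Matrix.mul_kronecker_mul, ← Matrix.mul_kronecker_mul]
      simp
    have e4 : (1 : Matrix ι ι ℂ) ⊗ₖ (W * α η * star W - α ξ) =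
        1 ⊗ₖ (W * α η * star W) - 1 ⊗ₖ α ξ := by
      ext
      simp [mul_sub]
    rw [mul_add, add_mul, e3, e4]
    abel
  set T := matrixState (ι × κ)
  rw [e, mul_assoc, T.norm2_unitary_mul (by rw [hFs, hF]), T.norm2_mul_unitary (by rw [hFs, hF]),
    e2]
  refine (T.norm2_add_le _ _).trans (add_le_add ?_ ((T.norm2_sub_le _ _).trans ?_))
  · rw [norm2_kronecker, TracialState.norm2_one, one_mul]
  · rw [T.norm2_mul_unitary (by rw [star_star, hV1]), T.norm2_unitary_mul hV1, norm2_kronecker,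
      norm2_kronecker, add_mul]

end Flip

/-- `M_k(ℂ)` embeds into `M_r(ℂ)` with defect at most `k / r`, by `⌊r / k⌋` diagonal copies. -/
theorem exists_padding (k r : ℕ) (hk : 1 ≤ k) (hr : 1 ≤ r) :
    ∃ α : Matrix (Fin k) (Fin k) ℂ →⋆ₙₐ[ℂ] Matrix (Fin r) (Fin r) ℂ,
      (normTrace (1 - α 1)).re ≤ k / r := by
  let q := r / k
  let s := r % k
  have hcard : Fintype.card (Fin r) = Fintype.card ((Fin k × Fin q) ⊕ Fin s) := by
    simp [q, s, Nat.div_add_mod]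
  let e : Fin r ≃ (Fin k × Fin q) ⊕ Fin s := Fintype.equivOfCardEq hcard
  let α : Matrix (Fin k) (Fin k) ℂ →⋆ₙₐ[ℂ] Matrix (Fin r) (Fin r) ℂ :=
    { toFun := fun x =>
        (Matrix.fromBlocks (x ⊗ₖ (1 : Matrix (Fin q) (Fin q) ℂ)) 0 0 0).submatrix e e
      map_smul' := fun c x => by
        ext i j
        rcases hi : e i <;> rcases hj : e j <;> simp [hi, hj, mul_assoc]
      map_zero' := by simp
      map_add' := fun x y => by
        ext i j
        rcases hi : e i <;> rcases hj : e j <;> simp [hi, hj, add_mul]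
      map_mul' := fun x y => by
        rw [Matrix.submatrix_mul_equiv, Matrix.fromBlocks_multiply, ← Matrix.mul_kronecker_mul]
        simp
      map_star' := fun x => by
        simp only [Matrix.star_eq_conjTranspose, Matrix.conjTranspose_submatrix,
          Matrix.fromBlocks_conjTranspose, Matrix.conjTranspose_kronecker]
        simp }
  refine ⟨α, ?_⟩
  have h1 : 1 - α 1 = (Matrix.fromBlocks 0 0 0 (1 : Matrix (Fin s) (Fin s) ℂ)).submatrix e e := by
    rw [sub_eq_iff_eq_add]
    have h3 : (Matrix.fromBlocks 0 0 0 (1 : Matrix (Fin s) (Fin s) ℂ)).submatrix e e + α 1 =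
      (Matrix.fromBlocks 0 0 0 (1 : Matrix (Fin s) (Fin s) ℂ) + Matrix.fromBlocks
        ((1 : Matrix (Fin k) (Fin k) ℂ) ⊗ₖ (1 : Matrix (Fin q) (Fin q) ℂ)) 0 0 0).submatrix e e :=
      rfl
    rw [h3, Matrix.fromBlocks_add]
    simp
  have h2 : (1 - α 1).trace = s := by
    have h3 := Fintype.sum_equiv e
      (fun i => (Matrix.fromBlocks 0 0 0 (1 : Matrix (Fin s) (Fin s) ℂ)) (e i) (e i))
      (fun j => (Matrix.fromBlocks 0 0 0 (1 : Matrix (Fin s) (Fin s) ℂ)) j j) (fun _ => rfl)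
    rw [h1, Matrix.trace]
    refine h3.trans ?_
    simp
  have hsk : (s : ℝ) ≤ k := by exact_mod_cast (Nat.mod_lt r hk).le
  have hr' : (0 : ℝ) < r := by exact_mod_cast hr
  rw [normTrace, h2, Fintype.card_fin, ← Complex.ofReal_natCast, ← Complex.ofReal_natCast,
    ← Complex.ofReal_inv, ← Complex.ofReal_mul, Complex.ofReal_re, inv_mul_eq_div]
  gcongr

end Matrices

/-! ### Matrix algebras in the hyperfinite factor -/

section Hyperfinite

variable {K : Type*} [NormedAddCommGroup K] [InnerProductSpace ℂ K] [CompleteSpace K]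

/-- Finite-dimensional subspaces are closed for a faithful 2-norm. -/
theorem TracialState.mem_of_finiteDimensional {A : Type*} [Ring A] [StarRing A] [Algebra ℂ A]
    [StarModule ℂ A] (T : TracialState A) (hT : ∀ a, T.norm2 a = 0 → a = 0) (V : Submodule ℂ A)
    [FiniteDimensional ℂ V] {a : A} (ha : ∀ ε > 0, ∃ b ∈ V, T.norm2 (a - b) < ε) : a ∈ V := by
  let c : InnerProductSpace.Core ℂ A :=
    { T.core with
      definite := fun x hx => hT x ((T.norm2_eq_zero_iff x).2 hx) }
  let _ : NormedAddCommGroup A := c.toNormedAddCommGroup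
  let _ : InnerProductSpace ℂ A := InnerProductSpace.ofCore c.toCore
  have hcl : IsClosed (V : Set A) := V.closed_of_finiteDimensional
  rw [← SetLike.mem_coe, ← hcl.closure_eq, Metric.mem_closure_iff]
  intro ε hε
  obtain ⟨b, hb, hlt⟩ := ha ε hε
  exact ⟨b, hb, by rw [dist_eq_norm]; exact hlt⟩

/-- A directed family of matrix algebras `β j : M_{r j}(ℂ) → R` with 2-norm dense union and with
unbounded sizes. -/
structure MatrixExhaustion {R : VonNeumannAlgebra K} (τ : FaithfulNormalTrace R) where
  /-- the sizes of the matrix algebras -/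
  r : ℕ → ℕ
  pos : ∀ j, 1 ≤ r j
  /-- the inclusions into `R` -/
  β : ∀ j, Matrix (Fin (r j)) (Fin (r j)) ℂ →⋆ₐ[ℂ] R.toStarSubalgebra
  compat : ∀ i j, i ≤ j → ∃ f : Matrix (Fin (r i)) (Fin (r i)) ℂ →⋆ₐ[ℂ]
    Matrix (Fin (r j)) (Fin (r j)) ℂ, ∀ x, β j (f x) = β i x
  unbounded : ∀ B, ∃ j, B < r j
  dense : ∀ (a : R.toStarSubalgebra) (ε : ℝ), 0 < ε →
    ∃ j b, τ.toTracialState.norm2 (a - β j b) < ε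

variable {R : VonNeumannAlgebra K} {τ : FaithfulNormalTrace R}

/-- The matrix algebras generating a hyperfinite `II₁`-factor form an exhaustion. Were their sizes
bounded, the sequence would be stationary, and its union finite-dimensional, hence closed in the
2-norm and equal to `R`. -/
theorem IsHyperfiniteII1Factor.nonempty_matrixExhaustion (hR : IsHyperfiniteII1Factor R)
    (τ : FaithfulNormalTrace R) : Nonempty (MatrixExhaustion τ) := by
  obtain ⟨A, hmono, hmat, hgen⟩ := hR.hyperfinite
  choose r e using hmat
  have e' : ∀ j, A j ≃⋆ₐ[ℂ] Matrix (Fin (r j)) (Fin (r j)) ℂ := fun j => (e j).some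
  have hAR : ∀ j, A j ≤ R.toStarSubalgebra := by
    intro j x hx
    have h : x ∈ Set.centralizer (Set.centralizer (⋃ k, (A k : Set (K →L[ℂ] K)))) :=
      Set.subset_centralizer_centralizer (Set.mem_iUnion.2 ⟨j, hx⟩)
    rw [hgen] at h
    exact h
  have hdense : ∀ (a : R.toStarSubalgebra) (ε : ℝ), 0 < ε →
      ∃ j, ∃ b : R.toStarSubalgebra,
        (b : K →L[ℂ] K) ∈ A j ∧ τ.toTracialState.norm2 (a - b) < ε := by
    intro a ε hε
    have hU : ((⨆ j, A j : StarSubalgebra ℂ (K →L[ℂ] K)) : Set (K →L[ℂ] K)) =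
        ⋃ j, (A j : Set (K →L[ℂ] K)) :=
      StarSubalgebra.coe_iSup_of_directed (hmono.directed_le)
    obtain ⟨b, hb, hlt⟩ := τ.exists_norm2_sub_lt (⨆ j, A j) (by rw [hU, hgen])
      (iSup_le hAR) a hε
    rw [← SetLike.mem_coe, hU] at hb
    obtain ⟨j, hj⟩ := Set.mem_iUnion.1 hb
    exact ⟨j, b, hj, hlt⟩
  have hfd : ∀ j, FiniteDimensional ℂ (A j) := fun j =>
    (e' j).toAlgEquiv.toLinearEquiv.symm.finiteDimensional
  have hrank : ∀ j, Module.finrank ℂ (A j) = r j * r j := fun j => by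
    rw [(e' j).toAlgEquiv.toLinearEquiv.finrank_eq]
    simp [Module.finrank_matrix]
  have hne : (1 : R.toStarSubalgebra) ≠ 0 := by
    intro h
    have h1 := τ.map_one
    rw [h, map_zero] at h1
    exact zero_ne_one h1
  have hpos : ∀ j, 1 ≤ r j := by
    intro j
    by_contra hj
    have h0 : r j = 0 := by omega
    have : IsEmpty (Fin (r j)) := by rw [h0]; infer_instance
    have h1 : (1 : A j) = 0 := (e' j).injective (Subsingleton.elim _ _)
    have h2 : (1 : K →L[ℂ] K) = 0 := congrArg Subtype.val h1
    exact hne (Subtype.ext h2)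
  have hunb : ∀ B, ∃ j, B < r j := by
    by_contra! hB
    obtain ⟨B, hB⟩ := hB
    obtain ⟨j, hj⟩ : ∃ j, ∀ i, r i ≤ r j := by
      have hfin : (Set.range r).Finite := (Set.finite_Iic B).subset (by
        rintro _ ⟨i, rfl⟩
        exact hB i)
      obtain ⟨_, ⟨j, rfl⟩, hj⟩ := Set.exists_max_image (Set.range r) id hfin ⟨_, 0, rfl⟩
      exact ⟨j, fun i => hj _ ⟨i, rfl⟩⟩
    have hAj : ∀ i, A i ≤ A j := by
      intro i
      rcases le_total i j with hij | hij
      · exact hmono hij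
      · have h1 : Subalgebra.toSubmodule (A j).toSubalgebra ≤
            Subalgebra.toSubmodule (A i).toSubalgebra := hmono hij
        have hfdi : FiniteDimensional ℂ (Subalgebra.toSubmodule (A i).toSubalgebra) := hfd i
        have h2 := Submodule.eq_of_le_of_finrank_le h1 (by
          have h3 : Module.finrank ℂ (A i) ≤ Module.finrank ℂ (A j) := by
            rw [hrank, hrank]
            exact Nat.mul_le_mul (hj i) (hj i)
          exact h3)
        intro x hx
        have h4 : x ∈ Subalgebra.toSubmodule (A i).toSubalgebra := hx
        rw [← h2] at h4
        exact h4
    apply hR.infinite_dimensional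
    let f : A j →ₗ[ℂ] R.toStarSubalgebra := (StarSubalgebra.inclusion (hAR j)).toAlgHom.toLinearMap
    have := hfd j
    have hsurj : Function.Surjective f := by
      intro a
      have h5 : a ∈ LinearMap.range f := by
        refine τ.toTracialState.mem_of_finiteDimensional (fun b => τ.eq_zero_of_norm2_eq_zero) _
          fun ε hε => ?_
        obtain ⟨i, b, hb, hlt⟩ := hdense a ε hε
        exact ⟨b, ⟨⟨b, hAj i hb⟩, rfl⟩, hlt⟩
      exact h5
    exact Module.Finite.of_surjective f hsurj
  refine ⟨⟨r, hpos, fun j => (StarSubalgebra.inclusion (hAR j)).comp (e' j).symm, ?_, hunb, ?_⟩⟩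
  · intro i j hij
    refine ⟨((e' j : A j →⋆ₐ[ℂ] _).comp (StarSubalgebra.inclusion (hmono hij))).comp
      ((e' i).symm : _ →⋆ₐ[ℂ] A i), fun x => ?_⟩
    apply Subtype.ext
    simp
  · intro a ε hε
    obtain ⟨j, b, hb, hlt⟩ := hdense a ε hε
    refine ⟨j, e' j ⟨b, hb⟩, ?_⟩
    convert hlt using 3
    apply Subtype.ext
    simp

namespace MatrixExhaustion

variable (E : MatrixExhaustion τ)

instance (j : ℕ) : Nonempty (Fin (E.r j)) := ⟨⟨0, E.pos j⟩⟩

theorem apply_β (j : ℕ) (x : Matrix (Fin (E.r j)) (Fin (E.r j)) ℂ) :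
    τ.toFun (E.β j x) = normTrace x := by
  have h := eq_mul_normTrace (τ.toFun.comp (E.β j).toAlgHom.toLinearMap) (fun a b => by
    change τ.toFun (E.β j (a * b)) = τ.toFun (E.β j (b * a))
    rw [map_mul (E.β j), map_mul (E.β j), τ.tracial]) x
  have h1 : (τ.toFun.comp (E.β j).toAlgHom.toLinearMap) 1 = 1 := by
    change τ.toFun (E.β j 1) = 1
    rw [map_one, τ.map_one]
  rw [h1, one_mul] at h
  exact h

theorem norm2_β (j : ℕ) (x : Matrix (Fin (E.r j)) (Fin (E.r j)) ℂ) :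
    τ.toTracialState.norm2 (E.β j x) = (matrixState (Fin (E.r j))).norm2 x := by
  rw [TracialState.norm2, TracialState.norm2, ← map_star, ← map_mul]
  exact congrArg (fun z : ℂ => Real.sqrt z.re) (E.apply_β j (star x * x))

theorem dense_above (i : ℕ) (a : R.toStarSubalgebra) {ε : ℝ} (hε : 0 < ε) :
    ∃ j b, i ≤ j ∧ τ.toTracialState.norm2 (a - E.β j b) < ε := by
  obtain ⟨j, b, h⟩ := E.dense a ε hε
  obtain ⟨f, hf⟩ := E.compat j (max i j) (le_max_right _ _)
  exact ⟨max i j, f b, le_max_left _ _, by rwa [hf]⟩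

/-- Every `M_k(ℂ)` embeds into one of the matrix algebras up to a small corner. -/
theorem exists_almost_unital (k : ℕ) (hk : 1 ≤ k) {δ : ℝ} (hδ : 0 < δ) :
    ∃ (j : ℕ) (α : Matrix (Fin k) (Fin k) ℂ →⋆ₙₐ[ℂ] Matrix (Fin (E.r j)) (Fin (E.r j)) ℂ),
      (matrixState (Fin (E.r j))).norm2 (1 - α 1) < δ := by
  obtain ⟨B, hB⟩ := exists_nat_gt (k / δ ^ 2)
  obtain ⟨j, hj⟩ := E.unbounded B
  obtain ⟨α, hα⟩ := exists_padding k (E.r j) hk (E.pos j)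
  refine ⟨j, α, lt_of_pow_lt_pow_left₀ 2 hδ.le ?_⟩
  rw [TracialState.norm2_sq, star_one_sub, one_sub_mul_one_sub]
  refine lt_of_le_of_lt hα ?_
  have h1 : (B : ℝ) < E.r j := by exact_mod_cast hj
  have h2 : (0 : ℝ) < E.r j := lt_of_le_of_lt (Nat.cast_nonneg B) h1
  rw [div_lt_iff₀ (by positivity)] at hB
  rw [div_lt_iff₀ h2]
  have h3 : (0 : ℝ) < δ ^ 2 := by positivity
  nlinarith

/-- Invertible matrices are dense: translate by a small scalar off the finite spectrum. -/
theorem dense_isUnit (i : ℕ) (a : R.toStarSubalgebra) {ε : ℝ} (hε : 0 < ε) :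
    ∃ j b, i ≤ j ∧ IsUnit b ∧ τ.toTracialState.norm2 (a - E.β j b) < ε := by
  obtain ⟨j, b, hij, hlt⟩ := E.dense_above i a (half_pos hε)
  have hinf : (Metric.ball (0 : ℂ) (ε / 2)).Infinite :=
    infinite_of_mem_nhds 0 (Metric.ball_mem_nhds 0 (half_pos hε))
  obtain ⟨z, hz, hzs⟩ := (hinf.sdiff (Matrix.finite_spectrum b)).nonempty
  have hu : IsUnit (b - algebraMap ℂ _ z) := by
    have h := spectrum.notMem_iff.1 hzs
    have h' := h.neg
    rwa [neg_sub] at h'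
  refine ⟨j, _, hij, hu, ?_⟩
  have e : a - E.β j (b - algebraMap ℂ _ z) = (a - E.β j b) + z • 1 := by
    rw [map_sub, Algebra.algebraMap_eq_smul_one, map_smul, map_one]
    abel
  rw [e]
  refine (TracialState.norm2_add_le _ _ _).trans_lt ?_
  rw [TracialState.norm2_smul, TracialState.norm2_one, mul_one]
  rw [mem_ball_zero_iff] at hz
  linarith

open scoped Matrix.Norms.L2Operator in
/-- An almost unitary element `u` of `R` is close in 2-norm to a unitary matrix: approximate `u` by
an invertible matrix `b` and take the unitary part of `b`. As only the 2-norm of `u` enters, the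
distance of `b* b` to `1` is measured against contractions in the trace. -/
theorem exists_unitary (i : ℕ) {u : R.toStarSubalgebra} {δ : ℝ} (hδ : 0 < δ)
    (hu : τ.toTracialState.norm2 (star u * u - 1) ≤ δ) :
    ∃ j, ∃ W ∈ Matrix.unitaryGroup (Fin (E.r j)) ℂ, i ≤ j ∧
      τ.toTracialState.norm2 (E.β j W - u) ≤ Real.sqrt (2 * δ) + δ := by
  set T := τ.toTracialState
  set C := T.norm2 u with hC
  have hC0 : 0 ≤ C := T.norm2_nonneg u
  obtain ⟨j, b, hij, hb, hlt⟩ := E.dense_isUnit i u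
    (show 0 < min 1 δ / (2 * C + 1) by positivity)
  rw [lt_div_iff₀ (by positivity)] at hlt
  set d := T.norm2 (u - E.β j b) with hd
  have hd0 : 0 ≤ d := T.norm2_nonneg _
  have hlt1 := hlt.trans_le (min_le_left _ _)
  have hlt2 := hlt.trans_le (min_le_right _ _)
  have hd1 : d ≤ 1 := by nlinarith
  have hdδ : d ≤ δ := by nlinarith
  have hb2 : T.norm2 (E.β j b) ≤ C + d := by
    have h := T.norm2_sub_le u (u - E.β j b)
    rwa [sub_sub_cancel] at h
  -- `d` is so small that replacing `u` by `b` costs at most another `δ` in `T(s (u* u - 1))`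
  have key : ∀ s : Matrix (Fin (E.r j)) (Fin (E.r j)) ℂ, ‖s‖ ≤ 1 →
      ‖(matrixState (Fin (E.r j))).toFun (s * (star b * b - 1))‖ ≤ 2 * δ := by
    intro s hs
    have hs' : ‖E.β j s‖ ≤ 1 := (NonUnitalStarAlgHom.norm_apply_le (E.β j) s).trans hs
    have e0 : (matrixState (Fin (E.r j))).toFun (s * (star b * b - 1)) =
        T.toFun (E.β j (s * (star b * b - 1))) := (E.apply_β j _).symm
    set c := E.β j b
    set t := E.β j s
    have e1 : E.β j (s * (star b * b - 1)) =
        t * star (c - u) * c + t * star u * (c - u) + t * (star u * u - 1) := by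
      rw [map_mul, map_sub, map_mul, map_star, map_one, star_sub]
      noncomm_ring
    have hts : ∀ x, T.norm2 (t * x) ≤ T.norm2 x := fun x =>
      (T.norm2_mul_le t x).trans (mul_le_of_le_one_left (T.norm2_nonneg x) hs')
    have hcu : T.norm2 (c - u) = d := T.norm2_sub_comm _ _
    have b1 : ‖T.toFun (t * star (c - u) * c)‖ ≤ d * (C + d) := by
      refine (T.norm_apply_mul_le _ _).trans ?_
      have h1 := hts (star (c - u))
      rw [T.norm2_star, hcu] at h1
      exact mul_le_mul h1 hb2 (T.norm2_nonneg _) hd0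
    have b2 : ‖T.toFun (t * star u * (c - u))‖ ≤ C * d := by
      refine (T.norm_apply_mul_le _ _).trans ?_
      have h1 := hts (star u)
      rw [T.norm2_star] at h1
      rw [hcu]
      exact mul_le_mul_of_nonneg_right h1 hd0
    have b3 : ‖T.toFun (t * (star u * u - 1))‖ ≤ δ :=
      (T.norm_apply_le _).trans ((hts _).trans hu)
    rw [e0, e1, map_add, map_add]
    refine (norm_add₃_le).trans ?_
    nlinarith
  obtain ⟨W, hW, hWb⟩ := (matrixState (Fin (E.r j))).exists_unitary_norm2_sub_le hb key
  refine ⟨j, W, hW, hij, ?_⟩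
  have h1 : T.norm2 (E.β j W - E.β j b) ≤ Real.sqrt (2 * δ) := by
    rw [← map_sub, E.norm2_β, TracialState.norm2_sub_comm]
    exact Real.le_sqrt_of_sq_le hWb
  have h2 := T.norm2_sub_le' (E.β j W) (E.β j b) u
  rw [T.norm2_sub_comm (E.β j b) u] at h2
  linarith

end MatrixExhaustion

end Hyperfinite

/-! ### Convergence of moments -/

section Moments

open Filter Topology

theorem star_prod_map {A ι : Type*} [Ring A] [StarRing A] {a : ι → A}
    (ha : ∀ i, IsSelfAdjoint (a i)) (l : List ι) :
    star (l.map a).prod = (l.reverse.map a).prod := by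
  induction l with
  | nil => simp
  | cons i l ih => simp [ih, (ha i).star_eq]

theorem map_prod_of_ne_nil {A B F ι : Type*} [Monoid A] [Monoid B] [FunLike F A B]
    [MulHomClass F A B] (f : F) (a : ι → A) {l : List ι} (hl : l ≠ []) :
    f (l.map a).prod = (l.map fun i => f (a i)).prod := by
  induction l with
  | nil => exact absurd rfl hl
  | cons i l ih =>
    rcases eq_or_ne l [] with rfl | h
    · simp
    · simp [map_mul, ih h]

namespace TracialState

variable {A : Type*} [CStarAlgebra A] (T : TracialState A) {F : Filter ℕ}

theorem exists_norm_prod_le {ι : Type*} {y : ℕ → ι → A} {C : ℝ} (hy : ∀ m i, ‖y m i‖ ≤ C)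
    (l : List ι) : ∃ B : ℝ, ∀ m, ‖(l.map (y m)).prod‖ ≤ B := by
  induction l with
  | nil => exact ⟨‖(1 : A)‖, fun m => by simp⟩
  | cons i l ih =>
    obtain ⟨B, hB⟩ := ih
    refine ⟨C * B, fun m => ?_⟩
    rw [List.map_cons, List.prod_cons]
    exact (norm_mul_le _ _).trans (mul_le_mul (hy m i) (hB m) (norm_nonneg _)
      ((norm_nonneg _).trans (hy m i)))

/-- Limits of moments do not change under norm bounded 2-norm small perturbations. The letters are
exchanged one at a time; the letters still to be exchanged are controlled in the 2-norm, by
their own moments, since no norm bound is available for them. -/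
theorem tendsto_moments {ι : Type*} {a y : ℕ → ι → A} {C : ℝ} {c : List ι → ℂ}
    (ha : ∀ m i, IsSelfAdjoint (a m i)) (hy : ∀ m i, ‖y m i‖ ≤ C)
    (hya : ∀ i, Tendsto (fun m => T.norm2 (y m i - a m i)) F (𝓝 0))
    (hc : ∀ l : List ι, Tendsto (fun m => T.toFun (l.map (a m)).prod) F (𝓝 (c l)))
    (l : List ι) : Tendsto (fun m => T.toFun (l.map (y m)).prod) F (𝓝 (c l)) := by
  have key : ∀ u w : List ι, Tendsto
      (fun m => T.toFun ((u.map (y m)).prod * (w.map (a m)).prod)) F (𝓝 (c (u ++ w))) := by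
    intro u
    induction u using List.reverseRecOn with
    | nil =>
      intro w
      simpa using hc w
    | append_singleton v i ih =>
      intro w
      have h1 := ih (i :: w)
      have h2 : Tendsto (fun m => T.norm2 (w.map (a m)).prod) F
          (𝓝 (Real.sqrt (c (w.reverse ++ w)).re)) := by
        have h := (Real.continuous_sqrt.tendsto _).comp
          ((Complex.continuous_re.tendsto _).comp (hc (w.reverse ++ w)))
        refine h.congr fun m => ?_
        simp only [Function.comp_apply, norm2, star_prod_map (ha m), List.map_append,
          List.prod_append]
      obtain ⟨B, hB⟩ := exists_norm_prod_le hy v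
      have h3 : Tendsto (fun m => T.toFun ((v.map (y m)).prod * (y m i - a m i) *
          (w.map (a m)).prod)) F (𝓝 0) := by
        have h4 := ((hya i).const_mul B).mul h2
        rw [mul_zero, zero_mul] at h4
        refine squeeze_zero_norm (fun m => ?_) h4
        refine (T.norm_apply_mul_le _ _).trans (mul_le_mul_of_nonneg_right ?_ (T.norm2_nonneg _))
        exact (T.norm2_mul_le _ _).trans (mul_le_mul_of_nonneg_right (hB m) (T.norm2_nonneg _))
      have h5 := h1.add h3
      rw [add_zero] at h5
      rw [List.append_assoc, List.singleton_append]
      refine h5.congr fun m => ?_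
      rw [← map_add]
      congr 1
      simp only [List.map_append, List.prod_append, List.map_cons, List.prod_cons, List.map_nil,
        List.prod_nil, mul_one]
      noncomm_ring
  simpa using key l []

/-- If the even moments of `a m` converge to numbers `c L` which grow at most like `D^(2L+2)` with
`D < C`, then the truncations `b m` of `a m` at `C` approach `a m` in the 2-norm. -/
theorem tendsto_truncation {a b : ℕ → A} {C D : ℝ} (hD : 0 ≤ D) (hDC : D < C)
    (hab : ∀ m L, T.norm2 (b m - a m) ^ 2 ≤ (T.toFun (a m ^ (2 * L + 2))).re / C ^ (2 * L))
    {c : ℕ → ℂ} (hc : ∀ L, Tendsto (fun m => T.toFun (a m ^ (2 * L + 2))) F (𝓝 (c L)))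
    (hcD : ∀ L, ‖c L‖ ≤ D ^ (2 * L + 2)) :
    Tendsto (fun m => T.norm2 (b m - a m)) F (𝓝 0) := by
  have hC : 0 < C := hD.trans_lt hDC
  rw [Metric.tendsto_nhds]
  intro ε hε
  have h1 : Tendsto (fun L : ℕ => D ^ 2 * ((D / C) ^ 2) ^ L) atTop (𝓝 0) := by
    have h := (tendsto_pow_atTop_nhds_zero_of_lt_one (r := (D / C) ^ 2) (by positivity)
      (pow_lt_one₀ (by positivity) ((div_lt_one hC).2 hDC) two_ne_zero)).const_mul (D ^ 2)
    rwa [mul_zero] at h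
  obtain ⟨L, hL⟩ := (h1.eventually_lt_const (show 0 < ε ^ 2 by positivity)).exists
  have h2 : (c L).re / C ^ (2 * L) < ε ^ 2 := by
    refine lt_of_le_of_lt ?_ hL
    rw [div_pow, div_pow, ← pow_mul, ← pow_mul, mul_div_assoc', ← pow_add, add_comm 2]
    exact div_le_div_of_nonneg_right ((Complex.re_le_norm _).trans (hcD L)) (by positivity)
  have h3 := ((Complex.continuous_re.tendsto _).comp (hc L)).div_const (C ^ (2 * L))
  filter_upwards [h3.eventually_lt_const h2] with m hm
  rw [Real.dist_eq, sub_zero, abs_of_nonneg (T.norm2_nonneg _)]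
  exact lt_of_pow_lt_pow_left₀ 2 hε.le ((hab m L).trans_lt hm)

end TracialState

variable {H : Type*} [NormedAddCommGroup H] [InnerProductSpace ℂ H] [CompleteSpace H]
  {M : VonNeumannAlgebra H} {φ : FaithfulNormalTrace M} {n : ℕ} {X : Fin n → M.toStarSubalgebra}

theorem norm_normTrace_sub_lt {m k : ℕ} {γ : ℝ} {ξ : Fin n → Matrix (Fin k) (Fin k) ℂ}
    (hξ : ξ ∈ microstateSpace φ X m k γ) {l : List (Fin n)} (hl : l ≠ []) (hm : l.length ≤ m) :
    ‖normTrace (l.map ξ).prod - φ.toFun (l.map X).prod‖ < γ := by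
  have h := hξ.2 l.length (List.length_pos_iff.2 hl) hm l.get
  have e1 : (List.ofFn fun j => ξ (l.get j)) = l.map ξ := by
    conv_rhs => rw [← List.ofFn_get l, List.map_ofFn]
    rfl
  have e2 : (List.ofFn fun j => X (l.get j)) = l.map X := by
    conv_rhs => rw [← List.ofFn_get l, List.map_ofFn]
    rfl
  rwa [e1, e2] at h

/-- The 2-norm of a microstate is bounded by its second moments. -/
theorem norm2_le_of_mem_microstateSpace {m k : ℕ} [Nonempty (Fin k)] {γ C : ℝ}
    {ξ : Fin n → Matrix (Fin k) (Fin k) ℂ} (hξ : ξ ∈ microstateSpace φ X m k γ) (hm : 2 ≤ m)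
    (hγ : γ ≤ 1) {i : Fin n} (hC : ‖X i‖ ≤ C) : (matrixState (Fin k)).norm2 (ξ i) ≤ C + 1 := by
  have hC0 : 0 ≤ C := (norm_nonneg _).trans hC
  have h := norm_normTrace_sub_lt hξ (l := [i, i]) (by simp) hm
  simp only [List.map_cons, List.map_nil, List.prod_cons, List.prod_nil, mul_one] at h
  have h1 : ‖φ.toFun (X i * X i)‖ ≤ C * C :=
    (φ.toTracialState.norm_apply_le _).trans <| (φ.toTracialState.norm2_le_norm _).trans <|
      (norm_mul_le _ _).trans (mul_le_mul hC hC (norm_nonneg _) hC0)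
  refine (sq_le_sq₀ (TracialState.norm2_nonneg _ _) (by positivity)).1 ?_
  have e : star (ξ i) = ξ i := (hξ.1 i)
  rw [TracialState.norm2_sq, e, matrixState_apply]
  have h2 := (Complex.re_le_norm (normTrace (ξ i * ξ i))).trans
    (norm_le_norm_add_norm_sub' _ (φ.toFun (X i * X i)))
  nlinarith

/-- Almost unital images of microstates have the right moments in the limit: the pullback of the
trace is a multiple of the normalized trace, by a factor which tends to `1`. -/
theorem tendsto_moments_of_microstates {A : Type*} [CStarAlgebra A] (T : TracialState A)
    {k : ℕ → ℕ} (hk : ∀ m, 1 ≤ k m) {ξ : ∀ m, Fin n → Matrix (Fin (k m)) (Fin (k m)) ℂ}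
    (hξ : ∀ m, ξ m ∈ microstateSpace φ X m (k m) (1 / (m + 1)))
    (f : ∀ m, Matrix (Fin (k m)) (Fin (k m)) ℂ →⋆ₙₐ[ℂ] A)
    (hf : ∀ m, T.norm2 (1 - f m 1) < 1 / (m + 1)) (l : List (Fin n)) :
    Tendsto (fun m => T.toFun (l.map fun i => f m (ξ m i)).prod) atTop
      (𝓝 (φ.toFun (l.map X).prod)) := by
  rcases eq_or_ne l [] with rfl | hl
  · simp [T.map_one, φ.map_one]
  have e : ∀ m, T.toFun (l.map fun i => f m (ξ m i)).prod =
      T.toFun (f m 1) * normTrace (l.map (ξ m)).prod := by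
    intro m
    have : Nonempty (Fin (k m)) := ⟨⟨0, hk m⟩⟩
    rw [← map_prod_of_ne_nil (f m) (ξ m) hl]
    exact eq_mul_normTrace
      (T.toFun.comp (f m : Matrix (Fin (k m)) (Fin (k m)) ℂ →ₗ[ℂ] A)) (fun x y => by
      change T.toFun (f m (x * y)) = T.toFun (f m (y * x))
      rw [map_mul (f m), map_mul (f m), T.tracial]) _
  have h0 : Tendsto (fun m : ℕ => 1 / ((m : ℝ) + 1)) atTop (𝓝 0) :=
    tendsto_one_div_add_atTop_nhds_zero_nat
  have h1 : Tendsto (fun m => T.toFun (f m 1)) atTop (𝓝 1) := by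
    rw [tendsto_iff_norm_sub_tendsto_zero]
    refine squeeze_zero (fun m => norm_nonneg _) (fun m => ?_) h0
    rw [norm_sub_rev, ← T.map_one, ← map_sub]
    exact (T.norm_apply_le _).trans (hf m).le
  have h2 : Tendsto (fun m => normTrace (l.map (ξ m)).prod) atTop
      (𝓝 (φ.toFun (l.map X).prod)) := by
    rw [tendsto_iff_norm_sub_tendsto_zero]
    refine squeeze_zero' (Eventually.of_forall fun m => norm_nonneg _) ?_ h0
    filter_upwards [eventually_ge_atTop l.length] with m hm
    exact (norm_normTrace_sub_lt (hξ m) hl hm).le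
  have h3 := h1.mul h2
  rw [one_mul] at h3
  exact h3.congr fun m => (e m).symm

end Moments

/-! ### From conjugate embeddings to conjugate microstates -/

section Conjugacy

open Filter Topology

/-- A unitary `w` close to an intertwiner `v` of `y₀`, `y₁` almost conjugates `a₀` to `a₁`, if `yᵢ`
is close to `aᵢ`. Norm bounds are needed for `yᵢ` only. -/
theorem TracialState.norm2_conjugate_sub_le {A : Type*} [CStarAlgebra A] (T : TracialState A)
    {w v a₀ a₁ y₀ y₁ : A} {C δ e : ℝ} (hw : star w * w = 1) (hw' : w * star w = 1)
    (hy₀ : ‖y₀‖ ≤ C) (hy₁ : ‖y₁‖ ≤ C) (h₀ : T.norm2 (y₀ - a₀) ≤ δ) (h₁ : T.norm2 (y₁ - a₁) ≤ δ)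
    (hv : T.norm2 (y₁ * v - v * y₀) ≤ δ) (hwv : T.norm2 (w - v) ≤ e) :
    T.norm2 (w * a₀ * star w - a₁) ≤ 3 * δ + 2 * (C * e) := by
  have e1 : w * a₀ * star w - a₁ = (w * a₀ - a₁ * w) * star w := by
    rw [sub_mul, mul_assoc a₁, hw', mul_one]
  have e2 : w * a₀ - a₁ * w = -(w * (y₀ - a₀)) + (w - v) * y₀ - (y₁ * v - v * y₀)
      - y₁ * (w - v) + (y₁ - a₁) * w := by noncomm_ring
  rw [e1, T.norm2_mul_unitary (by rwa [star_star]), e2]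
  have b1 : T.norm2 (-(w * (y₀ - a₀))) ≤ δ := by rwa [T.norm2_neg, T.norm2_unitary_mul hw]
  have b2 : T.norm2 ((w - v) * y₀) ≤ e * C :=
    (T.norm2_mul_le' _ _).trans (mul_le_mul hwv hy₀ (norm_nonneg _)
      ((T.norm2_nonneg _).trans hwv))
  have b3 : T.norm2 (y₁ * (w - v)) ≤ C * e :=
    (T.norm2_mul_le _ _).trans (mul_le_mul hy₁ hwv (T.norm2_nonneg _)
      ((norm_nonneg _).trans hy₁))
  have b4 : T.norm2 ((y₁ - a₁) * w) ≤ δ := by rwa [T.norm2_mul_unitary hw']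
  have c1 := T.norm2_add_le (-(w * (y₀ - a₀)) + (w - v) * y₀ - (y₁ * v - v * y₀) - y₁ * (w - v))
    ((y₁ - a₁) * w)
  have c2 := T.norm2_sub_le (-(w * (y₀ - a₀)) + (w - v) * y₀ - (y₁ * v - v * y₀)) (y₁ * (w - v))
  have c3 := T.norm2_sub_le (-(w * (y₀ - a₀)) + (w - v) * y₀) (y₁ * v - v * y₀)
  have c4 := T.norm2_add_le (-(w * (y₀ - a₀))) ((w - v) * y₀)
  linarith

/-- The factor `n + 1` in place of `√n` avoids a division by zero for the empty tuple. -/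
theorem tupleNorm₂_lt {n : ℕ} {ι : Type*} [Fintype ι] [DecidableEq ι] [Nonempty ι]
    {ζ : Fin n → Matrix ι ι ℂ} {ε : ℝ} (hε : 0 < ε)
    (h : ∀ i, (matrixState ι).norm2 (ζ i) ≤ ε / (n + 1)) : tupleNorm₂ ζ < ε := by
  rw [tupleNorm₂, Real.sqrt_lt' hε]
  have h1 : ∀ i ∈ Finset.univ, (normTrace (star (ζ i) * ζ i)).re ≤ (ε / (n + 1)) ^ 2 := by
    intro i _
    have e := (matrixState ι).norm2_sq (ζ i)
    rw [matrixState_apply] at e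
    rw [← e]
    exact pow_le_pow_left₀ (TracialState.norm2_nonneg _ _) (h i) 2
  refine (Finset.sum_le_card_nsmul _ _ _ h1).trans_lt ?_
  rw [Finset.card_univ, Fintype.card_fin, nsmul_eq_mul, div_pow, mul_div_assoc',
    div_lt_iff₀ (by positivity), mul_comm]
  have h2 : (0 : ℝ) < ε ^ 2 := by positivity
  have h3 : (0 : ℝ) ≤ n := Nat.cast_nonneg n
  refine mul_lt_mul_of_pos_left ?_ h2
  nlinarith

variable {H : Type*} [NormedAddCommGroup H] [InnerProductSpace ℂ H] [CompleteSpace H]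
  {K : Type*} [NormedAddCommGroup K] [InnerProductSpace ℂ K] [CompleteSpace K]
  {M : VonNeumannAlgebra H} {φ : FaithfulNormalTrace M} {n : ℕ} {X : Fin n → M.toStarSubalgebra}
  {R : VonNeumannAlgebra K} {τ : FaithfulNormalTrace R} {ω : Ultrafilter ℕ}

/-- Better and better microstates, mapped almost unitally to `R` and truncated, define an
embedding of the von Neumann algebra they approximate. -/
theorem exists_isEmbedding_of_microstates (hω : (ω : Filter ℕ) ≤ cofinite)
    (hX : ∀ i, IsSelfAdjoint (X i))
    (hgen : Set.centralizer (Set.centralizer (Set.range fun i => (X i : H →L[ℂ] H))) =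
      (M : Set (H →L[ℂ] H)))
    {k : ℕ → ℕ} (hk : ∀ m, 1 ≤ k m) {ξ : ∀ m, Fin n → Matrix (Fin (k m)) (Fin (k m)) ℂ}
    (hξ : ∀ m, ξ m ∈ microstateSpace φ X m (k m) (1 / (m + 1)))
    (f : ∀ m, Matrix (Fin (k m)) (Fin (k m)) ℂ →⋆ₙₐ[ℂ] R.toStarSubalgebra)
    (hf : ∀ m, τ.toTracialState.norm2 (1 - f m 1) < 1 / (m + 1))
    {C : ℝ} (hC : ∀ i, ‖X i‖ < C) :
    ∃ y : Fin n → boundedSeq R, (∀ i m, ‖(y i).1 m‖ ≤ C) ∧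
      (∀ i, Tendsto (fun m => τ.toTracialState.norm2 ((y i).1 m - f m (ξ m i))) ω (𝓝 0)) ∧
      ∃ σ : M.toStarSubalgebra →⋆ₐ[ℂ] Ultrapower τ ω, IsEmbedding φ τ ω σ ∧
        ∀ i, σ (X i) = Ultrapower.mk τ ω (y i) := by
  set T := τ.toTracialState
  have hωt : (ω : Filter ℕ) ≤ atTop := by rwa [← Nat.cofinite_eq_atTop]
  have ha : ∀ m i, IsSelfAdjoint (f m (ξ m i)) := by
    intro m i
    have h : star (ξ m i) = ξ m i := (hξ m).1 i
    rw [IsSelfAdjoint, ← map_star, h]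
  have hmom := fun l => (tendsto_moments_of_microstates T hk hξ f hf l).mono_left hωt
  have htr : ∀ m i, ∃ b : R.toStarSubalgebra, IsSelfAdjoint b ∧ ‖b‖ ≤ C ∧
      ∀ L : ℕ, T.norm2 (b - f m (ξ m i)) ^ 2 ≤
        (T.toFun (f m (ξ m i) ^ (2 * L + 2))).re / C ^ (2 * L) := fun m i =>
    T.exists_truncation (ha m i) ((norm_nonneg _).trans_lt (hC i))
  choose b hb hbC hba using htr
  have hlim : ∀ i, Tendsto (fun m => T.norm2 (b m i - f m (ξ m i))) ω (𝓝 0) := by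
    intro i
    refine T.tendsto_truncation (norm_nonneg (X i)) (hC i) (fun m L => hba m i L)
      (c := fun L => φ.toFun (X i ^ (2 * L + 2))) (fun L => ?_) (fun L => ?_)
    · simpa using hmom (List.replicate (2 * L + 2) i)
    · exact (φ.toTracialState.norm_apply_le _).trans
        ((φ.toTracialState.norm2_le_norm _).trans (norm_pow_le' _ (by omega)))
  have hmom' := T.tendsto_moments ha hbC hlim hmom
  let y : Fin n → boundedSeq R := fun i => ⟨fun m => b m i, C, fun m => hbC m i⟩
  have hprod : ∀ (l : List (Fin n)) (m : ℕ), (l.map y).prod.1 m = (l.map (b m)).prod := by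
    intro l m
    induction l with
    | nil => rfl
    | cons i l ih =>
      rw [List.map_cons, List.prod_cons, List.map_cons, List.prod_cons, ← ih]
      rfl
  refine ⟨y, fun i m => hbC m i, hlim, ?_⟩
  refine exists_isEmbedding hω hX hgen (Y := fun i => Ultrapower.mk τ ω (y i)) (fun i => ?_)
    fun l => ?_
  · have h : star (y i) = y i := Subtype.ext (funext fun m => hb m i)
    rw [IsSelfAdjoint, Ultrapower.star_mk, h]
  · have e : (l.map fun i => Ultrapower.mk τ ω (y i)).prod =
        Ultrapower.mk τ ω (l.map y).prod := by
      rw [map_list_prod (Ultrapower.mk τ ω), List.map_map]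
      rfl
    rw [e]
    refine Ultrapower.trace_eq_of_tendsto τ ω ((hmom' l).congr fun m => ?_)
    rw [hprod]
    rfl

/-- The choice of the precision `δ` of all approximations, for a given total error `η`. -/
theorem exists_pos_error_lt (C B : ℝ) {η : ℝ} (hη : 0 < η) :
    ∃ δ : ℝ, 0 < δ ∧ 3 * δ + 2 * (C * (Real.sqrt (2 * δ) + δ)) + B * δ < η := by
  have h : Continuous fun δ : ℝ => 3 * δ + 2 * (C * (Real.sqrt (2 * δ) + δ)) + B * δ := by
    fun_prop
  have h0 := (h.tendsto 0).mono_left (nhdsWithin_le_nhds (s := Set.Ioi 0))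
  simp only [mul_zero, Real.sqrt_zero, add_zero] at h0
  obtain ⟨δ, h1, h2⟩ := ((h0.eventually_lt_const hη).and self_mem_nhdsWithin).exists
  exact ⟨δ, h2, h1⟩

theorem mul_eq_of_conjugate {A : Type*} [Monoid A] {p u q s : A} (h : p = u * q * s)
    (hs : s * u = 1) : p * u = u * q := by
  rw [h, mul_assoc, hs, mul_one]

/-- A lift of the unitary which conjugates two embeddings. -/
theorem UnitarilyConjugate.exists_intertwiner {σ π : M.toStarSubalgebra →⋆ₐ[ℂ] Ultrapower τ ω}
    (h : UnitarilyConjugate σ π) {y z : Fin n → boundedSeq R}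
    (hσ : ∀ i, σ (X i) = Ultrapower.mk τ ω (y i)) (hπ : ∀ i, π (X i) = Ultrapower.mk τ ω (z i)) :
    ∃ v : boundedSeq R,
      Tendsto (fun m => τ.toTracialState.norm2 (star (v.1 m) * v.1 m - 1)) ω (𝓝 0) ∧
      ∀ i, Tendsto (fun m => τ.toTracialState.norm2 ((y i).1 m * v.1 m - v.1 m * (z i).1 m)) ω
        (𝓝 0) := by
  obtain ⟨u, hu, hσu⟩ := h
  obtain ⟨v, rfl⟩ := Ultrapower.mk_surjective τ ω u
  obtain ⟨hu1, -⟩ := Unitary.mem_iff.1 hu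
  rw [Ultrapower.star_mk] at hu1
  refine ⟨v, ?_, fun i => ?_⟩
  · have e1 : Ultrapower.mk τ ω (star v * v) = Ultrapower.mk τ ω (star v) * Ultrapower.mk τ ω v :=
      map_mul (Ultrapower.mk τ ω) (star v) v
    have e2 : Ultrapower.mk τ ω 1 = 1 := map_one (Ultrapower.mk τ ω)
    have e : IsNull τ ω (star v * v - 1) :=
      (Ultrapower.mk_eq_mk_iff τ ω (star v * v) 1).1 (by rw [e1, e2, hu1])
    exact e
  · have e1 : Ultrapower.mk τ ω (y i * v) = Ultrapower.mk τ ω (y i) * Ultrapower.mk τ ω v :=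
      map_mul (Ultrapower.mk τ ω) (y i) v
    have e2 : Ultrapower.mk τ ω (v * z i) = Ultrapower.mk τ ω v * Ultrapower.mk τ ω (z i) :=
      map_mul (Ultrapower.mk τ ω) v (z i)
    have e3 : Ultrapower.mk τ ω (y i) =
        Ultrapower.mk τ ω v * Ultrapower.mk τ ω (z i) * Ultrapower.mk τ ω (star v) := by
      rw [← hσ, ← hπ, hσu, Ultrapower.star_mk]
    have e : IsNull τ ω (y i * v - v * z i) :=
      (Ultrapower.mk_eq_mk_iff τ ω (y i * v) (v * z i)).1
        (e1.trans ((mul_eq_of_conjugate e3 hu1).trans e2.symm))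
    exact e

/-- If all embeddings into the ultrapower of an algebra exhausted by matrix algebras are conjugate,
then every generating tuple is quasitubular. -/
theorem isQuasitubular_of_unitarilyConjugate (hX : ∀ i, IsSelfAdjoint (X i))
    (hgen : Set.centralizer (Set.centralizer (Set.range fun i => (X i : H →L[ℂ] H))) =
      (M : Set (H →L[ℂ] H)))
    (E : MatrixExhaustion τ) (hω : (ω : Filter ℕ) ≤ cofinite)
    (hconj : ∀ σ π : M.toStarSubalgebra →⋆ₐ[ℂ] Ultrapower τ ω,
      IsEmbedding φ τ ω σ → IsEmbedding φ τ ω π → UnitarilyConjugate σ π) :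
    IsQuasitubular φ X := by
  intro ε hε
  by_contra! hneg
  choose k hk ξ hξ hno using fun m : ℕ => hneg m (1 / (m + 1)) (by positivity)
  set T := τ.toTracialState
  have hωt : (ω : Filter ℕ) ≤ atTop := by rwa [← Nat.cofinite_eq_atTop]
  choose j α hα using fun m : ℕ =>
    E.exists_almost_unital (k m) (hk m) (show (0 : ℝ) < 1 / (m + 1) by positivity)
  let f : ∀ m, Matrix (Fin (k m)) (Fin (k m)) ℂ →⋆ₙₐ[ℂ] R.toStarSubalgebra := fun m =>
    (E.β (j m) : _ →⋆ₙₐ[ℂ] R.toStarSubalgebra).comp (α m)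
  have hfα : ∀ m x, f m x = E.β (j m) (α m x) := fun m x => rfl
  have hf : ∀ m, T.norm2 (1 - f m 1) < 1 / (m + 1) := by
    intro m
    rw [hfα, ← map_one (E.β (j m)), ← map_sub, E.norm2_β]
    exact hα m
  set C : ℝ := 1 + ∑ i, ‖X i‖ with hCdef
  have hC : ∀ i, ‖X i‖ < C := by
    intro i
    have := Finset.single_le_sum (f := fun i => ‖X i‖) (fun i _ => norm_nonneg _)
      (Finset.mem_univ i)
    linarith
  choose y hyC hyf σ hσ hσy using fun s : Fin 2 =>
    exists_isEmbedding_of_microstates hω hX hgen hk (fun m => hξ m s) f hf hC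
  obtain ⟨v, hv, hyv⟩ := (hconj (σ 1) (σ 0) (hσ 1) (hσ 0)).exists_intertwiner (hσy 1) (hσy 0)
  have hη : 0 < ε / (n + 1) := by positivity
  obtain ⟨δ, hδ, hδε⟩ := exists_pos_error_lt C (2 * (C + 1)) hη
  have hev : ∀ᶠ m : ℕ in (ω : Filter ℕ), (2 ≤ m ∧ 1 / ((m : ℝ) + 1) < δ) ∧
      T.norm2 (star (v.1 m) * v.1 m - 1) < δ ∧
      (∀ i, T.norm2 ((y 1 i).1 m * v.1 m - v.1 m * (y 0 i).1 m) < δ) ∧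
      ∀ s i, T.norm2 ((y s i).1 m - f m (ξ m s i)) < δ := by
    have h1 : ∀ᶠ m : ℕ in (ω : Filter ℕ), 2 ≤ m := hωt (eventually_ge_atTop 2)
    have h2 : ∀ᶠ m : ℕ in (ω : Filter ℕ), 1 / ((m : ℝ) + 1) < δ :=
      hωt (tendsto_one_div_add_atTop_nhds_zero_nat.eventually_lt_const hδ)
    exact (h1.and h2).and ((hv.eventually_lt_const hδ).and
      ((eventually_all.2 fun i => (hyv i).eventually_lt_const hδ).and
        (eventually_all.2 fun s => eventually_all.2 fun i => (hyf s i).eventually_lt_const hδ)))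
  obtain ⟨m, ⟨hm2, hmδ⟩, hvm, hyvm, hyfm⟩ := hev.exists
  have : Nonempty (Fin (k m)) := ⟨⟨0, hk m⟩⟩
  obtain ⟨i, W, hW, hji, hWv⟩ := E.exists_unitary (j m) hδ hvm.le
  obtain ⟨g, hg⟩ := E.compat (j m) i hji
  let α' : Matrix (Fin (k m)) (Fin (k m)) ℂ →⋆ₙₐ[ℂ] Matrix (Fin (E.r i)) (Fin (E.r i)) ℂ :=
    (g : _ →⋆ₙₐ[ℂ] Matrix (Fin (E.r i)) (Fin (E.r i)) ℂ).comp (α m)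
  have hα' : ∀ x, E.β i (α' x) = f m x := fun x => hg (α m x)
  have hα1 : (matrixState (Fin (E.r i))).norm2 (1 - α' 1) ≤ δ := by
    rw [← E.norm2_β, map_sub, map_one, hα']
    exact ((hf m).trans hmδ).le
  obtain ⟨hW1, hW2⟩ := Unitary.mem_iff.1 hW
  obtain ⟨U, hU, hUξ⟩ := exists_unitary_kronecker α' hW
  refine (hno m (E.r i) (E.pos i) U hU 0 1 (by decide)).not_gt (tupleNorm₂_lt hε fun l => ?_)
  refine (hUξ (ξ m 1 l) (ξ m 0 l)).trans (le_trans ?_ hδε.le)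
  have b1 : (matrixState (Fin (E.r i))).norm2 (W * α' (ξ m 0 l) * star W - α' (ξ m 1 l)) ≤
      3 * δ + 2 * (C * (Real.sqrt (2 * δ) + δ)) := by
    rw [← E.norm2_β, map_sub, map_mul (E.β i), map_mul (E.β i), map_star, hα', hα']
    refine T.norm2_conjugate_sub_le ?_ ?_ (hyC 0 l m) (hyC 1 l m) (hyfm 0 l).le (hyfm 1 l).le
      (hyvm l).le hWv
    · rw [← map_star, ← map_mul, hW1, map_one]
    · rw [← map_star, ← map_mul, hW2, map_one]
  have hγ : (1 : ℝ) / (m + 1) ≤ 1 := by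
    rw [div_le_one (by positivity)]
    linarith [(Nat.cast_nonneg m : (0 : ℝ) ≤ m)]
  have b2 : ∀ s, (matrixState (Fin (k m))).norm2 (ξ m s l) ≤ C + 1 := fun s =>
    norm2_le_of_mem_microstateSpace (hξ m s) hm2 hγ (hC l).le
  have hC0 : 0 ≤ C := (norm_nonneg _).trans (hC l).le
  refine add_le_add b1 (mul_le_mul ?_ hα1 (TracialState.norm2_nonneg _ _) (by positivity))
  linarith [b2 0, b2 1]

end Conjugacy

end Microstates

end

open Microstates in
theorem lemma2p5
    {H : Type*} [NormedAddCommGroup H] [InnerProductSpace ℂ H] [CompleteSpace H]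
    {K : Type*} [NormedAddCommGroup K] [InnerProductSpace ℂ K] [CompleteSpace K]
    (M : VonNeumannAlgebra H) (φ : FaithfulNormalTrace M)
    {n : ℕ} (X : Fin n → M.toStarSubalgebra)
    (hX : ∀ i, IsSelfAdjoint (X i))
    (hgen : Set.centralizer (Set.centralizer (Set.range fun i => (X i : H →L[ℂ] H))) =
      (M : Set (H →L[ℂ] H)))
    (R : VonNeumannAlgebra K) (hR : IsHyperfiniteII1Factor R) (τ : FaithfulNormalTrace R)
    (ω : Ultrafilter ℕ) (hω : (ω : Filter ℕ) ≤ Filter.cofinite)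
    (hemb : ∃ π : M.toStarSubalgebra →⋆ₐ[ℂ] Ultrapower τ ω, IsEmbedding φ τ ω π)
    (hconj : ∀ σ π : M.toStarSubalgebra →⋆ₐ[ℂ] Ultrapower τ ω,
      IsEmbedding φ τ ω σ → IsEmbedding φ τ ω π → UnitarilyConjugate σ π) :
    IsQuasitubular φ X := by
  obtain ⟨E⟩ := hR.nonempty_matrixExhaustion τ
  exact isQuasitubular_of_unitarilyConjugate hX hgen E hω hconj
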